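/- Let $d\ge 1$, and equip $\mathbb Z^d$ with the graph norm $\|x\|=\sum_i|x_i|$. Let $(\Omega,\mathcal B^\Omega,\mathbb P^\Omega,\operatorname{dist})$ be a metric space with its Borel $\sigma$-algebra and a probability measure, of finite metric dimension: for some $\nu,C>0$ and every $\epsilon\in(0,1]$, $\Omega$ admits an $\epsilon$-net of cardinality at most $(C/\epsilon)^\nu$. Let $(T^x)_{x\in\mathbb Z^d}$ be an ergodic measure-preserving action of $\mathbb Z^d$ on $\Omega$ whose maps are Lipschitz with constants growing at most polynomially: for some $C>0$ and $q\in\mathbb N$, $\operatorname{dist}(T^x\omega,T^x\omega')\le C(1+\|x\|)^q\operatorname{dist}(\omega,\omega')$ for all $x,\omega,\omega'$ (for instance, an action by isometries). Let $(\Theta,\mathcal B^\Theta,\mathbb P^\Theta)$ be a probability space and let $v(\omega,\theta)$, $\omega\in\Omega$, be a real-valued stochastic process on $\Theta$, all of whose realisations $v(\cdot,\theta)$ are uniformly $\kappa$-Hölder continuous on $\Omega$, for a fixed $\kappa>0$ (with a constant that may depend on $\theta$). Let $A,\eta\in\mathbb R$ with $A\eta<1$ be such that the following hold. $(\mathrm{UPA})_A$: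 there is $c>0$ such that $\inf_{\omega\in\Omega}\min_{0<\|x\|\le L}\operatorname{dist}(T^x\omega,\omega)\ge cL^{-A}$ for all integers $L\ge1$. $(\mathrm{LIB})_\eta$: there are $C>0$ and $\epsilon_0>0$ such that for every $\omega\in\Omega$ and $\epsilon\in(0,\epsilon_0]$ the conditional distribution of $v(\omega,\cdot)$ given the values $v(\omega',\cdot)$ for all $\omega'$ with $\operatorname{dist}(\omega',\omega)\ge\epsilon$ is almost surely absolutely continuous with respect to Lebesgue measure, with a density bounded by $\exp(C\epsilon^{-\eta})$. For $g>0$ let $H(\omega,\theta;g)$ be the operator on $\ell^2(\mathbb Z^d)$ $$(H(\omega,\theta;g)f)(x)=\sum_{\|y-x\|=1}f(y)+g\,v(T^x\omega,\theta)f(x).$$ Then there exist events $\Theta^+(g)\in\mathcal B^\Theta$, $g>0$, with $\mathbb P^\Theta(\Theta^+(g))\to1$ as $g\to+\infty$, such that for every $g>0$, every $\theta\in\Theta^+(g)$ and almost every $\omega\in\Omega$, the spectrum of the self-adjoint operator $H(\omega,\theta;g)$ is pure point (its eigenvectors span a dense subspace of $\ell^2(\mathbb Z^d)$), and every eigenfunction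 $\psi$ satisfies $\sup_{x\in\mathbb Z^d}|\psi(x)|e^{\|x\|}<\infty$. -/

import Mathlib

open MeasureTheory ProbabilityTheory Filter Topology
open scoped ENNReal NNReal

namespace QuasiPeriodic

/-- The graph (`ℓ¹`) norm on the lattice `ℤ^d`. -/
def latticeNorm {d : ℕ} (x : Fin d → ℤ) : ℕ := ∑ i, (x i).natAbs

/-- The Hilbert space `ℓ²(ℤ^d)` of complex square-summable functions. -/
abbrev EllTwo (d : ℕ) : Type := lp (fun _ : Fin d → ℤ => ℂ) 2

/-- The sum of `f` over the nearest neighbours `x ± eᵢ` of `x`, plus `V x * f x`. -/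
def schrodingerExpr {d : ℕ} (V : (Fin d → ℤ) → ℝ) (f : (Fin d → ℤ) → ℂ) :
    (Fin d → ℤ) → ℂ :=
  fun x => (∑ i : Fin d, (f (x + Pi.single i 1) + f (x - Pi.single i 1))) + (V x : ℂ) * f x

theorem schrodingerExpr_add {d : ℕ} (V : (Fin d → ℤ) → ℝ) (f h : (Fin d → ℤ) → ℂ) :
    schrodingerExpr V (f + h) = schrodingerExpr V f + schrodingerExpr V h := by
  funext x
  simp only [schrodingerExpr, Pi.add_apply, Finset.sum_add_distrib]
  ring

theorem schrodingerExpr_smul {d : ℕ} (V : (Fin d → ℤ) → ℝ) (c : ℂ) (f : (Fin d → ℤ) → ℂ) :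
    schrodingerExpr V (c • f) = c • schrodingerExpr V f := by
  funext x
  simp only [schrodingerExpr, Pi.smul_apply, smul_eq_mul, ← mul_add, ← Finset.mul_sum]
  ring

theorem schrodingerExpr_zero {d : ℕ} (V : (Fin d → ℤ) → ℝ) :
    schrodingerExpr V (0 : (Fin d → ℤ) → ℂ) = 0 := by
  funext x
  simp [schrodingerExpr]

/-- The discrete Schrödinger operator with potential `V` on `ℓ²(ℤ^d)`, on its maximal domain
(all of `ℓ²(ℤ^d)` when `V` is bounded). -/
noncomputable def schrodinger {d : ℕ} (V : (Fin d → ℤ) → ℝ) : EllTwo d →ₗ.[ℂ] EllTwo d where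
  domain :=
    { carrier := {f | Memℓp (schrodingerExpr V (f : (Fin d → ℤ) → ℂ)) 2}
      add_mem' := by
        intro f h hf hh
        simp only [Set.mem_ofPred_eq, lp.coeFn_add, schrodingerExpr_add] at *
        exact hf.add hh
      zero_mem' := by
        simp only [Set.mem_ofPred_eq, lp.coeFn_zero, schrodingerExpr_zero]
        exact zero_memℓp
      smul_mem' := by
        intro c f hf
        simp only [Set.mem_ofPred_eq, lp.coeFn_smul, schrodingerExpr_smul] at *
        exact hf.const_smul c }
  toFun :=
    { toFun := fun f => ⟨schrodingerExpr V ((f : EllTwo d) : (Fin d → ℤ) → ℂ), f.2⟩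
      map_add' := by
        intro f h
        ext x
        exact congrFun (schrodingerExpr_add V _ _) x
      map_smul' := by
        intro c f
        ext x
        exact congrFun (schrodingerExpr_smul V c _) x }

/-- `ψ` is an eigenvector of the (partially defined) operator `H` with eigenvalue `E`. -/
def IsEigenvector {K : Type*} [AddCommGroup K] [Module ℂ K] (H : K →ₗ.[ℂ] K) (E : ℂ) (ψ : K) :
    Prop :=
  ψ ≠ 0 ∧ ∃ h : ψ ∈ H.domain, H ⟨ψ, h⟩ = E • ψ

/-- A self-adjoint operator on a Hilbert space has pure point spectrum when its eigenvectors
span a dense subspace. -/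
def HasPurePointSpectrum {K : Type*} [NormedAddCommGroup K] [InnerProductSpace ℂ K]
    [CompleteSpace K] (H : K →ₗ.[ℂ] K) : Prop :=
  IsSelfAdjoint H ∧
    (Submodule.span ℂ {ψ : K | ∃ E : ℂ, IsEigenvector H E ψ}).topologicalClosure = ⊤

/-- For some `ν > 0` and `C > 0`, the space admits for every `ε ∈ (0, 1]` an `ε`-net of
cardinality at most `(C / ε) ^ ν`. -/
def FiniteMetricDimension (Ω : Type*) [MetricSpace Ω] : Prop :=
  ∃ ν : ℝ, 0 < ν ∧ ∃ C : ℝ, 0 < C ∧ ∀ ε : ℝ, 0 < ε → ε ≤ 1 →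
    ∃ N : Finset Ω, (N.card : ℝ) ≤ (C / ε) ^ ν ∧ ∀ ω : Ω, ∃ ω' ∈ N, dist ω ω' ≤ ε

/-- The translations `T^x` are Lipschitz, with constants of at most polynomial growth in `‖x‖`
(for an action by isometries take `C = 1`, `q = 0`). -/
def TemperedAction (d : ℕ) (Ω : Type*) [MetricSpace Ω] [AddAction (Fin d → ℤ) Ω] : Prop :=
  ∃ C : ℝ, 0 < C ∧ ∃ q : ℕ, ∀ (x : Fin d → ℤ) (ω ω' : Ω),
    dist (x +ᵥ ω) (x +ᵥ ω') ≤ C * (1 + (latticeNorm x : ℝ)) ^ q * dist ω ω'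

/-- The Diophantine condition `(UPA)_A`:
`inf_ω min_{0 < ‖x‖ ≤ L} dist (T^x ω) ω ≥ c L ^ (-A)` for all `L`. -/
def UPA (d : ℕ) (Ω : Type*) [MetricSpace Ω] [AddAction (Fin d → ℤ) Ω] (A : ℝ) : Prop :=
  ∃ c : ℝ, 0 < c ∧ ∀ (L : ℕ) (ω : Ω) (x : Fin d → ℤ),
    0 < latticeNorm x → latticeNorm x ≤ L → c * (L : ℝ) ^ (-A) ≤ dist (x +ᵥ ω) ω

/-- The conditional distribution of the random variable `v ω` given the values of the process
`v` outside the `ε`-neighbourhood `{ω' | dist ω' ω < ε}` of `ω`. -/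
noncomputable def condLaw {Ω Θ : Type*} [MetricSpace Ω] [MeasurableSpace Θ] (P : Measure Θ)
    [IsFiniteMeasure P] (v : Ω → Θ → ℝ) (ω : Ω) (ε : ℝ) :
    Kernel ({ω' : Ω // ε ≤ dist ω' ω} → ℝ) ℝ :=
  condDistrib (v ω) (fun θ (ω' : {ω' : Ω // ε ≤ dist ω' ω}) => v ω' θ) P

/-- The local interpolation bound `(LIB)_η`: for `ε ∈ (0, ε₀]`, the conditional distribution of
`v ω` given the values of `v` outside the `ε`-neighbourhood of `ω` almost surely has a density
(with respect to Lebesgue measure) that is bounded by `exp (C ε ^ (-η))`. -/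
def LIB {Ω Θ : Type*} [MetricSpace Ω] [MeasurableSpace Θ] (P : Measure Θ) [IsFiniteMeasure P]
    (v : Ω → Θ → ℝ) (η : ℝ) : Prop :=
  ∃ C : ℝ, 0 < C ∧ ∃ ε₀ : ℝ, 0 < ε₀ ∧ ∀ ε : ℝ, 0 < ε → ε ≤ ε₀ → ∀ ω : Ω, ∀ᵐ θ ∂P,
    ∃ p : ℝ → ℝ≥0∞, Measurable p ∧
      condLaw P v ω ε (fun ω' : {ω' : Ω // ε ≤ dist ω' ω} => v ω' θ) = volume.withDensity p ∧
      ∀ t : ℝ, p t ≤ ENNReal.ofReal (Real.exp (C * ε ^ (-η)))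

/-- `v` is a stochastic process indexed by `Ω`, all of whose realisations are uniformly
`κ`-Hölder continuous functions on `Ω`. -/
def IsHolderProcess {Ω Θ : Type*} [MetricSpace Ω] [MeasurableSpace Θ] (v : Ω → Θ → ℝ)
    (κ : ℝ≥0) : Prop :=
  (∀ ω, Measurable (v ω)) ∧ ∀ θ, ∃ K : ℝ≥0, HolderWith K κ (fun ω => v ω θ)

/-- The operator `H(ω, θ; g)`, with potential `x ↦ g * v (T^x ω, θ)`. -/
noncomputable def hamiltonian {d : ℕ} {Ω Θ : Type*} [AddAction (Fin d → ℤ) Ω]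
    (v : Ω → Θ → ℝ) (g : ℝ) (ω : Ω) (θ : Θ) : EllTwo d →ₗ.[ℂ] EllTwo d :=
  schrodinger (fun x : Fin d → ℤ => g * v (x +ᵥ ω) θ)

end QuasiPeriodic

/-!
Multi-scale analysis. Divide the operator by the coupling and write `γ = g⁻¹`, which is small. A
ball of the lattice is resonant at the energy `E` when the operator restricted to it has an
approximate eigenvector of energy `E` with a tiny error. If a ball is not resonant, solutions of
`(γ Δ + V) ψ = E ψ` contract at its centre; this gives contraction at scale `s + 1` from
contraction at scale `s`, provided that around each site and for each energy at most `J` well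
separated resonances of scale `s` exist, because a solution can be passed over a bounded number of
clusters without much loss.

By `(UPA)` the sites of a window have well separated orbit points, so `(LIB)` bounds the conditional
density of the potential at each of them given the others. Since an eigenvalue moves with the
potential, a resonance at given energy fixes the potential at some site of its ball up to a small
error, whence `p` separated resonances have the `p`-th power of a tiny probability. A grid of
energies makes this uniform in `E`; for `J` large it is also summable over a net of `Ω`, which by
the Hölder continuity of `v` and the polynomial growth of the Lipschitz constants represents all
orbits. Two separated resonances at a common energy are summably rare for each single `ω`, so by
Borel-Cantelli almost every `ω` has none near the origin at large scales. As a slowly growing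
nonzero solution forces a resonance near the origin at every large scale, everything further away
contracts and the solution decays exponentially.

Finally, spectrally almost every energy has a slowly growing generalised eigenfunction: the
spectral transforms of the canonical basis. It decays, so spectrally almost every energy is an
eigenvalue, and as there are only countably many eigenvalues the spectrum is pure point.
-/

namespace QuasiPeriodic

section Lattice

variable {d : ℕ}

theorem latticeNorm_zero : latticeNorm (0 : Fin d → ℤ) = 0 := by simp [latticeNorm]

theorem latticeNorm_neg (x : Fin d → ℤ) : latticeNorm (-x) = latticeNorm x := by
  simp [latticeNorm]

theorem latticeNorm_sub_comm (x y : Fin d → ℤ) : latticeNorm (x - y) = latticeNorm (y - x) := by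
  rw [← latticeNorm_neg, neg_sub]

theorem latticeNorm_add_le (x y : Fin d → ℤ) :
    latticeNorm (x + y) ≤ latticeNorm x + latticeNorm y := by
  unfold latticeNorm
  rw [← Finset.sum_add_distrib]
  exact Finset.sum_le_sum fun i _ => Int.natAbs_add_le _ _

theorem latticeNorm_sub_le (x y z : Fin d → ℤ) :
    latticeNorm (x - z) ≤ latticeNorm (x - y) + latticeNorm (y - z) := by
  simpa using latticeNorm_add_le (x - y) (y - z)

theorem latticeNorm_eq_zero {x : Fin d → ℤ} : latticeNorm x = 0 ↔ x = 0 := by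
  simp [latticeNorm, funext_iff]

theorem natAbs_le_latticeNorm (x : Fin d → ℤ) (i : Fin d) : (x i).natAbs ≤ latticeNorm x :=
  Finset.single_le_sum (f := fun i => (x i).natAbs) (fun _ _ => Nat.zero_le _) (Finset.mem_univ i)

theorem latticeNorm_single (i : Fin d) : latticeNorm (Pi.single i (1 : ℤ)) = 1 := by
  unfold latticeNorm
  rw [Finset.sum_eq_single i] <;> simp +contextual

/-- The ball of radius `r` about `x` in the graph metric. -/
noncomputable def latticeBall (x : Fin d → ℤ) (r : ℕ) : Finset (Fin d → ℤ) :=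
  (Finset.Icc (x - fun _ => (r : ℤ)) (x + fun _ => (r : ℤ))).filter
    fun u => latticeNorm (u - x) ≤ r

theorem mem_latticeBall {x u : Fin d → ℤ} {r : ℕ} :
    u ∈ latticeBall x r ↔ latticeNorm (u - x) ≤ r := by
  unfold latticeBall
  rw [Finset.mem_filter, and_iff_right_iff_imp]
  intro hu
  have hcoord : ∀ i, ((u - x) i).natAbs ≤ r := fun i => (natAbs_le_latticeNorm _ i).trans hu
  rw [Finset.mem_Icc, Pi.le_def, Pi.le_def]
  refine ⟨fun i => ?_, fun i => ?_⟩ <;>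
  · have := hcoord i
    simp only [Pi.sub_apply, Pi.add_apply] at this ⊢
    omega

theorem latticeBall_subset {x y : Fin d → ℤ} {r R : ℕ} (h : latticeNorm (y - x) + r ≤ R) :
    latticeBall y r ⊆ latticeBall x R := fun w hw => by
  rw [mem_latticeBall] at hw ⊢
  have := latticeNorm_sub_le w y x
  omega

theorem self_mem_latticeBall (x : Fin d → ℤ) (r : ℕ) : x ∈ latticeBall x r := by
  simp [mem_latticeBall, latticeNorm_zero]

theorem latticeBall_zero (x : Fin d → ℤ) : latticeBall x 0 = {x} := by
  ext u
  simp [mem_latticeBall, latticeNorm_eq_zero, sub_eq_zero]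

theorem card_latticeBall_le (x : Fin d → ℤ) (r : ℕ) :
    (latticeBall x r).card ≤ (2 * r + 1) ^ d := by
  refine (Finset.card_filter_le _ _).trans ?_
  rw [Pi.card_Icc]
  simp only [Pi.add_apply, Pi.sub_apply, Int.card_Icc]
  refine (Finset.prod_le_pow_card _ _ (2 * r + 1) fun i _ => ?_).trans (by simp)
  omega

end Lattice

theorem exists_card_le_forall_exists_rel {α : Type*} {r : α → α → Prop}
    (hr : ∀ x y, r x y → r y x) {J : ℕ} {Z : Set α}
    (h : ¬ ∃ u : Fin (J + 1) → α, (∀ i, u i ∈ Z) ∧ Pairwise fun i j => ¬ r (u i) (u j)) :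
    ∃ C : Finset α, C.card ≤ J ∧ ∀ z ∈ Z, ∃ c ∈ C, r z c := by
  classical
  induction J generalizing Z with
  | zero =>
    refine ⟨∅, le_rfl, fun z hz => (h ⟨fun _ => z, fun _ => hz, fun i j hij => ?_⟩).elim⟩
    exact (hij (Subsingleton.elim (α := Fin 1) i j)).elim
  | succ J ih =>
    rcases Z.eq_empty_or_nonempty with rfl | ⟨z₀, hz₀⟩
    · exact ⟨∅, by simp, by simp⟩
    obtain ⟨C, hC, hcover⟩ := ih (Z := {z ∈ Z | ¬ r z z₀}) fun ⟨u, huZ, hu⟩ => by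
      refine h ⟨Fin.cons z₀ u, Fin.cases hz₀ fun i => (huZ i).1, fun i j => ?_⟩
      cases i using Fin.cases with
      | zero => cases j using Fin.cases with
        | zero => exact fun hij => (hij rfl).elim
        | succ j => exact fun _ hr' => (huZ j).2 (hr _ _ hr')
      | succ i => cases j using Fin.cases with
        | zero => exact fun _ => (huZ i).2
        | succ j => exact fun hij => hu fun hij' => hij (congrArg Fin.succ hij')
    refine ⟨insert z₀ C, (Finset.card_insert_le _ _).trans (by omega), fun z hz => ?_⟩
    by_cases hzz₀ : r z z₀
    · exact ⟨z₀, Finset.mem_insert_self _ _, hzz₀⟩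
    · obtain ⟨c, hc, hzc⟩ := hcover z ⟨hz, hzz₀⟩
      exact ⟨c, Finset.mem_insert_of_mem hc, hzc⟩

section Solutions

variable {d : ℕ}

/-- The sum of `f` over the nearest neighbours of `x`. -/
def neighborSum (f : (Fin d → ℤ) → ℝ) (x : Fin d → ℤ) : ℝ :=
  ∑ i : Fin d, (f (x + Pi.single i 1) + f (x - Pi.single i 1))

/-- The difference expression `γ Δ + V` on real functions. The coupling is moved from the potential
to the hopping term, so that the strong coupling regime is `γ = g⁻¹ → 0`. -/
def realSchrodinger (γ : ℝ) (V f : (Fin d → ℤ) → ℝ) (x : Fin d → ℤ) : ℝ :=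
  γ * neighborSum f x + V x * f x

/-- `ψ` solves the eigenvalue equation `(γ Δ + V) ψ = E ψ` at the sites of `S`. -/
def IsSolutionOn (γ : ℝ) (V : (Fin d → ℤ) → ℝ) (E : ℝ) (ψ : (Fin d → ℤ) → ℝ)
    (S : Set (Fin d → ℤ)) : Prop :=
  ∀ x ∈ S, realSchrodinger γ V ψ x = E * ψ x

/-- `f` is a normalised function supported in the finite set `B` which solves the eigenvalue
equation of the restriction of `γ Δ + V` to `B` with an error of `ℓ²` norm at most `δ`. -/
structure IsApproxEigenvector (γ : ℝ) (V : (Fin d → ℤ) → ℝ) (B : Finset (Fin d → ℤ)) (E δ : ℝ)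
    (f : (Fin d → ℤ) → ℝ) : Prop where
  eq_zero_of_notMem : ∀ x ∉ B, f x = 0
  sum_sq : ∑ x ∈ B, f x ^ 2 = 1
  sum_sq_sub_le : ∑ x ∈ B, (realSchrodinger γ V f x - E * f x) ^ 2 ≤ δ ^ 2

/-- The restriction of `γ Δ + V` to the finite set `B` has an approximate eigenvector with energy
`E` and error at most `δ`; equivalently, an eigenvalue in `[E - δ, E + δ]`. -/
def IsResonant (γ : ℝ) (V : (Fin d → ℤ) → ℝ) (B : Finset (Fin d → ℤ)) (E δ : ℝ) : Prop :=
  ∃ f, IsApproxEigenvector γ V B E δ f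

theorem neighborSum_sub (f h : (Fin d → ℤ) → ℝ) (x : Fin d → ℤ) :
    neighborSum (f - h) x = neighborSum f x - neighborSum h x := by
  simp only [neighborSum, ← Finset.sum_sub_distrib, Pi.sub_apply]
  exact Finset.sum_congr rfl fun i _ => by ring

theorem neighborSum_smul (c : ℝ) (f : (Fin d → ℤ) → ℝ) (x : Fin d → ℤ) :
    neighborSum (c • f) x = c * neighborSum f x := by
  simp only [neighborSum, Finset.mul_sum, Pi.smul_apply, smul_eq_mul, mul_add]

theorem realSchrodinger_sub (γ : ℝ) (V f h : (Fin d → ℤ) → ℝ) (x : Fin d → ℤ) :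
    realSchrodinger γ V (f - h) x = realSchrodinger γ V f x - realSchrodinger γ V h x := by
  simp only [realSchrodinger, neighborSum_sub, Pi.sub_apply]; ring

theorem realSchrodinger_smul (γ c : ℝ) (V f : (Fin d → ℤ) → ℝ) (x : Fin d → ℤ) :
    realSchrodinger γ V (c • f) x = c * realSchrodinger γ V f x := by
  simp only [realSchrodinger, neighborSum_smul, Pi.smul_apply, smul_eq_mul]; ring

theorem abs_neighborSum_le {f : (Fin d → ℤ) → ℝ} {x : Fin d → ℤ} {W : ℝ}
    (h : ∀ w, latticeNorm (w - x) = 1 → |f w| ≤ W) : |neighborSum f x| ≤ 2 * d * W := by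
  have hpair : ∀ i : Fin d, |f (x + Pi.single i 1) + f (x - Pi.single i 1)| ≤ 2 * W := fun i => by
    have hpos := h (x + Pi.single i 1) (by simp [latticeNorm_single])
    have hneg := h (x - Pi.single i 1) (by
      rw [sub_sub_cancel_left, latticeNorm_neg, latticeNorm_single])
    exact (abs_add_le _ _).trans (by linarith)
  calc |neighborSum f x| ≤ ∑ i : Fin d, |f (x + Pi.single i 1) + f (x - Pi.single i 1)| :=
        Finset.abs_sum_le_sum_abs _ _
    _ ≤ ∑ _i : Fin d, 2 * W := Finset.sum_le_sum fun i _ => hpair i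
    _ = 2 * d * W := by rw [Finset.sum_const, Finset.card_fin, nsmul_eq_mul]; ring

variable {γ : ℝ} {V : (Fin d → ℤ) → ℝ} {E : ℝ}

theorem sq_mul_sum_le_of_not_isResonant {B : Finset (Fin d → ℤ)} {δ : ℝ}
    (h : ¬ IsResonant γ V B E δ) {f : (Fin d → ℤ) → ℝ} (hf : ∀ x, x ∉ B → f x = 0) :
    δ ^ 2 * ∑ x ∈ B, f x ^ 2 ≤ ∑ x ∈ B, (realSchrodinger γ V f x - E * f x) ^ 2 := by
  set N := ∑ x ∈ B, f x ^ 2 with hN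
  have hN_nonneg : 0 ≤ N := Finset.sum_nonneg fun x _ => sq_nonneg (f x)
  rcases hN_nonneg.eq_or_lt with hN0 | hNpos
  · rw [← hN0, mul_zero]
    exact Finset.sum_nonneg fun x _ => sq_nonneg _
  by_contra! hlt
  have hsq : ((√N)⁻¹) ^ 2 = N⁻¹ := by rw [inv_pow, Real.sq_sqrt hNpos.le]
  refine h ⟨(√N)⁻¹ • f, ⟨fun x hx => by simp [hf x hx], ?_, ?_⟩⟩
  · simp only [Pi.smul_apply, smul_eq_mul, mul_pow, hsq]
    rw [← Finset.mul_sum, ← hN, inv_mul_cancel₀ hNpos.ne']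
  · simp only [realSchrodinger_smul, Pi.smul_apply, smul_eq_mul, mul_left_comm E, ← mul_sub,
      mul_pow, hsq]
    rw [← Finset.mul_sum, inv_mul_le_iff₀ hNpos, mul_comm]
    exact hlt.le

theorem IsSolutionOn.mono {ψ : (Fin d → ℤ) → ℝ} {S T : Set (Fin d → ℤ)}
    (h : IsSolutionOn γ V E ψ T) (hST : S ⊆ T) : IsSolutionOn γ V E ψ S :=
  fun x hx => h x (hST hx)

theorem IsSolutionOn.abs_indicator_sub_le {ψ : (Fin d → ℤ) → ℝ} {B : Finset (Fin d → ℤ)} {W : ℝ}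
    (hψ : IsSolutionOn γ V E ψ B) (hγ : 0 ≤ γ) (hW : 0 ≤ W)
    (hbd : ∀ u ∈ B, ∀ w ∉ B, latticeNorm (w - u) = 1 → |ψ w| ≤ W) {x : Fin d → ℤ} (hx : x ∈ B) :
    |realSchrodinger γ V ((B : Set (Fin d → ℤ)).indicator ψ) x -
      E * (B : Set (Fin d → ℤ)).indicator ψ x| ≤ 2 * d * γ * W := by
  set f := (B : Set (Fin d → ℤ)).indicator ψ with hf
  have hfx : f x = ψ x := Set.indicator_of_mem hx ψ
  have houter : |neighborSum (ψ - f) x| ≤ 2 * d * W := by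
    refine abs_neighborSum_le fun w hw => ?_
    by_cases hwB : w ∈ B
    · simpa [hf, hwB] using hW
    · simpa [hf, hwB] using hbd x hx w hwB hw
  have heq : realSchrodinger γ V f x - E * f x = -(γ * neighborSum (ψ - f) x) := by
    have hsub := realSchrodinger_sub γ V ψ f x
    rw [realSchrodinger, Pi.sub_apply, hfx, sub_self, mul_zero, add_zero] at hsub
    rw [hsub, hfx, hψ x hx]
    ring
  rw [heq, abs_neg, abs_mul, abs_of_nonneg hγ]
  calc γ * |neighborSum (ψ - f) x| ≤ γ * (2 * d * W) := by gcongr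
    _ = 2 * d * γ * W := by ring

theorem IsSolutionOn.abs_le_of_not_isResonant {ψ : (Fin d → ℤ) → ℝ} {B : Finset (Fin d → ℤ)}
    {W δ : ℝ} (hψ : IsSolutionOn γ V E ψ B) (hγ : 0 ≤ γ) (hδ : 0 < δ)
    (h : ¬ IsResonant γ V B E δ) (hW : 0 ≤ W)
    (hbd : ∀ u ∈ B, ∀ w ∉ B, latticeNorm (w - u) = 1 → |ψ w| ≤ W) {u : Fin d → ℤ} (hu : u ∈ B) :
    |ψ u| ≤ B.card / δ * (2 * d * γ) * W := by
  set f := (B : Set (Fin d → ℤ)).indicator ψ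
  have hcard : (1 : ℝ) ≤ B.card := Nat.one_le_cast.2 (Finset.card_pos.2 ⟨u, hu⟩)
  have hsum : δ ^ 2 * ∑ x ∈ B, f x ^ 2 ≤ B.card * (2 * d * γ * W) ^ 2 :=
    calc δ ^ 2 * ∑ x ∈ B, f x ^ 2 ≤ ∑ x ∈ B, (realSchrodinger γ V f x - E * f x) ^ 2 :=
          sq_mul_sum_le_of_not_isResonant h fun x hx => Set.indicator_of_notMem hx ψ
      _ ≤ B.card • (2 * d * γ * W) ^ 2 := Finset.sum_le_card_nsmul _ _ _ fun x hx =>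
          sq_le_sq.2 ((hψ.abs_indicator_sub_le hγ hW hbd hx).trans (le_abs_self _))
      _ = B.card * (2 * d * γ * W) ^ 2 := nsmul_eq_mul _ _
  have hu_le : ψ u ^ 2 ≤ ∑ x ∈ B, f x ^ 2 := by
    rw [← Set.indicator_of_mem (s := (B : Set (Fin d → ℤ))) hu ψ]
    exact Finset.single_le_sum (f := fun x => f x ^ 2) (fun _ _ => sq_nonneg _) hu
  have hsq : (δ * |ψ u|) ^ 2 ≤ (B.card * (2 * d * γ * W)) ^ 2 :=
    calc (δ * |ψ u|) ^ 2 = δ ^ 2 * ψ u ^ 2 := by rw [mul_pow, sq_abs]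
      _ ≤ B.card * (2 * d * γ * W) ^ 2 := (by gcongr : _ ≤ _).trans hsum
      _ ≤ B.card ^ 2 * (2 * d * γ * W) ^ 2 := by gcongr; exact le_self_pow₀ hcard two_ne_zero
      _ = (B.card * (2 * d * γ * W)) ^ 2 := by ring
  have hle := (sq_le_sq₀ (by positivity) (by positivity)).1 hsq
  rw [div_mul_eq_mul_div, div_mul_eq_mul_div, le_div_iff₀ hδ]
  linarith

end Solutions

theorem le_count_notMem_add_card (S : Finset ℕ) (n : ℕ) : n ≤ Nat.count (· ∉ S) n + S.card := by
  rw [Nat.count_eq_card_filter_range, ← Finset.sdiff_eq_filter]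
  have hsplit := Finset.card_sdiff_add_card_inter (Finset.range n) S
  have hinter := Finset.card_le_card (Finset.inter_subset_right (s₁ := Finset.range n) (s₂ := S))
  rw [Finset.card_range] at hsplit
  omega

theorem count_le_count_add {p : ℕ → Prop} [DecidablePred p] {m n a k : ℕ}
    (h : ∀ t, m ≤ t → t < n → p t → a ≤ t ∧ t < a + k) : Nat.count p n ≤ Nat.count p m + k := by
  simp only [Nat.count_eq_card_filter_range]
  have hsub : (Finset.range n).filter p ⊆ (Finset.range m).filter p ∪ Finset.Ico a (a + k) := by
    intro t ht
    simp only [Finset.mem_filter, Finset.mem_range, Finset.mem_union, Finset.mem_Ico] at ht ⊢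
    rcases lt_or_ge t m with htm | htm
    · exact Or.inl ⟨htm, ht.2⟩
    · exact Or.inr (h t htm ht.1 ht.2)
  refine (Finset.card_le_card hsub).trans ((Finset.card_union_le _ _).trans ?_)
  rw [Nat.card_Ico, Nat.add_sub_cancel_left]

theorem le_pow_mul_of_forall {X : Type*} {φ : X → ℕ} {f : X → ℝ} {S : Set X} {q W : ℝ}
    {h T : ℕ} (hW : ∀ w ∈ S, f w ≤ W)
    (hstep : ∀ u ∈ S, φ u + h ≤ T → ∀ W', (∀ w ∈ S, φ w ≤ φ u + h → f w ≤ W') → f u ≤ q * W')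
    (n : ℕ) : ∀ u ∈ S, φ u + n * h ≤ T → f u ≤ q ^ n * W := by
  induction n with
  | zero => exact fun u hu _ => by simpa using hW u hu
  | succ n ih =>
    intro u hu hn
    rw [pow_succ', mul_assoc]
    refine hstep u hu (by nlinarith) _ fun w hw hwu => ih w hw ?_
    nlinarith

section Shells

variable {d : ℕ}

/-- The radii `t` for which the sphere of radius `t` about `x` can come within distance `k` of the
finite set `C`. -/
def shells (C : Finset (Fin d → ℤ)) (x : Fin d → ℤ) (k : ℕ) : Finset ℕ :=
  C.biUnion fun c => Finset.Icc (latticeNorm (c - x) - k) (latticeNorm (c - x) + k)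

theorem mem_shells_of_le {C : Finset (Fin d → ℤ)} {x c : Fin d → ℤ} {k t : ℕ} (hc : c ∈ C)
    (h₁ : latticeNorm (c - x) ≤ t + k) (h₂ : t ≤ latticeNorm (c - x) + k) : t ∈ shells C x k :=
  Finset.mem_biUnion.2 ⟨c, hc, Finset.mem_Icc.2 ⟨by omega, h₂⟩⟩

theorem card_shells_le (C : Finset (Fin d → ℤ)) (x : Fin d → ℤ) (k : ℕ) :
    (shells C x k).card ≤ C.card * (2 * k + 1) := by
  refine Finset.card_biUnion_le.trans (Finset.sum_le_card_nsmul C _ (2 * k + 1) fun c _ => ?_)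
  rw [Nat.card_Icc]
  omega

theorem exists_sphere_forall_notMem {Z : Set (Fin d → ℤ)} {C : Finset (Fin d → ℤ)}
    {u : Fin d → ℤ} {s R : ℕ}
    (hcov : ∀ w ∈ latticeBall u (R + 1), w ∈ Z → ∃ c ∈ C, latticeNorm (w - c) ≤ s)
    (hR : C.card * (2 * s + 1) ≤ R) : ∃ ρ ≤ R, ∀ w, latticeNorm (w - u) = ρ + 1 → w ∉ Z := by
  by_contra! hbad
  have hsub : Finset.Icc 1 (R + 1) ⊆ shells C u s := by
    intro t ht
    rw [Finset.mem_Icc] at ht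
    obtain ⟨w, hwt, hwZ⟩ := hbad (t - 1) (by omega)
    obtain ⟨c, hc, hwc⟩ := hcov w (mem_latticeBall.2 (by omega)) hwZ
    have hwu := latticeNorm_sub_le w c u
    have hcu := latticeNorm_sub_le c w u
    rw [latticeNorm_sub_comm c w] at hcu
    exact mem_shells_of_le hc (by omega) (by omega)
  have hcard := (Finset.card_le_card hsub).trans (card_shells_le C u s)
  rw [Nat.card_Icc] at hcard
  omega

theorem count_notMem_shells_le {C : Finset (Fin d → ℤ)} {x u w c : Fin d → ℤ} {a b k : ℕ}
    (hc : c ∈ C) (huc : latticeNorm (u - c) ≤ a) (hwu : latticeNorm (w - u) ≤ b + k) :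
    Nat.count (· ∉ shells C x (a + b)) (latticeNorm (w - x)) ≤
      Nat.count (· ∉ shells C x (a + b)) (latticeNorm (u - x)) + k := by
  refine count_le_count_add (a := latticeNorm (u - x) + b) fun t hut htw ht => ⟨?_, ?_⟩
  · by_contra! hlt
    have hux := latticeNorm_sub_le u c x
    have hcx := latticeNorm_sub_le c u x
    rw [latticeNorm_sub_comm c u] at hcx
    exact ht (mem_shells_of_le hc (by omega) (by omega))
  · have := latticeNorm_sub_le w u x
    omega

end Shells

section Contraction

variable {d : ℕ} {γ : ℝ} {V : (Fin d → ℤ) → ℝ} {E : ℝ}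

/-- Solutions of `(γ Δ + V) ψ = E ψ` on the ball of radius `L` about `x` are smaller at the centre
than on the ball of radius `L + 1` by a factor `q`. This plays the role of the exponential decay of
the Green function in multiscale analysis. -/
def IsContracting (γ : ℝ) (V : (Fin d → ℤ) → ℝ) (E : ℝ) (x : Fin d → ℤ) (L : ℕ) (q : ℝ) : Prop :=
  ∀ (ψ : (Fin d → ℤ) → ℝ) (W : ℝ), IsSolutionOn γ V E ψ (latticeBall x L) →
    (∀ w ∈ latticeBall x (L + 1), |ψ w| ≤ W) → |ψ x| ≤ q * W

theorem IsContracting.mono {x : Fin d → ℤ} {L : ℕ} {q q' : ℝ} (h : IsContracting γ V E x L q)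
    (hq : q ≤ q') : IsContracting γ V E x L q' := fun ψ W hψ hW =>
  (h ψ W hψ hW).trans (mul_le_mul_of_nonneg_right hq
    ((abs_nonneg _).trans (hW x (self_mem_latticeBall _ _))))

theorem isContracting_of_forall_not_isResonant {x : Fin d → ℤ} {L : ℕ} {δ : ℝ} (hγ : 0 ≤ γ)
    (hδ : 0 < δ) (hnr : ∀ u ∈ latticeBall x L, ¬ IsResonant γ V (latticeBall u 0) E δ) :
    IsContracting γ V E x L ((2 * d * γ / δ) ^ L) := by
  intro ψ W hψ hW
  refine le_pow_mul_of_forall (f := fun w => |ψ w|) (φ := fun u => latticeNorm (u - x))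
    (S := latticeBall x (L + 1)) (h := 1) (T := L) hW (fun u hu hφ W' hW' => ?_) L x
    (self_mem_latticeBall _ _) (by simp [latticeNorm_zero])
  have hW'0 : 0 ≤ W' := (abs_nonneg _).trans (hW' u hu (Nat.le_add_right _ _))
  have huL : u ∈ latticeBall x L := mem_latticeBall.2 (by omega)
  have hsite := (hψ.mono (Finset.coe_subset.2 (latticeBall_subset (y := u) (by omega)))
    ).abs_le_of_not_isResonant hγ hδ (hnr u huL) hW'0 (fun y hy w _ hwy => ?_)
    (self_mem_latticeBall u 0)
  · rw [latticeBall_zero, Finset.card_singleton, Nat.cast_one] at hsite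
    exact hsite.trans_eq (by ring)
  · obtain rfl : y = u := by rwa [latticeBall_zero, Finset.mem_singleton] at hy
    have hwx := latticeNorm_sub_le w y x
    exact hW' w (mem_latticeBall.2 (by omega)) (by omega)

theorem IsSolutionOn.abs_le_of_sphere_isContracting {ψ : (Fin d → ℤ) → ℝ} {u : Fin d → ℤ}
    {ρ L : ℕ} {q δ W : ℝ} (hψ : IsSolutionOn γ V E ψ (latticeBall u (ρ + 1 + L))) (hγ : 0 ≤ γ)
    (hδ : 0 < δ) (hq : 0 ≤ q) (hW : 0 ≤ W) (hnr : ¬ IsResonant γ V (latticeBall u ρ) E δ)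
    (hsphere : ∀ w, latticeNorm (w - u) = ρ + 1 → IsContracting γ V E w L q)
    (hbd : ∀ w ∈ latticeBall u (ρ + 1 + (L + 1)), |ψ w| ≤ W) :
    |ψ u| ≤ (2 * ρ + 1) ^ d / δ * (2 * d * γ) * (q * W) := by
  have hψsphere : ∀ w, latticeNorm (w - u) = ρ + 1 → |ψ w| ≤ q * W := fun w hw =>
    hsphere w hw ψ W (hψ.mono (Finset.coe_subset.2 (latticeBall_subset (by omega))))
      fun z hz => hbd z (latticeBall_subset (by omega) hz)
  have hcard : ((latticeBall u ρ).card : ℝ) ≤ (2 * ρ + 1) ^ d := by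
    exact_mod_cast card_latticeBall_le u ρ
  calc |ψ u| ≤ (latticeBall u ρ).card / δ * (2 * d * γ) * (q * W) := by
        refine (hψ.mono (Finset.coe_subset.2 (latticeBall_subset ?_))).abs_le_of_not_isResonant hγ
          hδ hnr (mul_nonneg hq hW) (fun y hy w hw hwy => hψsphere w ?_) (self_mem_latticeBall u ρ)
        · rw [sub_self, latticeNorm_zero]; omega
        · have hwu := latticeNorm_sub_le w y u
          rw [mem_latticeBall] at hy hw
          omega
    _ ≤ (2 * ρ + 1) ^ d / δ * (2 * d * γ) * (q * W) := by gcongr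

/- At a contracting site one gains a factor within distance `L + 1`; at any other site one jumps to
a sphere of contracting sites, which costs the factor `(2 * R + 1) ^ d / δ`. Progress is measured by
the number of radii outside the shells around the clusters of non-contracting sites, so that the
width of a jump over a cluster is not counted. -/
theorem IsSolutionOn.abs_le_of_cover {ψ : (Fin d → ℤ) → ℝ} {x u : Fin d → ℤ} {L s R : ℕ}
    {q δ W : ℝ} (hψ : IsSolutionOn γ V E ψ (latticeBall u (R + L + 1))) (hγ : 0 ≤ γ)
    (hγd : 2 * d * γ ≤ 1) (hδ : 0 < δ) (hδ1 : δ ≤ 1) (hq : 0 ≤ q) (hW : 0 ≤ W)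
    {C : Finset (Fin d → ℤ)}
    (hcov : ∀ w ∈ latticeBall u (R + 1), ¬ IsContracting γ V E w L q →
      ∃ c ∈ C, latticeNorm (w - c) ≤ s)
    (hR : C.card * (2 * s + 1) ≤ R)
    (hnr : ∀ ρ ≤ R, ¬ IsResonant γ V (latticeBall u ρ) E δ)
    (hbd : ∀ w ∈ latticeBall u (R + L + 2),
      Nat.count (· ∉ shells C x (s + (R + 1))) (latticeNorm (w - x)) ≤
        Nat.count (· ∉ shells C x (s + (R + 1))) (latticeNorm (u - x)) + (L + 2) → |ψ w| ≤ W) :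
    |ψ u| ≤ q * ((2 * R + 1) ^ d / δ) * W := by
  have hsub : ∀ {r r' : ℕ}, r ≤ r' → latticeBall u r ⊆ latticeBall u r' := fun h =>
    latticeBall_subset (by rw [sub_self, latticeNorm_zero]; omega)
  by_cases hu : IsContracting γ V E u L q
  · have hfac : 1 ≤ (2 * (R : ℝ) + 1) ^ d / δ := by
      rw [one_le_div₀ hδ]
      exact hδ1.trans (one_le_pow₀ (by linarith [Nat.cast_nonneg (α := ℝ) R]))
    calc |ψ u| ≤ q * W := hu ψ W (hψ.mono (Finset.coe_subset.2 (hsub (by omega))))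
          fun w hw => hbd w (hsub (by omega) hw) <|
            count_le_count_add (a := latticeNorm (u - x)) fun t hut htw _ => ⟨hut, by
              have := latticeNorm_sub_le w u x
              rw [mem_latticeBall] at hw
              omega⟩
      _ ≤ q * W * ((2 * R + 1) ^ d / δ) := le_mul_of_one_le_right (by positivity) hfac
      _ = q * ((2 * R + 1) ^ d / δ) * W := by ring
  · obtain ⟨c, hc, huc⟩ := hcov u (self_mem_latticeBall u _) hu
    obtain ⟨ρ, hρR, hρ⟩ := exists_sphere_forall_notMem (Z := {w | ¬ IsContracting γ V E w L q})
      hcov hR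
    calc |ψ u| ≤ (2 * ρ + 1) ^ d / δ * (2 * d * γ) * (q * W) :=
          (hψ.mono (Finset.coe_subset.2 (hsub (by omega)))).abs_le_of_sphere_isContracting hγ hδ
            hq hW (hnr ρ hρR) (fun w hw => not_not.1 (hρ w hw))
            fun w hw => hbd w (hsub (by omega) hw) <|
              (count_notMem_shells_le (k := L + 1) hc huc
                (by rw [mem_latticeBall] at hw; omega)).trans (Nat.add_le_add_left (by omega) _)
      _ ≤ (2 * R + 1) ^ d / δ * 1 * (q * W) := by gcongr
      _ = q * ((2 * R + 1) ^ d / δ) * W := by ring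

theorem isContracting_of_cover {x : Fin d → ℤ} {L L' J s R n : ℕ} {q δ : ℝ} (hγ : 0 ≤ γ)
    (hγd : 2 * d * γ ≤ 1) (hδ : 0 < δ) (hδ1 : δ ≤ 1) (hq : 0 ≤ q) {C : Finset (Fin d → ℤ)}
    (hC : C.card ≤ J)
    (hcov : ∀ u ∈ latticeBall x L', ¬ IsContracting γ V E u L q →
      ∃ c ∈ C, latticeNorm (u - c) ≤ s)
    (hR : J * (2 * s + 1) ≤ R)
    (hnr : ∀ u ∈ latticeBall x L', ∀ ρ ≤ R, ¬ IsResonant γ V (latticeBall u ρ) E δ)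
    (hn : n * (L + 2) + J * (2 * (s + (R + 1)) + 1) + R + L + 2 ≤ L') :
    IsContracting γ V E x L' ((q * ((2 * R + 1) ^ d / δ)) ^ n) := by
  intro ψ W hψ hW
  have hshells : (shells C x (s + (R + 1))).card ≤ J * (2 * (s + (R + 1)) + 1) :=
    (card_shells_le _ _ _).trans (Nat.mul_le_mul_right _ hC)
  refine le_pow_mul_of_forall (f := fun w => |ψ w|)
    (φ := fun u => Nat.count (· ∉ shells C x (s + (R + 1))) (latticeNorm (u - x)))
    (S := latticeBall x (L' + 1)) (h := L + 2) (T := n * (L + 2)) hW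
    (fun u hu hφ W' hW' => ?_) n x (self_mem_latticeBall _ _) (by simp [latticeNorm_zero])
  have hux : latticeNorm (u - x) + R + L + 2 ≤ L' := by
    have := le_count_notMem_add_card (shells C x (s + (R + 1))) (latticeNorm (u - x))
    omega
  have huL' : u ∈ latticeBall x L' := mem_latticeBall.2 (by omega)
  exact (hψ.mono (Finset.coe_subset.2 (latticeBall_subset (by omega)))).abs_le_of_cover hγ hγd hδ
    hδ1 hq ((abs_nonneg _).trans (hW' u hu (Nat.le_add_right _ _)))
    (fun w hw => hcov w (latticeBall_subset (by omega) hw))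
    ((Nat.mul_le_mul_right _ hC).trans hR) (hnr u huL')
    fun w hw => hW' w (latticeBall_subset (by omega) hw)

end Contraction

section Scales

variable {d : ℕ}

/-- The length scales `2 ^ (s ^ 2)` of the induction. -/
def scale (s : ℕ) : ℕ := 2 ^ s ^ 2

/-- The largest radius of the balls inspected for resonances at scale `s`. -/
def resRadius (J s : ℕ) : ℕ := 8 * J * scale s

/-- The radius of the window in which resonances of scale `s` have to be rare. -/
def window (s : ℕ) : ℕ := 32 * scale (s + 2)

/-- The width of a resonance at scale `s`. -/
noncomputable def tol (σ : ℝ) (s : ℕ) : ℝ := Real.exp (-(scale s : ℝ) ^ σ)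

/-- The contraction factor of a ball of scale `s`. The rate per unit length decreases from `32` to
`16`, which leaves room for the losses made at each scale. -/
noncomputable def gain (s : ℕ) : ℝ := Real.exp (-(16 * (1 + (1 / 2) ^ s) * scale s))

/-- The sites with a resonance of scale `s` at energy `E`. -/
def resSites (γ : ℝ) (V : (Fin d → ℤ) → ℝ) (J : ℕ) (σ E : ℝ) (s : ℕ) : Set (Fin d → ℤ) :=
  {u | ∃ r ≤ resRadius J s, IsResonant γ V (latticeBall u r) E (tol σ s)}

/-- There are `p` well separated sites in the window about `y` which have resonances of scale `s`
at the same energy `E`. -/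
def SeparatedResonances (γ : ℝ) (V : (Fin d → ℤ) → ℝ) (J : ℕ) (σ : ℝ) (s p : ℕ) (E : ℝ)
    (y : Fin d → ℤ) : Prop :=
  ∃ u : Fin p → Fin d → ℤ, (∀ i, u i ∈ latticeBall y (window s) ∧ u i ∈ resSites γ V J σ E s) ∧
    Pairwise fun i j => ¬ latticeNorm (u i - u j) ≤ 2 * resRadius J s

/-- In the absence of resonances of scale `s`, balls of scale `s + 1` contract: the statement
proved by induction on the scale. -/
def ContractsOffResonances (γ : ℝ) (V : (Fin d → ℤ) → ℝ) (J : ℕ) (σ E : ℝ) (s : ℕ) : Prop :=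
  ∀ x, (∀ u ∈ latticeBall x (scale (s + 1)), u ∉ resSites γ V J σ E s) →
    IsContracting γ V E x (scale (s + 1)) (gain (s + 1))

/-- The scale `s` is large enough for the induction step. -/
structure LargeScale (d J : ℕ) (σ : ℝ) (s : ℕ) : Prop where
  four_le : 4 ≤ s
  J_lt : 16 * J < 2 ^ (2 * s + 1)
  J_sq_le : 31 * (34 * J ^ 2 + 1) ≤ 14 * 2 ^ s
  loss_le : d * Real.log (2 * resRadius J s + 1) + (scale s : ℝ) ^ σ ≤ (1 / 2) ^ s * scale s

theorem scale_pos (s : ℕ) : 0 < scale s := Nat.two_pow_pos _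

theorem scale_succ (s : ℕ) : scale (s + 1) = 2 ^ (2 * s + 1) * scale s := by
  unfold scale; rw [← pow_add]; congr 1; ring

theorem scale_strictMono : StrictMono scale := fun _ _ h =>
  Nat.pow_lt_pow_right one_lt_two (Nat.pow_lt_pow_left h two_ne_zero)

theorem le_scale (s : ℕ) : s ≤ scale s := scale_strictMono.le_apply

theorem two_mul_resRadius (J s : ℕ) : 2 * resRadius J s = 16 * J * scale s := by
  unfold resRadius; ring

theorem tol_pos (σ : ℝ) (s : ℕ) : 0 < tol σ s := Real.exp_pos _

theorem tol_le_one (σ : ℝ) (s : ℕ) : tol σ s ≤ 1 := by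
  unfold tol
  rw [Real.exp_le_one_iff, neg_nonpos]
  positivity

theorem gain_pos (s : ℕ) : 0 < gain s := Real.exp_pos _

theorem gain_le (s : ℕ) : gain s ≤ Real.exp (-(16 * scale s)) := by
  unfold gain
  rw [Real.exp_le_exp]
  have : (0 : ℝ) ≤ (1 / 2) ^ s * scale s := by positivity
  nlinarith

namespace LargeScale

variable {J s : ℕ} {σ : ℝ}

theorem resRadius_lt (h : LargeScale d J σ s) : 2 * resRadius J s < scale (s + 1) := by
  rw [two_mul_resRadius, scale_succ]
  exact Nat.mul_lt_mul_of_pos_right h.J_lt (scale_pos s)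

theorem J_sq_le_two_pow (h : LargeScale d J σ s) : 34 * J ^ 2 + 1 ≤ 2 ^ (2 * s + 1) := by
  have hle : 2 ^ s ≤ 2 ^ (2 * s + 1) := Nat.pow_le_pow_right two_pos (by omega)
  have := h.J_sq_le
  omega

theorem loss_factor_le (h : LargeScale d J σ s) :
    (2 * (resRadius J s : ℝ) + 1) ^ d / tol σ s ≤ Real.exp ((1 / 2) ^ s * scale s) := by
  have hpow : (2 * (resRadius J s : ℝ) + 1) ^ d =
      Real.exp (d * Real.log (2 * resRadius J s + 1)) := by
    rw [Real.exp_nat_mul, Real.exp_log (by positivity)]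
  rw [hpow, tol, Real.exp_neg, div_inv_eq_mul, ← Real.exp_add, Real.exp_le_exp]
  exact h.loss_le

theorem rate_succ_le (h : LargeScale d J σ s) :
    2 ^ (2 * s + 1) * (16 * (1 + (1 / 2 : ℝ) ^ (s + 1))) ≤
      (2 ^ (2 * s + 1) - (34 * J ^ 2 + 1)) * (16 + 15 * (1 / 2) ^ s) := by
  obtain ⟨B, hB⟩ : ∃ B : ℝ, 2 ^ s = B := ⟨_, rfl⟩
  obtain ⟨c, hc⟩ : ∃ c : ℝ, 34 * (J : ℝ) ^ 2 + 1 = c := ⟨_, rfl⟩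
  have hB1 : 1 ≤ B := hB ▸ one_le_pow₀ one_le_two
  have hc0 : 0 ≤ c := hc ▸ by positivity
  have hcB : 31 * c ≤ 14 * B := by rw [← hc, ← hB]; exact_mod_cast h.J_sq_le
  have hhalf : (1 / 2 : ℝ) ^ s = B⁻¹ := by rw [one_div, inv_pow, hB]
  have hsq : (2 : ℝ) ^ (2 * s + 1) = 2 * B ^ 2 := by rw [pow_succ, pow_mul', hB]; ring
  have hc15 : c * (15 * B⁻¹) ≤ c * 15 := by
    gcongr; linarith [inv_le_one_of_one_le₀ hB1]
  rw [hc, hsq, pow_succ (1 / 2 : ℝ), hhalf]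
  calc 2 * B ^ 2 * (16 * (1 + B⁻¹ * (1 / 2))) = 32 * B ^ 2 + 16 * B := by field_simp; ring
    _ ≤ 32 * B ^ 2 + 30 * B - c * 16 - c * (15 * B⁻¹) := by linarith
    _ = (2 * B ^ 2 - c) * (16 + 15 * B⁻¹) := by field_simp; ring

theorem pow_le_gain_succ (h : LargeScale d J σ s) :
    (gain s * ((2 * (resRadius J s : ℝ) + 1) ^ d / tol σ s)) ^
      (2 ^ (2 * s + 1) - (34 * J ^ 2 + 1)) ≤ gain (s + 1) := by
  have hbase : gain s * ((2 * (resRadius J s : ℝ) + 1) ^ d / tol σ s) ≤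
      Real.exp (-((16 + 15 * (1 / 2) ^ s) * scale s)) := by
    refine (mul_le_mul_of_nonneg_left h.loss_factor_le (gain_pos s).le).trans_eq ?_
    rw [gain, ← Real.exp_add]; congr 1; ring
  have hnonneg : 0 ≤ gain s * ((2 * (resRadius J s : ℝ) + 1) ^ d / tol σ s) :=
    mul_nonneg (gain_pos s).le (div_nonneg (by positivity) (tol_pos σ s).le)
  refine (pow_le_pow_left₀ hnonneg hbase _).trans ?_
  rw [← Real.exp_nat_mul, gain, Real.exp_le_exp, scale_succ, Nat.cast_sub h.J_sq_le_two_pow]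
  push_cast
  have hrate := mul_le_mul_of_nonneg_right h.rate_succ_le (Nat.cast_nonneg (α := ℝ) (scale s))
  linarith

theorem card_mul_le_scale_succ (hs : 3 ≤ s) (hJ : 1 ≤ J) (h : LargeScale d J σ s) :
    (2 ^ (2 * s + 1) - (34 * J ^ 2 + 1)) * (scale s + 2) +
        J * (2 * (2 * scale s + (resRadius J s + 1)) + 1) + resRadius J s + scale s + 2 ≤
      scale (s + 1) := by
  have hL : 1 ≤ scale s := scale_pos s
  have htwo : 2 * 2 ^ (2 * s + 1) ≤ scale s := by
    rw [scale, ← pow_succ']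
    exact Nat.pow_le_pow_right two_pos (by nlinarith)
  obtain ⟨m, hm⟩ := Nat.exists_eq_add_of_le h.J_sq_le_two_pow
  rw [scale_succ, resRadius]
  rw [hm] at htwo ⊢
  rw [Nat.add_sub_cancel_left]
  have hJL : scale s ≤ J * scale s := Nat.le_mul_of_pos_left _ hJ
  have hJJL : J * scale s ≤ J ^ 2 * scale s := by
    rw [pow_two, mul_assoc]; exact Nat.le_mul_of_pos_left _ hJ
  have hJJ : J ≤ J * scale s := Nat.le_mul_of_pos_right _ hL
  nlinarith

end LargeScale

variable {γ : ℝ} {V : (Fin d → ℤ) → ℝ} {J : ℕ} {σ E : ℝ}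

theorem contractsOffResonances_of_le {s : ℕ} (hγ : 0 ≤ γ)
    (hγs : 2 * d * γ ≤ Real.exp (-32) * tol σ s) : ContractsOffResonances γ V J σ E s := by
  intro x hx
  refine (isContracting_of_forall_not_isResonant hγ (tol_pos σ s) fun u hu hres =>
    hx u hu ⟨0, Nat.zero_le _, hres⟩).mono ?_
  have hbase : 2 * d * γ / tol σ s ≤ Real.exp (-32) := by rwa [div_le_iff₀ (tol_pos _ _)]
  refine (pow_le_pow_left₀ (div_nonneg (by positivity) (tol_pos _ _).le) hbase _).trans ?_
  rw [← Real.exp_nat_mul, gain, Real.exp_le_exp]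
  have hhalf : ((1 / 2 : ℝ)) ^ (s + 1) ≤ 1 := pow_le_one₀ (by norm_num) (by norm_num)
  nlinarith [Nat.cast_nonneg (α := ℝ) (scale (s + 1))]

theorem ContractsOffResonances.exists_cover {s : ℕ} (h : ContractsOffResonances γ V J σ E s)
    (hs : LargeScale d J σ s) {x : Fin d → ℤ}
    (hrare : ¬ SeparatedResonances γ V J σ s (J + 1) E x) :
    ∃ C : Finset (Fin d → ℤ), C.card ≤ J ∧ ∀ u ∈ latticeBall x (scale (s + 2)),
      ¬ IsContracting γ V E u (scale (s + 1)) (gain (s + 1)) →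
        ∃ c ∈ C, latticeNorm (u - c) ≤ 2 * scale (s + 1) := by
  obtain ⟨C, hC, hcov⟩ := exists_card_le_forall_exists_rel
    (r := fun z c => latticeNorm (z - c) ≤ 2 * resRadius J s)
    (Z := {u | u ∈ latticeBall x (window s) ∧ u ∈ resSites γ V J σ E s})
    (fun u w h => (latticeNorm_sub_comm w u).trans_le h) hrare
  refine ⟨C, hC, fun u hu hbad => ?_⟩
  obtain ⟨z, hzu, hz⟩ : ∃ z ∈ latticeBall u (scale (s + 1)), z ∈ resSites γ V J σ E s := by
    by_contra! hno
    exact hbad (h u hno)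
  have hmono : scale (s + 1) ≤ scale (s + 2) := scale_strictMono.monotone (by omega)
  rw [mem_latticeBall] at hu hzu
  obtain ⟨c, hc, hzc⟩ := hcov z ⟨by
    have := latticeNorm_sub_le z u x
    rw [mem_latticeBall, window]
    omega, hz⟩
  have huc := latticeNorm_sub_le u z c
  rw [latticeNorm_sub_comm u z] at huc
  have := hs.resRadius_lt
  exact ⟨c, hc, by omega⟩

theorem ContractsOffResonances.succ {s : ℕ} (h : ContractsOffResonances γ V J σ E s)
    (hJ : 1 ≤ J) (hγ : 0 ≤ γ) (hγd : 2 * d * γ ≤ 1) (hs : LargeScale d J σ s)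
    (hs' : LargeScale d J σ (s + 1))
    (hrare : ∀ y, ¬ SeparatedResonances γ V J σ s (J + 1) E y) :
    ContractsOffResonances γ V J σ E (s + 1) := by
  intro x hx
  obtain ⟨C, hC, hcov⟩ := h.exists_cover hs (hrare x)
  refine (isContracting_of_cover hγ hγd (tol_pos σ (s + 1)) (tol_le_one _ _) (gain_pos _).le hC
    hcov (R := resRadius J (s + 1)) ?_ (fun u hu ρ hρ hres => hx u hu ⟨ρ, hρ, hres⟩)
    (hs'.card_mul_le_scale_succ (by linarith [hs.four_le]) hJ)).mono hs'.pow_le_gain_succ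
  unfold resRadius
  have := scale_pos (s + 1)
  nlinarith

theorem contractsOffResonances_of_not_separatedResonances {s₁ : ℕ} (hJ : 1 ≤ J) (hγ : 0 ≤ γ)
    (hγs : 2 * d * γ ≤ Real.exp (-32) * tol σ s₁) (hlarge : ∀ s, s₁ ≤ s → LargeScale d J σ s)
    (hrare : ∀ s, s₁ ≤ s → ∀ y, ¬ SeparatedResonances γ V J σ s (J + 1) E y) {s : ℕ}
    (hs : s₁ ≤ s) : ContractsOffResonances γ V J σ E s := by
  have hγd : 2 * d * γ ≤ 1 :=
    hγs.trans (mul_le_one₀ (Real.exp_le_one_iff.2 (by norm_num)) (tol_pos _ _).le (tol_le_one _ _))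
  induction s, hs using Nat.le_induction with
  | base => exact contractsOffResonances_of_le hγ hγs
  | succ s hs ih =>
    exact ih.succ hJ hγ hγd (hlarge s hs) (hlarge (s + 1) (Nat.le_succ_of_le hs)) (hrare s hs)

section Decay

variable {ψ : (Fin d → ℤ) → ℝ} {C : ℝ}

theorem eventually_exists_mem_resSites
    (hcontr : ∀ᶠ s in atTop, ContractsOffResonances γ V J σ E s)
    (hψ : IsSolutionOn γ V E ψ Set.univ) (hC : ∀ x, |ψ x| ≤ C * Real.exp (latticeNorm x / 4))
    {u₀ : Fin d → ℤ} (hu₀ : ψ u₀ ≠ 0) :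
    ∀ᶠ s in atTop, ∃ z ∈ latticeBall 0 (2 * scale (s + 1)), z ∈ resSites γ V J σ E s := by
  have hC0 : 0 ≤ C := by simpa [latticeNorm_zero] using (abs_nonneg _).trans (hC 0)
  have hlim : Tendsto (fun s : ℕ => C * Real.exp 1 * Real.exp (-(scale (s + 1) : ℝ))) atTop
      (𝓝 (C * Real.exp 1 * 0)) :=
    Tendsto.const_mul _ (Real.tendsto_exp_neg_atTop_nhds_zero.comp
      (tendsto_natCast_atTop_atTop.comp
        (scale_strictMono.tendsto_atTop.comp (tendsto_add_atTop_nat 1))))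
  rw [mul_zero] at hlim
  filter_upwards [hlim.eventually (gt_mem_nhds (abs_pos.2 hu₀)), hcontr,
    eventually_ge_atTop (latticeNorm u₀)] with s hsmall hs hu₀s
  by_contra! hno
  have hu₀L : latticeNorm (u₀ - 0) ≤ scale (s + 1) := by
    rw [sub_zero]; exact hu₀s.trans ((Nat.le_succ s).trans (le_scale _))
  have hdecay := hs u₀ (fun u hu => hno u (latticeBall_subset (by omega) hu)) ψ
    (C * Real.exp ((2 * scale (s + 1) + 1) / 4)) (hψ.mono (Set.subset_univ _)) fun w hw => by
      have hw0 := mem_latticeBall.1 (latticeBall_subset (R := 2 * scale (s + 1) + 1)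
        (by omega : latticeNorm (u₀ - 0) + _ ≤ _) hw)
      rw [sub_zero] at hw0
      refine (hC w).trans ?_
      gcongr
      exact_mod_cast hw0
  refine absurd hsmall (not_lt.2 (hdecay.trans ?_))
  calc gain (s + 1) * (C * Real.exp ((2 * scale (s + 1) + 1) / 4))
      ≤ Real.exp (-(16 * scale (s + 1))) * (C * Real.exp ((2 * scale (s + 1) + 1) / 4)) := by
        gcongr; exact gain_le _
    _ = C * Real.exp (-(16 * scale (s + 1)) + (2 * scale (s + 1) + 1) / 4) := by
        rw [Real.exp_add]; ring
    _ ≤ C * Real.exp (1 + -(scale (s + 1) : ℝ)) := by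
        refine mul_le_mul_of_nonneg_left (Real.exp_le_exp.2 ?_) hC0
        linarith [Nat.cast_nonneg (α := ℝ) (scale (s + 1))]
    _ = C * Real.exp 1 * Real.exp (-(scale (s + 1) : ℝ)) := by rw [Real.exp_add]; ring

theorem exists_eight_mul_scale_le {s₂ n : ℕ} (hn : 8 * scale (s₂ + 1) < n) :
    ∃ s, s₂ ≤ s ∧ 8 * scale (s + 1) ≤ n ∧ n ≤ 8 * scale (s + 2) := by
  have hex : ∃ s, n ≤ 8 * scale (s + 2) := ⟨n, by have := le_scale (n + 2); omega⟩
  classical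
  have hle : s₂ ≤ Nat.find hex := by
    by_contra! hlt
    have hmono : scale (Nat.find hex + 2) ≤ scale (s₂ + 1) := scale_strictMono.monotone (by omega)
    have := Nat.find_spec hex
    omega
  refine ⟨Nat.find hex, hle, ?_, Nat.find_spec hex⟩
  rcases hle.eq_or_lt with heq | hlt
  · exact heq ▸ hn.le
  · have hmin := Nat.find_min hex (m := Nat.find hex - 1) (by omega)
    rw [show Nat.find hex - 1 + 2 = Nat.find hex + 1 by omega] at hmin
    exact (not_le.1 hmin).le

theorem separatedResonances_two {s : ℕ} {y z w : Fin d → ℤ}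
    (hz : z ∈ latticeBall y (window s)) (hz' : z ∈ resSites γ V J σ E s)
    (hw : w ∈ latticeBall y (window s)) (hw' : w ∈ resSites γ V J σ E s)
    (hzw : 2 * resRadius J s < latticeNorm (z - w)) : SeparatedResonances γ V J σ s 2 E y := by
  refine ⟨![z, w], by simp [Fin.forall_fin_two, *], ?_⟩
  simp [Pairwise, Fin.forall_fin_two, latticeNorm_sub_comm w z, hzw]

theorem ContractsOffResonances.isContracting_of_two {s : ℕ}
    (h : ContractsOffResonances γ V J σ E s) (hs : LargeScale d J σ s)
    (htwo : ¬ SeparatedResonances γ V J σ s 2 E 0) {z u : Fin d → ℤ}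
    (hz : z ∈ latticeBall 0 (2 * scale (s + 1))) (hz' : z ∈ resSites γ V J σ E s)
    (hu : 4 * scale (s + 1) ≤ latticeNorm u) (hu' : latticeNorm u ≤ 16 * scale (s + 2)) :
    IsContracting γ V E u (scale (s + 1)) (gain (s + 1)) := by
  have hR := hs.resRadius_lt
  have hmono : scale (s + 1) ≤ scale (s + 2) := scale_strictMono.monotone (by omega)
  refine h u fun w hw hw' => htwo ?_
  have huw := latticeNorm_sub_le u w 0
  have hwu := latticeNorm_sub_le w u 0
  have hwz := latticeNorm_sub_le w z 0
  simp only [mem_latticeBall, sub_zero] at hw hz huw hwu hwz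
  rw [latticeNorm_sub_comm] at huw hwz
  refine separatedResonances_two ?_ hz' ?_ hw' (by omega) <;>
  · rw [mem_latticeBall, sub_zero, window]
    omega

theorem IsSolutionOn.abs_le_of_isContracting (hψ : IsSolutionOn γ V E ψ Set.univ)
    (hC : ∀ x, |ψ x| ≤ C * Real.exp (latticeNorm x / 4)) {x : Fin d → ℤ} {L : ℕ} {q : ℝ}
    (hcontr : ∀ u, 4 * L ≤ latticeNorm u → latticeNorm u ≤ 2 * latticeNorm x →
      IsContracting γ V E u L q) :
    |ψ x| ≤ q ^ ((latticeNorm x - 4 * L) / (L + 1)) * (C * Real.exp (latticeNorm x / 2)) := by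
  rcases lt_or_ge (latticeNorm x) (4 * L) with hx | hx
  · have hC0 : 0 ≤ C := by simpa [latticeNorm_zero] using (abs_nonneg _).trans (hC 0)
    rw [Nat.sub_eq_zero_of_le hx.le, Nat.zero_div, pow_zero, one_mul]
    refine (hC x).trans ?_
    gcongr
    norm_num
  refine le_pow_mul_of_forall (φ := fun u => latticeNorm (u - x)) (f := fun w => |ψ w|)
    (S := latticeBall x (latticeNorm x - 4 * L)) (h := L + 1) (T := latticeNorm x - 4 * L)
    (fun w hw => ?_) (fun u hu hφ W hW => ?_) _ x (self_mem_latticeBall _ _)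
    (by simpa only [sub_self, latticeNorm_zero, zero_add] using Nat.div_mul_le_self _ _)
  · have hwx := latticeNorm_sub_le w x 0
    rw [Finset.mem_coe, mem_latticeBall] at hw
    rw [sub_zero, sub_zero] at hwx
    have hle : (latticeNorm w : ℝ) ≤ 2 * latticeNorm x := by exact_mod_cast (by omega)
    refine (hC w).trans (mul_le_mul_of_nonneg_left (Real.exp_le_exp.2 (by linarith)) ?_)
    simpa [latticeNorm_zero] using (abs_nonneg _).trans (hC 0)
  · have hxu := latticeNorm_sub_le x u 0
    have hux := latticeNorm_sub_le u x 0
    simp only [Finset.mem_coe, mem_latticeBall, sub_zero] at hu hφ hW hxu hux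
    rw [latticeNorm_sub_comm] at hxu
    refine hcontr u (by omega) (by omega) ψ W (hψ.mono (Set.subset_univ _)) fun w hw => ?_
    rw [mem_latticeBall] at hw
    have hwx := latticeNorm_sub_le w u x
    exact hW w (by omega) (by omega)

theorem two_mul_le_mul_sub_div {L n : ℕ} (hL : 1 ≤ L) (hn : 8 * L ≤ n) :
    2 * n ≤ 16 * L * ((n - 4 * L) / (L + 1)) := by
  obtain ⟨m, hm⟩ : ∃ m, (n - 4 * L) / (L + 1) = m := ⟨_, rfl⟩
  have hdiv := Nat.div_add_mod (n - 4 * L) (L + 1)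
  have hmod := Nat.mod_lt (n - 4 * L) (show 0 < L + 1 by omega)
  rw [hm] at hdiv ⊢
  have hmL : m ≤ L * m := Nat.le_mul_of_pos_left _ hL
  rw [add_one_mul] at hdiv
  rw [mul_assoc]
  omega

theorem exists_abs_le_exp_neg
    (hlarge : ∀ᶠ s in atTop, LargeScale d J σ s)
    (hcontr : ∀ᶠ s in atTop, ContractsOffResonances γ V J σ E s)
    (htwo : ∀ᶠ s in atTop, ¬ SeparatedResonances γ V J σ s 2 E 0)
    (hψ : IsSolutionOn γ V E ψ Set.univ)
    (hC : ∀ x, |ψ x| ≤ C * Real.exp (latticeNorm x / 4)) :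
    ∃ C', ∀ x, |ψ x| ≤ C' * Real.exp (-latticeNorm x) := by
  have hC0 : 0 ≤ C := by simpa [latticeNorm_zero] using (abs_nonneg _).trans (hC 0)
  by_cases hzero : ∀ x, ψ x = 0
  · exact ⟨0, fun x => by simp [hzero x]⟩
  push Not at hzero
  obtain ⟨u₀, hu₀⟩ := hzero
  obtain ⟨s₂, hs₂⟩ := eventually_atTop.1 ((eventually_exists_mem_resSites hcontr hψ hC hu₀).and
    (hlarge.and (hcontr.and htwo)))
  refine ⟨C * Real.exp (2 * (8 * scale (s₂ + 1))), fun x => ?_⟩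
  suffices h : |ψ x| ≤ C * Real.exp (2 * (8 * scale (s₂ + 1)) + -latticeNorm x) by
    rwa [Real.exp_add, ← mul_assoc] at h
  rcases le_or_gt (latticeNorm x) (8 * scale (s₂ + 1)) with hsmall | hbig
  · have hsmall' : (latticeNorm x : ℝ) ≤ 8 * scale (s₂ + 1) := by exact_mod_cast hsmall
    refine (hC x).trans ?_
    gcongr
    linarith
  obtain ⟨s, hss, hxs, hxs'⟩ := exists_eight_mul_scale_le hbig
  obtain ⟨⟨z, hz, hz'⟩, hs, hsc, hs2⟩ := hs₂ s hss
  have hn : 2 * (latticeNorm x : ℝ) ≤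
      16 * scale (s + 1) * ((latticeNorm x - 4 * scale (s + 1)) / (scale (s + 1) + 1) : ℕ) := by
    exact_mod_cast two_mul_le_mul_sub_div (scale_pos _) hxs
  set n := (latticeNorm x - 4 * scale (s + 1)) / (scale (s + 1) + 1)
  calc |ψ x| ≤ gain (s + 1) ^ n * (C * Real.exp (latticeNorm x / 2)) :=
        hψ.abs_le_of_isContracting hC fun u hu hu' =>
          hsc.isContracting_of_two hs hs2 hz hz' hu (by omega)
    _ ≤ Real.exp (-(16 * scale (s + 1))) ^ n * (C * Real.exp (latticeNorm x / 2)) := by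
        gcongr
        · exact (gain_pos _).le
        · exact gain_le _
    _ = C * Real.exp (-(16 * scale (s + 1) * n) + latticeNorm x / 2) := by
        rw [← Real.exp_nat_mul, Real.exp_add,
          show (n : ℝ) * -(16 * scale (s + 1)) = -(16 * scale (s + 1) * n) by ring]
        ring
    _ ≤ C * Real.exp (2 * (8 * scale (s₂ + 1)) + -latticeNorm x) := by
        refine mul_le_mul_of_nonneg_left (Real.exp_le_exp.2 ?_) hC0
        linarith [Nat.cast_nonneg (α := ℝ) (scale (s₂ + 1)),
          Nat.cast_nonneg (α := ℝ) (latticeNorm x)]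

end Decay

end Scales

section Asymptotics

theorem eventually_mul_two_rpow_le {a b : ℝ} (hab : a < b) (m c : ℝ) :
    ∀ᶠ s : ℕ in atTop, c * (2 : ℝ) ^ (a * (s : ℝ) ^ 2 + m * s) ≤ (2 : ℝ) ^ (b * (s : ℝ) ^ 2) := by
  obtain ⟨k, hk⟩ := pow_unbounded_of_one_lt c (one_lt_two (α := ℝ))
  filter_upwards [eventually_ge_atTop 1,
    tendsto_natCast_atTop_atTop.eventually_ge_atTop ((|m| + k) / (b - a))] with s hs1 hs
  have hs1' : (1 : ℝ) ≤ s := by exact_mod_cast hs1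
  rw [div_le_iff₀' (sub_pos.2 hab)] at hs
  calc c * (2 : ℝ) ^ (a * (s : ℝ) ^ 2 + m * s)
      ≤ (2 : ℝ) ^ (k : ℝ) * (2 : ℝ) ^ (a * (s : ℝ) ^ 2 + m * s) := by
        rw [Real.rpow_natCast]; gcongr
    _ = (2 : ℝ) ^ ((k : ℝ) + (a * (s : ℝ) ^ 2 + m * s)) := (Real.rpow_add two_pos _ _).symm
    _ ≤ (2 : ℝ) ^ (b * (s : ℝ) ^ 2) := by
        refine Real.rpow_le_rpow_of_exponent_le one_le_two ?_
        have hk : (k : ℝ) ≤ k * s := le_mul_of_one_le_right (Nat.cast_nonneg k) hs1'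
        have hm : m * s ≤ |m| * s := mul_le_mul_of_nonneg_right (le_abs_self m) (by linarith)
        nlinarith

theorem scale_rpow (σ : ℝ) (s : ℕ) : (scale s : ℝ) ^ σ = (2 : ℝ) ^ (σ * (s : ℝ) ^ 2) := by
  rw [scale, Nat.cast_pow, Nat.cast_ofNat, ← Real.rpow_natCast, ← Real.rpow_mul zero_le_two,
    Nat.cast_pow, mul_comm]

theorem window_rpow (β : ℝ) (s : ℕ) :
    (window s : ℝ) ^ β = (2 : ℝ) ^ (9 * β) * (2 : ℝ) ^ (β * (s : ℝ) ^ 2 + 4 * β * s) := by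
  unfold window scale
  push_cast
  rw [show (32 : ℝ) = 2 ^ 5 by norm_num, ← pow_add, ← Real.rpow_natCast,
    ← Real.rpow_mul zero_le_two, ← Real.rpow_add two_pos]
  congr 1
  push_cast
  ring

theorem four_pow_le_window (s : ℕ) : 4 ^ s ≤ window s :=
  calc 4 ^ s = 2 ^ (2 * s) := (pow_mul 2 2 s).symm
    _ ≤ scale (s + 2) := Nat.pow_le_pow_right two_pos (by nlinarith)
    _ ≤ window s := Nat.le_mul_of_pos_left _ (by norm_num)

theorem one_le_window (s : ℕ) : 1 ≤ window s :=
  (Nat.one_le_pow _ _ (by norm_num)).trans (four_pow_le_window s)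

theorem eventually_window_rpow_le {β σ : ℝ} (hβσ : β < σ) (c : ℝ) :
    ∀ᶠ s : ℕ in atTop, c * (window s : ℝ) ^ β ≤ (scale s : ℝ) ^ σ := by
  filter_upwards [eventually_mul_two_rpow_le hβσ (4 * β) (c * 2 ^ (9 * β))] with s hs
  rw [window_rpow, scale_rpow, ← mul_assoc]
  exact hs

theorem log_resRadius_le (J s : ℕ) {σ : ℝ} (hσ : 0 < σ) :
    Real.log (2 * resRadius J s + 1) ≤ (16 * J + 1) ^ σ / σ * (scale s : ℝ) ^ σ := by
  have hL : (1 : ℝ) ≤ scale s := by exact_mod_cast scale_pos s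
  have hR : 2 * (resRadius J s : ℝ) + 1 ≤ (16 * J + 1) * scale s := by
    unfold resRadius; push_cast; nlinarith
  refine (Real.log_le_rpow_div (by positivity) hσ).trans ?_
  rw [div_mul_eq_mul_div, ← Real.mul_rpow (by positivity) (by positivity)]
  gcongr

theorem eventually_largeScale (d J : ℕ) {σ : ℝ} (hσ : 0 < σ) (hσ1 : σ < 1) :
    ∀ᶠ s : ℕ in atTop, LargeScale d J σ s := by
  filter_upwards [eventually_ge_atTop 4, eventually_ge_atTop (31 * (34 * J ^ 2 + 1) + 16 * J),
    eventually_mul_two_rpow_le hσ1 1 (d * ((16 * J + 1) ^ σ / σ) + 1)] with s hs4 hsJ hs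
  have hpow : s < 2 ^ s := Nat.lt_two_pow_self
  have hpow' : 2 ^ s ≤ 2 ^ (2 * s + 1) := Nat.pow_le_pow_right two_pos (by omega)
  refine ⟨hs4, by omega, by omega, ?_⟩
  have hscale : (2 : ℝ) ^ (1 * (s : ℝ) ^ 2) = scale s := by rw [← scale_rpow, Real.rpow_one]
  rw [hscale, Real.rpow_add two_pos, ← scale_rpow, one_mul, Real.rpow_natCast] at hs
  calc d * Real.log (2 * resRadius J s + 1) + (scale s : ℝ) ^ σ
      ≤ d * ((16 * J + 1) ^ σ / σ * (scale s : ℝ) ^ σ) + (scale s : ℝ) ^ σ := by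
        gcongr; exact log_resRadius_le J s hσ
    _ = (d * ((16 * J + 1) ^ σ / σ) + 1) * (scale s : ℝ) ^ σ := by ring
    _ ≤ (1 / 2) ^ s * scale s := by
        rw [one_div, inv_pow, inv_mul_eq_div, le_div_iff₀ (by positivity)]
        linarith

theorem mul_exp_mul_rpow_le {M β : ℝ} (hM : 1 ≤ M) (hβ : 0 < β) (c₀ c₁ a : ℝ) :
    c₀ * Real.exp (c₁ * M ^ β) * M ^ a ≤ Real.exp ((|c₀| + c₁ + |a| / β) * M ^ β) := by
  have hc₀ : c₀ ≤ Real.exp (|c₀| * M ^ β) := by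
    have hexp := Real.add_one_le_exp (|c₀| * M ^ β)
    have hle := le_mul_of_one_le_right (abs_nonneg c₀) (Real.one_le_rpow hM hβ.le)
    linarith [le_abs_self c₀]
  have ha : M ^ a ≤ Real.exp (|a| / β * M ^ β) := by
    rw [Real.rpow_def_of_pos (by linarith), Real.exp_le_exp]
    calc Real.log M * a ≤ Real.log M * |a| :=
          mul_le_mul_of_nonneg_left (le_abs_self a) (Real.log_nonneg hM)
      _ ≤ M ^ β / β * |a| := by gcongr; exact Real.log_le_rpow_div (by linarith) hβ
      _ = |a| / β * M ^ β := by ring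
  calc c₀ * Real.exp (c₁ * M ^ β) * M ^ a
      ≤ Real.exp (|c₀| * M ^ β) * Real.exp (c₁ * M ^ β) * Real.exp (|a| / β * M ^ β) := by gcongr
    _ = Real.exp ((|c₀| + c₁ + |a| / β) * M ^ β) := by
        rw [← Real.exp_add, ← Real.exp_add]; congr 1; ring

theorem natCast_mul_le_window_rpow {β : ℝ} (hβ : 0 < β) (s : ℕ) :
    s * β ≤ (window s : ℝ) ^ β := by
  have hM : (1 : ℝ) ≤ window s := by exact_mod_cast one_le_window s
  have hlog : (s : ℝ) ≤ Real.log (window s) := by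
    rw [Real.le_log_iff_exp_le (by linarith)]
    calc Real.exp s = Real.exp 1 ^ s := by rw [← Real.exp_nat_mul, mul_one]
      _ ≤ 4 ^ s := by gcongr; linarith [Real.exp_one_lt_three]
      _ ≤ window s := by exact_mod_cast four_pow_le_window s
  exact (le_div_iff₀ hβ).1 (hlog.trans (Real.log_le_rpow_div (by linarith) hβ))

theorem exp_neg_natCast_le (s : ℕ) : Real.exp (-(s : ℝ)) ≤ (1 / 2) ^ s := by
  rw [show -(s : ℝ) = s * (-1) by ring, Real.exp_nat_mul, Real.exp_neg, one_div]
  gcongr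
  linarith [Real.add_one_le_exp (1 : ℝ)]

theorem eventually_mul_tol_le {β σ : ℝ} (hβ : 0 < β) (hβσ : β < σ) (c₀ c₁ a : ℝ) :
    ∀ᶠ s : ℕ in atTop, c₀ * Real.exp (c₁ * (window s : ℝ) ^ β) * (window s : ℝ) ^ a * tol σ s ≤
      (1 / 2) ^ s := by
  filter_upwards [eventually_window_rpow_le hβσ (2 * (|c₀| + c₁ + |a| / β)),
    eventually_window_rpow_le hβσ (2 * β⁻¹)] with s hs hs'
  have hM : (1 : ℝ) ≤ window s := by exact_mod_cast one_le_window s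
  have hsβ : (s : ℝ) ≤ β⁻¹ * (window s : ℝ) ^ β := by
    rw [inv_mul_eq_div, le_div_iff₀ hβ]
    exact natCast_mul_le_window_rpow hβ s
  calc c₀ * Real.exp (c₁ * (window s : ℝ) ^ β) * (window s : ℝ) ^ a * tol σ s
      ≤ Real.exp ((|c₀| + c₁ + |a| / β) * (window s : ℝ) ^ β) * tol σ s :=
        mul_le_mul_of_nonneg_right (mul_exp_mul_rpow_le hM hβ c₀ c₁ a) (tol_pos σ s).le
    _ = Real.exp ((|c₀| + c₁ + |a| / β) * (window s : ℝ) ^ β + -(scale s : ℝ) ^ σ) := by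
        rw [tol, ← Real.exp_add]
    _ ≤ Real.exp (-(s : ℝ)) := Real.exp_le_exp.2 (by linarith)
    _ ≤ (1 / 2) ^ s := exp_neg_natCast_le s

end Asymptotics

section Wegner

variable {d : ℕ} {γ E δ : ℝ} {B : Finset (Fin d → ℤ)} {x : Fin d → ℤ}
  {V V' f f' : (Fin d → ℤ) → ℝ}

theorem exists_one_le_card_mul_sq {α : Type*} {B : Finset α} {f : α → ℝ}
    (h : ∑ y ∈ B, f y ^ 2 = 1) :
    ∃ x ∈ B, 1 ≤ B.card * f x ^ 2 ∧ ∀ y ∈ B, |f y| ≤ |f x| := by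
  have hne : B.Nonempty := Finset.nonempty_of_sum_ne_zero (h ▸ one_ne_zero)
  obtain ⟨x, hx, hmax⟩ := B.exists_max_image (fun y => |f y|) hne
  refine ⟨x, hx, ?_, hmax⟩
  rw [← h, ← nsmul_eq_mul]
  exact Finset.sum_le_card_nsmul _ _ _ fun y hy => sq_le_sq.2 (hmax y hy)

theorem IsApproxEigenvector.abs_le_one (h : IsApproxEigenvector γ V B E δ f)
    (y : Fin d → ℤ) : |f y| ≤ 1 := by
  by_cases hy : y ∈ B
  · rw [← sq_le_one_iff_abs_le_one, ← h.sum_sq]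
    exact Finset.single_le_sum (f := fun y => f y ^ 2) (fun _ _ => sq_nonneg _) hy
  · simp [h.eq_zero_of_notMem y hy]

theorem IsApproxEigenvector.congr (h : IsApproxEigenvector γ V B E δ f)
    (hV : ∀ y ∈ B, V y = V' y) : IsApproxEigenvector γ V' B E δ f := by
  refine ⟨h.eq_zero_of_notMem, h.sum_sq, (Finset.sum_congr rfl fun y hy => ?_).trans_le
    h.sum_sq_sub_le⟩
  simp only [realSchrodinger, hV y hy]

theorem isClosed_setOf_isApproxEigenvector (γ : ℝ) (B : Finset (Fin d → ℤ)) (E δ : ℝ) :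
    IsClosed {p : ((Fin d → ℤ) → ℝ) × ((Fin d → ℤ) → ℝ) |
      IsApproxEigenvector γ p.1 B E δ p.2} := by
  have hset : {p : ((Fin d → ℤ) → ℝ) × ((Fin d → ℤ) → ℝ) | IsApproxEigenvector γ p.1 B E δ p.2} =
      {p | (∀ y ∉ B, p.2 y = 0) ∧ ∑ y ∈ B, p.2 y ^ 2 = 1 ∧
        ∑ y ∈ B, (realSchrodinger γ p.1 p.2 y - E * p.2 y) ^ 2 ≤ δ ^ 2} :=
    Set.ext fun p => ⟨fun h => ⟨h.1, h.2, h.3⟩, fun h => ⟨h.1, h.2.1, h.2.2⟩⟩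
  simp only [hset, realSchrodinger, neighborSum, Set.ofPred_and, Set.ofPred_forall]
  refine .inter (isClosed_iInter fun y => isClosed_iInter fun _ => ?_) (.inter ?_ ?_)
  · exact isClosed_eq (by fun_prop) continuous_const
  · exact isClosed_eq (by fun_prop) continuous_const
  · exact isClosed_le (by fun_prop) continuous_const

/-- The potentials for which the restriction of `γ Δ + V` to `B` has a resonance at energy `E`
whose approximate eigenvector is not small at `x`. -/
def resonantAt (γ : ℝ) (B : Finset (Fin d → ℤ)) (x : Fin d → ℤ) (E δ : ℝ) :
    Set ((Fin d → ℤ) → ℝ) :=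
  {V | ∃ f, IsApproxEigenvector γ V B E δ f ∧ 1 ≤ B.card * f x ^ 2}

theorem isClosed_resonantAt (γ : ℝ) (B : Finset (Fin d → ℤ)) (x : Fin d → ℤ) (E δ : ℝ) :
    IsClosed (resonantAt γ B x E δ) := by
  let K : Set ((Fin d → ℤ) → ℝ) := Set.univ.pi fun _ => Set.Icc (-1) 1
  have : CompactSpace K := isCompact_iff_compactSpace.1 (isCompact_univ_pi fun _ => isCompact_Icc)
  let S : Set (((Fin d → ℤ) → ℝ) × K) :=
    {p | IsApproxEigenvector γ p.1 B E δ p.2 ∧ 1 ≤ B.card * (p.2 : (Fin d → ℤ) → ℝ) x ^ 2}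
  have hS : IsClosed S := by
    have hval : Continuous fun p : ((Fin d → ℤ) → ℝ) × K => (p.2 : (Fin d → ℤ) → ℝ) :=
      continuous_subtype_val.comp continuous_snd
    exact ((isClosed_setOf_isApproxEigenvector γ B E δ).preimage
      (continuous_fst.prodMk hval)).inter (isClosed_le continuous_const
        (continuous_const.mul (((continuous_apply x).comp hval).pow 2)))
  convert isClosedMap_fst_of_compactSpace S hS
  ext V
  constructor
  · rintro ⟨f, hf, hfx⟩
    exact ⟨(V, ⟨f, fun y _ => abs_le.1 (hf.abs_le_one y)⟩), ⟨hf, hfx⟩, rfl⟩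
  · rintro ⟨⟨V, f⟩, hf, rfl⟩
    exact ⟨f, hf⟩

theorem measurableSet_resonantAt (γ : ℝ) (B : Finset (Fin d → ℤ)) (x : Fin d → ℤ) (E δ : ℝ) :
    MeasurableSet (resonantAt γ B x E δ) :=
  (isClosed_resonantAt γ B x E δ).measurableSet

theorem resonantAt_congr (h : ∀ y ∈ B, V y = V' y) :
    V ∈ resonantAt γ B x E δ ↔ V' ∈ resonantAt γ B x E δ :=
  exists_congr fun _ => and_congr_left fun _ => ⟨fun hf => hf.congr h,
    fun hf => hf.congr fun y hy => (h y hy).symm⟩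

theorem sum_mul_shift (hf : ∀ y ∉ B, f y = 0) (hf' : ∀ y ∉ B, f' y = 0) (e : Fin d → ℤ) :
    ∑ y ∈ B, f' y * f (y + e) = ∑ y ∈ B, f y * f' (y - e) :=
  calc ∑ y ∈ B, f' y * f (y + e) = ∑' y, f' y * f (y + e) :=
        (tsum_eq_sum fun y hy => by simp [hf' y hy]).symm
    _ = ∑' y, f y * f' (y - e) := by
        rw [← (Equiv.addRight e).tsum_eq fun y => f y * f' (y - e)]
        simp [mul_comm]
    _ = ∑ y ∈ B, f y * f' (y - e) := tsum_eq_sum fun y hy => by simp [hf y hy]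

theorem sum_mul_neighborSum_comm (hf : ∀ y ∉ B, f y = 0) (hf' : ∀ y ∉ B, f' y = 0) :
    ∑ y ∈ B, f' y * neighborSum f y = ∑ y ∈ B, f y * neighborSum f' y := by
  simp only [neighborSum, Finset.mul_sum]
  rw [Finset.sum_comm, Finset.sum_comm (s := B) (t := Finset.univ)]
  refine Finset.sum_congr rfl fun i _ => ?_
  simp only [mul_add, Finset.sum_add_distrib]
  linarith [sum_mul_shift hf hf' (Pi.single i 1), sum_mul_shift hf' hf (Pi.single i 1)]

theorem sum_mul_realSchrodinger_sub (hf : ∀ y ∉ B, f y = 0) (hf' : ∀ y ∉ B, f' y = 0) (hx : x ∈ B)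
    (hV : ∀ y ∈ B, y ≠ x → V y = V' y) :
    ∑ y ∈ B, f' y * (realSchrodinger γ V f y - E * f y) -
      ∑ y ∈ B, f y * (realSchrodinger γ V' f' y - E * f' y) = (V x - V' x) * (f x * f' x) :=
  calc _ = ∑ y ∈ B, (γ * (f' y * neighborSum f y) - γ * (f y * neighborSum f' y) +
          (V y - V' y) * (f y * f' y)) := by
        rw [← Finset.sum_sub_distrib]
        exact Finset.sum_congr rfl fun y _ => by simp only [realSchrodinger]; ring
    _ = ∑ y ∈ B, (V y - V' y) * (f y * f' y) := by
        rw [Finset.sum_add_distrib, Finset.sum_sub_distrib, ← Finset.mul_sum, ← Finset.mul_sum,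
          sum_mul_neighborSum_comm hf hf', sub_self, zero_add]
    _ = _ := Finset.sum_eq_single_of_mem x hx fun y hy hyx => by
        rw [hV y hy hyx, sub_self, zero_mul]

theorem IsApproxEigenvector.abs_sum_mul_le (h : IsApproxEigenvector γ V B E δ f) (hδ : 0 ≤ δ)
    (hf' : ∑ y ∈ B, f' y ^ 2 = 1) :
    |∑ y ∈ B, f' y * (realSchrodinger γ V f y - E * f y)| ≤ δ := by
  refine abs_le_of_sq_le_sq ((Finset.sum_mul_sq_le_sq_mul_sq B _ _).trans ?_) hδ
  rw [hf', one_mul]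
  exact h.sum_sq_sub_le

theorem abs_sub_le_of_mem_resonantAt (hδ : 0 ≤ δ) (hx : x ∈ B)
    (hVV' : ∀ y ∈ B, y ≠ x → V y = V' y)
    (h : V ∈ resonantAt γ B x E δ) (h' : V' ∈ resonantAt γ B x E δ) :
    |V x - V' x| ≤ 2 * δ * B.card := by
  obtain ⟨f, hf, hfx⟩ := h
  obtain ⟨f', hf', hfx'⟩ := h'
  have hupper : |V x - V' x| * |f x * f' x| ≤ 2 * δ := by
    rw [← abs_mul, ← sum_mul_realSchrodinger_sub (γ := γ) (E := E) hf.eq_zero_of_notMem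
      hf'.eq_zero_of_notMem hx hVV']
    linarith [abs_sub (∑ y ∈ B, f' y * (realSchrodinger γ V f y - E * f y))
      (∑ y ∈ B, f y * (realSchrodinger γ V' f' y - E * f' y)),
      hf.abs_sum_mul_le hδ hf'.sum_sq, hf'.abs_sum_mul_le hδ hf.sum_sq]
  have hlower : 1 ≤ B.card * |f x * f' x| := by
    refine (one_le_sq_iff₀ (by positivity)).1 ?_
    rw [mul_pow, sq_abs, mul_pow]
    nlinarith [mul_le_mul hfx hfx' zero_le_one (by positivity)]
  calc |V x - V' x| ≤ |V x - V' x| * (B.card * |f x * f' x|) :=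
        le_mul_of_one_le_right (abs_nonneg _) hlower
    _ = |V x - V' x| * |f x * f' x| * B.card := by ring
    _ ≤ 2 * δ * B.card := by gcongr

theorem IsApproxEigenvector.perturb {E' : ℝ} (h : IsApproxEigenvector γ V B E δ f)
    (hV : ∀ y ∈ B, |V y - V' y| ≤ δ) (hE : |E - E'| ≤ δ) :
    IsApproxEigenvector γ V' B E' (3 * δ) f := by
  refine ⟨h.eq_zero_of_notMem, h.sum_sq, ?_⟩
  have hterm : ∀ y ∈ B, (realSchrodinger γ V' f y - E' * f y) ^ 2 ≤
      3 * (realSchrodinger γ V f y - E * f y) ^ 2 + 6 * δ ^ 2 * f y ^ 2 := by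
    intro y hy
    set a := realSchrodinger γ V f y - E * f y with ha
    set b := V' y - V y + (E - E') with hb
    have hb_le : |b| ≤ 2 * δ :=
      (abs_add_le _ _).trans (by linarith [abs_sub_comm (V y) (V' y) ▸ hV y hy])
    have hb_sq : b ^ 2 ≤ (2 * δ) ^ 2 := sq_le_sq.2 (hb_le.trans (le_abs_self _))
    have hsplit : realSchrodinger γ V' f y - E' * f y = a + b * f y := by
      simp only [ha, hb, realSchrodinger]; ring
    rw [hsplit]
    nlinarith [sq_nonneg (2 * a - b * f y), mul_le_mul_of_nonneg_right hb_sq (sq_nonneg (f y))]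
  calc ∑ y ∈ B, (realSchrodinger γ V' f y - E' * f y) ^ 2 ≤
        ∑ y ∈ B, (3 * (realSchrodinger γ V f y - E * f y) ^ 2 + 6 * δ ^ 2 * f y ^ 2) :=
        Finset.sum_le_sum hterm
    _ = 3 * ∑ y ∈ B, (realSchrodinger γ V f y - E * f y) ^ 2 + 6 * δ ^ 2 := by
        rw [Finset.sum_add_distrib, ← Finset.mul_sum, ← Finset.mul_sum, h.sum_sq, mul_one]
    _ ≤ (3 * δ) ^ 2 := by linarith [h.sum_sq_sub_le]

theorem IsResonant.exists_mem_resonantAt {E' : ℝ} (h : IsResonant γ V B E δ)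
    (hV : ∀ y ∈ B, |V y - V' y| ≤ δ) (hE : |E - E'| ≤ δ) :
    ∃ x ∈ B, V' ∈ resonantAt γ B x E' (3 * δ) := by
  obtain ⟨f, hf⟩ := h
  obtain ⟨x, hx, hfx, -⟩ := exists_one_le_card_mul_sq hf.sum_sq
  exact ⟨x, hx, f, hf.perturb hV hE, hfx⟩

theorem IsResonant.abs_le {K : ℝ} (hγ : 0 ≤ γ) (hγd : 2 * d * γ ≤ 1) (hδ : 0 ≤ δ) (hδ1 : δ ≤ 1)
    (hV : ∀ y, |V y| ≤ K) (h : IsResonant γ V B E δ) : |E| ≤ K + 1 + B.card := by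
  obtain ⟨f, hf⟩ := h
  obtain ⟨x, hx, hfx, hmax⟩ := exists_one_le_card_mul_sq hf.sum_sq
  have hcard : 1 ≤ B.card * |f x| := by
    nlinarith [sq_abs (f x), hf.abs_le_one x, mul_nonneg B.card.cast_nonneg (abs_nonneg (f x))]
  have hpos : 0 < |f x| := (abs_nonneg _).lt_of_ne' fun h0 => by simp [h0] at hcard; linarith
  have herror : |realSchrodinger γ V f x - E * f x| ≤ δ :=
    abs_le_of_sq_le_sq ((Finset.single_le_sum
      (f := fun y => (realSchrodinger γ V f y - E * f y) ^ 2) (fun _ _ => sq_nonneg _) hx).trans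
      hf.sum_sq_sub_le) hδ
  have hneighbor : |neighborSum f x| ≤ 2 * d * |f x| := abs_neighborSum_le fun w _ => by
    by_cases hw : w ∈ B
    · exact hmax w hw
    · simp [hf.eq_zero_of_notMem w hw]
  refine le_of_mul_le_mul_right ?_ hpos
  calc |E| * |f x| = |γ * neighborSum f x + V x * f x - (realSchrodinger γ V f x - E * f x)| := by
        rw [← abs_mul]; congr 1; simp only [realSchrodinger]; ring
    _ ≤ |γ * neighborSum f x| + |V x * f x| + |realSchrodinger γ V f x - E * f x| :=
        (abs_sub _ _).trans (by gcongr; exact abs_add_le _ _)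
    _ ≤ γ * (2 * d * |f x|) + K * |f x| + δ := by
        rw [abs_mul, abs_of_nonneg hγ, abs_mul]
        have := hV x
        gcongr
    _ ≤ (K + 1 + B.card) * |f x| := by
        nlinarith

end Wegner

section Conditioning

variable {Θ 𝒴 : Type*} [MeasurableSpace Θ] [MeasurableSpace 𝒴]

theorem withDensity_le_of_forall_abs_sub_le {p : ℝ → ℝ≥0∞} {D ℓ : ℝ} (hD : 0 ≤ D)
    (hp : ∀ t, p t ≤ ENNReal.ofReal D) {S : Set ℝ} (hS : MeasurableSet S)
    (hdiam : ∀ t ∈ S, ∀ t' ∈ S, |t - t'| ≤ ℓ) :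
    volume.withDensity p S ≤ ENNReal.ofReal (D * ℓ) := by
  have hvol : volume S ≤ ENNReal.ofReal ℓ := by
    refine (Real.volume_le_diam _).trans (Metric.ediam_le fun t ht t' ht' => ?_)
    rw [edist_dist, Real.dist_eq]
    exact ENNReal.ofReal_le_ofReal (hdiam t ht t' ht')
  rw [withDensity_apply _ hS, ENNReal.ofReal_mul hD]
  calc ∫⁻ t in S, p t ≤ ∫⁻ _ in S, ENNReal.ofReal D := lintegral_mono hp
    _ = ENNReal.ofReal D * volume S := setLIntegral_const _ _
    _ ≤ ENNReal.ofReal D * ENNReal.ofReal ℓ := by gcongr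

theorem measure_and_mem_le_of_condDistrib_le {P : Measure Θ} [IsFiniteMeasure P] {Y : Θ → 𝒴}
    {X : Θ → ℝ} (hY : Measurable Y) (hX : Measurable X) {c : ℝ≥0∞} {S : Set (𝒴 × ℝ)}
    (hS : MeasurableSet S) (h : ∀ᵐ θ ∂P, condDistrib X Y P (Y θ) (Prod.mk (Y θ) ⁻¹' S) ≤ c)
    {A : Set 𝒴} (hA : MeasurableSet A) :
    P {θ | Y θ ∈ A ∧ (Y θ, X θ) ∈ S} ≤ c * P {θ | Y θ ∈ A} := by
  have hae : ∀ᵐ y ∂P.map Y, condDistrib X Y P y (Prod.mk y ⁻¹' S) ≤ c :=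
    (ae_map_iff hY.aemeasurable (measurableSet_le (Kernel.measurable_kernel_prodMk_left hS)
      measurable_const)).2 h
  have hAS : MeasurableSet (Prod.fst ⁻¹' A ∩ S) := (measurable_fst hA).inter hS
  have hsection : ∀ y, condDistrib X Y P y (Prod.mk y ⁻¹' (Prod.fst ⁻¹' A ∩ S)) =
      A.indicator (fun y => condDistrib X Y P y (Prod.mk y ⁻¹' S)) y := fun y => by
    by_cases hy : y ∈ A <;> simp [hy, Set.preimage_preimage]
  calc P {θ | Y θ ∈ A ∧ (Y θ, X θ) ∈ S} = (P.map Y ⊗ₘ condDistrib X Y P) (Prod.fst ⁻¹' A ∩ S) := by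
        rw [compProd_map_condDistrib hX.aemeasurable, Measure.map_apply (hY.prodMk hX) hAS]
        rfl
    _ = ∫⁻ y in A, condDistrib X Y P y (Prod.mk y ⁻¹' S) ∂P.map Y := by
        rw [Measure.compProd_apply hAS, lintegral_congr hsection, lintegral_indicator hA]
    _ ≤ ∫⁻ _ in A, c ∂P.map Y := lintegral_mono_ae (ae_restrict_of_ae hae)
    _ = c * P {θ | Y θ ∈ A} := by
        rw [setLIntegral_const, Measure.map_apply hY hA]
        rfl

end Conditioning

section Fields

variable {Θ ι : Type*} [MeasurableSpace Θ] {P : Measure Θ}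

/-- The random field `X` has conditional distributions, at each site of `F` given the other sites
of `F`, with densities at most `D`. In terms of probabilities: whatever is known about the other
sites, the value at `x` falls into a set whose sections have diameter at most `ℓ` with probability
at most `D ℓ`. -/
def CondDensityBound (P : Measure Θ) (X : Θ → ι → ℝ) (F : Finset ι) (D : ℝ) : Prop :=
  ∀ x ∈ F, ∀ A S : Set (ι → ℝ), MeasurableSet A → MeasurableSet S →
    DependsOn (· ∈ A) ((F : Set ι) \ {x}) → DependsOn (· ∈ S) (F : Set ι) →
    ∀ ℓ : ℝ, (∀ f ∈ S, ∀ f' ∈ S, (∀ y ∈ (F : Set ι) \ {x}, f y = f' y) → |f x - f' x| ≤ ℓ) →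
    P {θ | X θ ∈ A ∧ X θ ∈ S} ≤ ENNReal.ofReal (D * ℓ) * P {θ | X θ ∈ A}

section Splice

variable {Ω : Type*} [MetricSpace Ω] {τ : ι → Ω} {ε : ℝ} {x : ι}

open Classical in
/-- The field on `ι` with value `q.2` at `x`, whose values at the sites `y` with `τ y` at distance
at least `ε` from `τ x` are read off from `q.1`. The remaining sites carry the value `0`. -/
noncomputable def splice (τ : ι → Ω) (ε : ℝ) (x : ι)
    (q : ({ω : Ω // ε ≤ dist ω (τ x)} → ℝ) × ℝ) (y : ι) : ℝ :=
  if y = x then q.2 else if hy : ε ≤ dist (τ y) (τ x) then q.1 ⟨τ y, hy⟩ else 0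

theorem splice_self (q : ({ω : Ω // ε ≤ dist ω (τ x)} → ℝ) × ℝ) : splice τ ε x q x = q.2 :=
  if_pos rfl

theorem splice_of_ne {q : ({ω : Ω // ε ≤ dist ω (τ x)} → ℝ) × ℝ} {y : ι} (hyx : y ≠ x)
    (hy : ε ≤ dist (τ y) (τ x)) : splice τ ε x q y = q.1 ⟨τ y, hy⟩ := by
  rw [splice, if_neg hyx, dif_pos hy]

theorem measurable_splice (τ : ι → Ω) (ε : ℝ) (x : ι) : Measurable (splice τ ε x) := by
  refine measurable_pi_lambda _ fun y => ?_
  unfold splice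
  split_ifs <;> fun_prop

end Splice

theorem condDensityBound_of_condLaw {Ω : Type*} [MetricSpace Ω] [IsFiniteMeasure P]
    {v : Ω → Θ → ℝ} (hv : ∀ ω, Measurable (v ω)) {τ : ι → Ω} {F : Finset ι} {ε D : ℝ}
    (hD : 0 ≤ D) (hsep : ∀ x ∈ F, ∀ y ∈ F, y ≠ x → ε ≤ dist (τ y) (τ x))
    (h : ∀ ω, ∀ᵐ θ ∂P, ∃ p : ℝ → ℝ≥0∞, Measurable p ∧
      condLaw P v ω ε (fun ω' : {ω' : Ω // ε ≤ dist ω' ω} => v ω' θ) = volume.withDensity p ∧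
      ∀ t : ℝ, p t ≤ ENNReal.ofReal D) :
    CondDensityBound P (fun θ x => v (τ x) θ) F D := by
  intro x hx A S hA hS hAdep hSdep ℓ hdiam
  let Y : Θ → {ω' : Ω // ε ≤ dist ω' (τ x)} → ℝ := fun θ ω' => v ω' θ
  have hsplice : ∀ q, ∀ y ∈ (F : Set ι) \ {x}, ∃ hy, splice τ ε x q y = q.1 ⟨τ y, hy⟩ :=
    fun q y hy => ⟨_, splice_of_ne hy.2 (hsep x hx y hy.1 hy.2)⟩
  have hYA : ∀ θ, splice τ ε x (Y θ, 0) ∈ A ↔ (fun y => v (τ y) θ) ∈ A := fun θ =>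
    (hAdep fun y hy => (hsplice (Y θ, 0) y hy).choose_spec).to_iff
  have hYS : ∀ θ, splice τ ε x (Y θ, v (τ x) θ) ∈ S ↔ (fun y => v (τ y) θ) ∈ S := fun θ => by
    refine (hSdep fun y hy => ?_).to_iff
    rcases eq_or_ne y x with rfl | hyx
    · exact splice_self _
    · exact (hsplice (Y θ, v (τ x) θ) y ⟨hy, hyx⟩).choose_spec
  have hmeas := measurable_splice τ ε x
  have hSx : MeasurableSet (splice τ ε x ⁻¹' S) := hmeas hS
  have hcond : ∀ᵐ θ ∂P, condDistrib (v (τ x)) Y P (Y θ) (Prod.mk (Y θ) ⁻¹' (splice τ ε x ⁻¹' S)) ≤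
      ENNReal.ofReal (D * ℓ) := by
    filter_upwards [h (τ x)] with θ ⟨p, _, hp, hpD⟩
    have hp' : condDistrib (v (τ x)) Y P (Y θ) = volume.withDensity p := hp
    rw [hp']
    refine withDensity_le_of_forall_abs_sub_le hD hpD (measurable_prodMk_left hSx)
      fun t ht t' ht' => ?_
    have hle := hdiam _ ht _ ht' fun y hy => by
      obtain ⟨_, ht_eq⟩ := hsplice (Y θ, t) y hy
      obtain ⟨_, ht'_eq⟩ := hsplice (Y θ, t') y hy
      rw [ht_eq, ht'_eq]
    rwa [splice_self, splice_self] at hle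
  have hmain := measure_and_mem_le_of_condDistrib_le (measurable_pi_lambda Y fun _ => hv _)
    (hv (τ x)) hSx hcond (A := {η | splice τ ε x (η, 0) ∈ A})
    ((hmeas.comp measurable_prodMk_right) hA)
  simpa only [Set.mem_ofPred_eq, Set.mem_preimage, hYA, hYS] using hmain

theorem CondDensityBound.measure_forall_le [IsProbabilityMeasure P] {X : Θ → ι → ℝ} {F : Finset ι}
    {D ℓ : ℝ} (h : CondDensityBound P X F D) {p : ℕ} (B : Fin p → Finset ι) (x : Fin p → ι)
    (S : Fin p → Set (ι → ℝ)) (hx : ∀ i, x i ∈ B i) (hB : ∀ i, B i ⊆ F)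
    (hdisj : Pairwise fun i j => Disjoint (B i) (B j)) (hS : ∀ i, MeasurableSet (S i))
    (hSdep : ∀ i, DependsOn (· ∈ S i) (B i : Set ι))
    (hdiam : ∀ i, ∀ f ∈ S i, ∀ f' ∈ S i, (∀ y ∈ B i, y ≠ x i → f y = f' y) →
      |f (x i) - f' (x i)| ≤ ℓ) :
    P {θ | ∀ i, X θ ∈ S i} ≤ ENNReal.ofReal (D * ℓ) ^ p := by
  induction p with
  | zero => simp
  | succ p ih =>
    have htail := ih (fun i => B i.succ) (fun i => x i.succ) (fun i => S i.succ)
      (fun i => hx _) (fun i => hB _) (fun i j hij => hdisj (by simpa using hij))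
      (fun i => hS _) (fun i => hSdep _) (fun i => hdiam _)
    have htail_meas : MeasurableSet {f | ∀ i : Fin p, f ∈ S i.succ} := by
      rw [Set.ofPred_forall]
      exact .iInter fun i => hS _
    have htail_dep : DependsOn (· ∈ {f | ∀ i : Fin p, f ∈ S i.succ}) ((F : Set ι) \ {x 0}) :=
      fun f f' hff' => forall_congr fun i => hSdep _ fun y hy => hff' y ⟨hB _ hy, fun hyx =>
        Finset.disjoint_left.1 (hdisj (Fin.succ_ne_zero i)) hy (hyx ▸ hx 0)⟩
    have hhead := h (x 0) (hB 0 (hx 0)) {f | ∀ i : Fin p, f ∈ S i.succ} (S 0)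
      htail_meas (hS 0) htail_dep
      (fun f f' hff' => hSdep 0 fun y hy => hff' y (hB 0 hy)) ℓ
      (fun f hf f' hf' hff' => hdiam 0 f hf f' hf' fun y hy hyx => hff' y ⟨hB 0 hy, hyx⟩)
    calc P {θ | ∀ i, X θ ∈ S i} =
          P {θ | X θ ∈ {f | ∀ i : Fin p, f ∈ S i.succ} ∧ X θ ∈ S 0} := by
          simp only [Fin.forall_fin_succ, and_comm, Set.mem_ofPred_eq]
      _ ≤ ENNReal.ofReal (D * ℓ) ^ (p + 1) := by
          rw [pow_succ']
          exact hhead.trans (mul_le_mul_right htail _)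

end Fields

theorem exists_int_abs_sub_mul_le {E δ : ℝ} {N : ℕ} (hδ : 0 < δ) (hE : |E| ≤ N * δ) :
    ∃ j ∈ Finset.Icc (-(N : ℤ)) N, |E - j * δ| ≤ δ := by
  obtain ⟨hlower, hupper⟩ := abs_le.1 hE
  have hfloor_le : ⌊E / δ⌋ * δ ≤ E := (le_div_iff₀ hδ).1 (Int.floor_le _)
  have hlt_floor : E < (⌊E / δ⌋ + 1) * δ := (div_lt_iff₀ hδ).1 (Int.lt_floor_add_one _)
  refine ⟨⌊E / δ⌋, Finset.mem_Icc.2 ⟨?_, ?_⟩, abs_le.2 ⟨by linarith, by linarith⟩⟩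
  · rw [Int.le_floor, le_div_iff₀ hδ]
    push_cast
    linarith
  · have hle : (⌊E / δ⌋ : ℝ) ≤ N := le_of_mul_le_mul_right (hfloor_le.trans hupper) hδ
    exact_mod_cast hle

theorem measure_mem_biUnion_le {Θ β ι : Type*} [MeasurableSpace Θ] {P : Measure Θ} {X : Θ → β}
    {T : Finset ι} {S : ι → Set β} {a b : ℝ} (hT : T.card ≤ a)
    (hS : ∀ t ∈ T, P {θ | X θ ∈ S t} ≤ ENNReal.ofReal b) :
    P {θ | X θ ∈ ⋃ t ∈ T, S t} ≤ ENNReal.ofReal (a * b) :=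
  calc P {θ | X θ ∈ ⋃ t ∈ T, S t} = P (⋃ t ∈ T, {θ | X θ ∈ S t}) := by
        congr 1
        ext θ
        simp
    _ ≤ ∑ t ∈ T, P {θ | X θ ∈ S t} := measure_biUnion_finset_le _ _
    _ ≤ T.card • ENNReal.ofReal b := Finset.sum_le_card_nsmul _ _ _ hS
    _ = ENNReal.ofReal T.card * ENNReal.ofReal b := by
        rw [nsmul_eq_mul, ENNReal.ofReal_natCast]
    _ ≤ ENNReal.ofReal (a * b) := by
        rw [ENNReal.ofReal_mul ((Nat.cast_nonneg _).trans hT)]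
        gcongr

section Events

variable {d : ℕ}

theorem disjoint_latticeBall {x y : Fin d → ℤ} {r R : ℕ} (h : r + R < latticeNorm (x - y)) :
    Disjoint (latticeBall x r) (latticeBall y R) := by
  refine Finset.disjoint_left.2 fun w hx hy => ?_
  rw [mem_latticeBall] at hx hy
  have := latticeNorm_sub_le x w y
  rw [latticeNorm_sub_comm x w] at this
  omega

open Classical in
/-- The possible locations of `p` well separated resonant balls in the window about the origin:
each ball is given by its centre, its radius and a marked site. -/
noncomputable def resTuples (d J s p : ℕ) : Finset (Fin p → (Fin d → ℤ) × ℕ × (Fin d → ℤ)) :=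
  (Fintype.piFinset fun _ => latticeBall 0 (window s) ×ˢ Finset.range (resRadius J s + 1) ×ˢ
    latticeBall 0 (window s + resRadius J s)).filter fun t =>
      (∀ i, (t i).2.2 ∈ latticeBall (t i).1 (t i).2.1) ∧
      Pairwise fun i j => ¬ latticeNorm ((t i).1 - (t j).1) ≤ 2 * resRadius J s

/-- The potentials with `p` well separated resonances of scale `s` and width `δ` at energy `E`. -/
def resEvent (γ : ℝ) (J s p : ℕ) (E δ : ℝ) : Set ((Fin d → ℤ) → ℝ) :=
  ⋃ t ∈ resTuples d J s p,
    {V | ∀ i, V ∈ resonantAt γ (latticeBall (t i).1 (t i).2.1) (t i).2.2 E δ}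

/-- The number of steps of the energy grid, on either side of `0`, when the potential is bounded
by `K`. -/
noncomputable def gridSize (d : ℕ) (σ K : ℝ) (s : ℕ) : ℕ :=
  ⌈(K + 1 + (2 * window s) ^ d) / tol σ s⌉₊

/-- The potentials with `p` well separated resonances of scale `s` at some energy of the grid. -/
def gridEvent (γ : ℝ) (J : ℕ) (σ K : ℝ) (s p : ℕ) : Set ((Fin d → ℤ) → ℝ) :=
  ⋃ j ∈ Finset.Icc (-(gridSize d σ K s : ℤ)) (gridSize d σ K s),
    resEvent γ J s p (j * tol σ s) (3 * tol σ s)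

theorem measurableSet_resEvent (γ : ℝ) (J s p : ℕ) (E δ : ℝ) :
    MeasurableSet (resEvent γ J s p E δ : Set ((Fin d → ℤ) → ℝ)) := by
  refine Finset.measurableSet_biUnion _ fun t _ => ?_
  rw [Set.ofPred_forall]
  exact .iInter fun i => measurableSet_resonantAt _ _ _ _ _

theorem measurableSet_gridEvent (γ : ℝ) (J : ℕ) (σ K : ℝ) (s p : ℕ) :
    MeasurableSet (gridEvent γ J σ K s p : Set ((Fin d → ℤ) → ℝ)) :=
  Finset.measurableSet_biUnion _ fun _ _ => measurableSet_resEvent _ _ _ _ _ _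

variable {γ E K σ : ℝ} {J s p : ℕ}

theorem mem_resTuples {t : Fin p → (Fin d → ℤ) × ℕ × (Fin d → ℤ)} :
    t ∈ resTuples d J s p ↔
      (∀ i, (t i).1 ∈ latticeBall 0 (window s) ∧ (t i).2.1 ≤ resRadius J s ∧
        (t i).2.2 ∈ latticeBall (t i).1 (t i).2.1) ∧
      Pairwise fun i j => ¬ latticeNorm ((t i).1 - (t j).1) ≤ 2 * resRadius J s := by
  simp only [resTuples, Finset.mem_filter, Fintype.mem_piFinset, Finset.mem_product,
    Finset.mem_range, Nat.lt_succ_iff]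
  constructor
  · exact fun ⟨hmem, hmark, hsep⟩ => ⟨fun i => ⟨(hmem i).1, (hmem i).2.1, hmark i⟩, hsep⟩
  · refine fun ⟨hmem, hsep⟩ =>
      ⟨fun i => ⟨(hmem i).1, (hmem i).2.1, ?_⟩, fun i => (hmem i).2.2, hsep⟩
    obtain ⟨hcenter, hradius, hmark⟩ := hmem i
    refine latticeBall_subset ?_ hmark
    rw [mem_latticeBall] at hcenter
    omega

theorem card_resTuples_le (hRM : resRadius J s + 1 ≤ window s) :
    ((resTuples d J s p).card : ℝ) ≤
      ((3 * (window s : ℝ)) ^ d * (window s * (5 * window s) ^ d)) ^ p := by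
  classical
  have hcenters : (latticeBall (0 : Fin d → ℤ) (window s)).card ≤ (3 * window s) ^ d :=
    (card_latticeBall_le _ _).trans (Nat.pow_le_pow_left (by omega) d)
  have hmarks : (latticeBall (0 : Fin d → ℤ) (window s + resRadius J s)).card ≤
      (5 * window s) ^ d :=
    (card_latticeBall_le _ _).trans (Nat.pow_le_pow_left (by omega) d)
  have hcard : (resTuples d J s p).card ≤
      ((3 * window s) ^ d * (window s * (5 * window s) ^ d)) ^ p := by
    refine (Finset.card_filter_le _ _).trans ?_
    rw [Fintype.card_piFinset, Finset.prod_const, Finset.card_univ, Fintype.card_fin,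
      Finset.card_product, Finset.card_product, Finset.card_range]
    gcongr
  exact_mod_cast hcard

theorem IsResonant.abs_energy_le {u : Fin d → ℤ} {r : ℕ} {V : (Fin d → ℤ) → ℝ} (hγ : 0 ≤ γ)
    (hγd : 2 * d * γ ≤ 1) (hRM : resRadius J s + 1 ≤ window s) (hr : r ≤ resRadius J s)
    (hV : ∀ y, |V y| ≤ K) (h : IsResonant γ V (latticeBall u r) E (tol σ s)) :
    |E| ≤ gridSize d σ K s * tol σ s := by
  have hcard : (latticeBall u r).card ≤ (2 * window s) ^ d :=
    (card_latticeBall_le u r).trans (Nat.pow_le_pow_left (by omega) d)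
  calc |E| ≤ K + 1 + (latticeBall u r).card :=
        h.abs_le hγ hγd (tol_pos σ s).le (tol_le_one σ s) hV
    _ ≤ K + 1 + (2 * window s) ^ d := by gcongr; exact_mod_cast hcard
    _ ≤ gridSize d σ K s * tol σ s := (div_le_iff₀ (tol_pos σ s)).1 (Nat.le_ceil _)

theorem SeparatedResonances.mem_gridEvent (hp : p ≠ 0) (hγ : 0 ≤ γ) (hγd : 2 * d * γ ≤ 1)
    (hRM : resRadius J s + 1 ≤ window s) {V V' : (Fin d → ℤ) → ℝ} (hV : ∀ y, |V y| ≤ K)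
    (hVV' : ∀ y ∈ latticeBall 0 (2 * window s), |V y - V' y| ≤ tol σ s)
    (h : SeparatedResonances γ V J σ s p E 0) : V' ∈ gridEvent γ J σ K s p := by
  obtain ⟨u, hu, hsep⟩ := h
  choose r hr hres using fun i => (hu i).2
  let i₀ : Fin p := ⟨0, Nat.pos_of_ne_zero hp⟩
  obtain ⟨j, hj, hjE⟩ := exists_int_abs_sub_mul_le (tol_pos σ s)
    ((hres i₀).abs_energy_le hγ hγd hRM (hr i₀) hV)
  have hball : ∀ i, latticeBall (u i) (r i) ⊆ latticeBall 0 (2 * window s) := fun i => by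
    refine latticeBall_subset ?_
    have := mem_latticeBall.1 (hu i).1
    have := hr i
    omega
  choose x hx hxV using fun i =>
    (hres i).exists_mem_resonantAt (fun y hy => hVV' y (hball i hy)) hjE
  exact Set.mem_biUnion hj (Set.mem_biUnion (x := fun i => (u i, r i, x i))
    (mem_resTuples.2 ⟨fun i => ⟨(hu i).1, hr i, hx i⟩, hsep⟩) hxV)

section Probability

variable {Θ : Type*} [MeasurableSpace Θ] {P : Measure Θ} [IsProbabilityMeasure P]
  {X : Θ → (Fin d → ℤ) → ℝ} {D : ℝ}

theorem measure_forall_mem_resonantAt_le (hD : 0 ≤ D) (hRM : resRadius J s + 1 ≤ window s)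
    (h : CondDensityBound P X (latticeBall 0 (2 * window s)) D) {δ : ℝ} (hδ : 0 ≤ δ)
    {t : Fin p → (Fin d → ℤ) × ℕ × (Fin d → ℤ)} (ht : t ∈ resTuples d J s p) :
    P {θ | ∀ i, X θ ∈ resonantAt γ (latticeBall (t i).1 (t i).2.1) (t i).2.2 E δ} ≤
      ENNReal.ofReal ((D * (2 * δ * (2 * window s) ^ d)) ^ p) := by
  obtain ⟨hmem, hsep⟩ := mem_resTuples.1 ht
  rw [ENNReal.ofReal_pow (by positivity)]
  refine h.measure_forall_le (fun i => latticeBall (t i).1 (t i).2.1) (fun i => (t i).2.2)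
    (fun i => resonantAt γ (latticeBall (t i).1 (t i).2.1) (t i).2.2 E δ) (fun i => (hmem i).2.2)
    (fun i => latticeBall_subset ?_) (fun i j hij => disjoint_latticeBall ?_)
    (fun i => measurableSet_resonantAt _ _ _ _ _)
    (fun i f f' hff' => propext (resonantAt_congr hff')) fun i f hf f' hf' hff' => ?_
  · have := mem_latticeBall.1 (hmem i).1
    have := (hmem i).2.1
    omega
  · have := (hmem i).2.1
    have := (hmem j).2.1
    have := hsep hij
    omega
  · refine (abs_sub_le_of_mem_resonantAt hδ (hmem i).2.2 hff' hf hf').trans ?_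
    have hcard : (latticeBall (t i).1 (t i).2.1).card ≤ (2 * window s) ^ d :=
      (card_latticeBall_le _ _).trans (Nat.pow_le_pow_left (by have := (hmem i).2.1; omega) d)
    gcongr
    exact_mod_cast hcard

theorem measure_resEvent_le (hD : 0 ≤ D) (hRM : resRadius J s + 1 ≤ window s)
    (h : CondDensityBound P X (latticeBall 0 (2 * window s)) D) (γ : ℝ) (p : ℕ) (E : ℝ) {δ : ℝ}
    (hδ : 0 ≤ δ) :
    P {θ | X θ ∈ resEvent γ J s p E δ} ≤
      ENNReal.ofReal ((2 * 30 ^ d * (window s : ℝ) ^ (3 * d + 1) * D * δ) ^ p) := by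
  have hconst : ((3 * (window s : ℝ)) ^ d * (window s * (5 * window s) ^ d)) ^ p *
      (D * (2 * δ * (2 * window s) ^ d)) ^ p =
      (2 * 30 ^ d * (window s : ℝ) ^ (3 * d + 1) * D * δ) ^ p := by
    rw [show (30 : ℝ) ^ d = 3 ^ d * 5 ^ d * 2 ^ d by rw [← mul_pow, ← mul_pow]; norm_num]
    ring
  rw [← hconst]
  exact measure_mem_biUnion_le (card_resTuples_le hRM) fun t ht =>
    measure_forall_mem_resonantAt_le hD hRM h hδ ht

theorem card_grid_le (hK : 0 ≤ K) :
    ((Finset.Icc (-(gridSize d σ K s : ℤ)) (gridSize d σ K s)).card : ℝ) ≤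
      (2 * K + 5 + 2 * 2 ^ d) * (window s : ℝ) ^ d / tol σ s := by
  set N := gridSize d σ K s
  have hcard : (Finset.Icc (-(N : ℤ)) N).card = 2 * N + 1 := by rw [Int.card_Icc]; omega
  have hN : (N : ℝ) * tol σ s ≤ K + 1 + (2 * window s) ^ d + tol σ s := by
    calc (N : ℝ) * tol σ s ≤ ((K + 1 + (2 * window s) ^ d) / tol σ s + 1) * tol σ s := by
          have := tol_pos σ s
          gcongr
          exact (Nat.ceil_lt_add_one (by positivity)).le
      _ = K + 1 + (2 * window s) ^ d + tol σ s := by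
          rw [add_mul, div_mul_cancel₀ _ (tol_pos σ s).ne', one_mul]
  have hwindow : (1 : ℝ) ≤ (window s : ℝ) ^ d := one_le_pow₀ (by exact_mod_cast one_le_window s)
  rw [hcard, le_div_iff₀ (tol_pos σ s)]
  rw [mul_pow] at hN
  push_cast
  nlinarith [tol_le_one σ s]

/-- The bound on the probability of `gridEvent` when the conditional densities of the potential
are at most `D`. -/
noncomputable def gridBound (d : ℕ) (K σ D : ℝ) (s p : ℕ) : ℝ :=
  (2 * K + 5 + 2 * 2 ^ d) * (window s : ℝ) ^ d / tol σ s *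
    (6 * 30 ^ d * (window s : ℝ) ^ (3 * d + 1) * D * tol σ s) ^ p

theorem measure_gridEvent_le (hD : 0 ≤ D) (hRM : resRadius J s + 1 ≤ window s)
    (h : CondDensityBound P X (latticeBall 0 (2 * window s)) D) (γ : ℝ) (p : ℕ) (hK : 0 ≤ K) :
    P {θ | X θ ∈ gridEvent γ J σ K s p} ≤ ENNReal.ofReal (gridBound d K σ D s p) := by
  refine measure_mem_biUnion_le (card_grid_le hK) fun j _ => ?_
  convert measure_resEvent_le hD hRM h γ p (j * tol σ s) (δ := 3 * tol σ s)
    (by have := tol_pos σ s; positivity) using 3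
  ring

end Probability

end Events

section Estimates

theorem LargeScale.resRadius_lt_window {d J s : ℕ} {σ : ℝ} (h : LargeScale d J σ s) :
    resRadius J s + 1 ≤ window s := by
  have hlt : 16 * J * scale s < scale (s + 1) := by
    rw [scale_succ]
    exact Nat.mul_lt_mul_of_pos_right h.J_lt (scale_pos s)
  have hle : scale (s + 1) ≤ scale (s + 2) := scale_strictMono.monotone (by omega)
  have hdouble : 16 * J * scale s = 2 * (8 * J * scale s) := by ring
  unfold resRadius window
  omega

theorem le_dist_vadd_of_mem_latticeBall {d : ℕ} {Ω : Type*} [MetricSpace Ω]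
    [AddAction (Fin d → ℤ) Ω] {A c : ℝ}
    (h : ∀ (L : ℕ) (ω : Ω) (x : Fin d → ℤ), 0 < latticeNorm x → latticeNorm x ≤ L →
      c * (L : ℝ) ^ (-A) ≤ dist (x +ᵥ ω) ω) {r : ℕ} (ω : Ω) {x y : Fin d → ℤ}
    (hx : x ∈ latticeBall 0 r) (hy : y ∈ latticeBall 0 r) (hyx : y ≠ x) :
    c * (2 * r : ℝ) ^ (-A) ≤ dist (y +ᵥ ω) (x +ᵥ ω) := by
  have hpos : 0 < latticeNorm (y - x) :=
    Nat.pos_of_ne_zero fun h0 => hyx (sub_eq_zero.1 (latticeNorm_eq_zero.1 h0))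
  have hle : latticeNorm (y - x) ≤ 2 * r := by
    rw [mem_latticeBall] at hx hy
    have := latticeNorm_sub_le y 0 x
    rw [latticeNorm_sub_comm 0 x] at this
    omega
  have hdist := h (2 * r) (x +ᵥ ω) (y - x) hpos hle
  rw [vadd_vadd, sub_add_cancel] at hdist
  exact_mod_cast hdist

theorem min_rpow_neg_le {ε₀ c M A η β : ℝ} (hε₀ : 0 < ε₀) (hc : 0 < c) (hM : 1 ≤ M) (hβ : 0 ≤ β)
    (hAη : A * η ≤ β) :
    min ε₀ (c * (4 * M) ^ (-A)) ^ (-η) ≤ (ε₀ ^ (-η) + c ^ (-η) * 4 ^ β) * M ^ β := by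
  have hM4 : 0 < 4 * M := by linarith
  have hfirst : ε₀ ^ (-η) ≤ ε₀ ^ (-η) * M ^ β :=
    le_mul_of_one_le_right (by positivity) (Real.one_le_rpow hM hβ)
  have hfirst_nonneg : 0 ≤ ε₀ ^ (-η) * M ^ β := by positivity
  have hsecond_nonneg : 0 ≤ c ^ (-η) * 4 ^ β * M ^ β := by positivity
  rw [add_mul]
  rcases le_or_gt η 0 with hη | -
  · have hmin : min ε₀ (c * (4 * M) ^ (-A)) ^ (-η) ≤ ε₀ ^ (-η) :=
      Real.rpow_le_rpow (by positivity) (min_le_left _ _) (by linarith)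
    linarith
  rcases min_choice ε₀ (c * (4 * M) ^ (-A)) with hmin | hmin <;> rw [hmin]
  · linarith
  · have hsecond : (c * (4 * M) ^ (-A)) ^ (-η) ≤ c ^ (-η) * 4 ^ β * M ^ β :=
      calc (c * (4 * M) ^ (-A)) ^ (-η) = c ^ (-η) * (4 * M) ^ (A * η) := by
            rw [Real.mul_rpow hc.le (by positivity), ← Real.rpow_mul hM4.le, neg_mul_neg]
        _ ≤ c ^ (-η) * (4 * M) ^ β := by
            gcongr
            linarith
        _ = c ^ (-η) * 4 ^ β * M ^ β := by
            rw [Real.mul_rpow (by norm_num) (by linarith), mul_assoc]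
    linarith

theorem exists_condDensityBound {d : ℕ} {Ω : Type*} [MetricSpace Ω] [AddAction (Fin d → ℤ) Ω]
    {Θ : Type*} [MeasurableSpace Θ] {P : Measure Θ} [IsFiniteMeasure P]
    {v : Ω → Θ → ℝ} {A η : ℝ} (hv : ∀ ω, Measurable (v ω)) (hUPA : UPA d Ω A) (hLIB : LIB P v η)
    (hAη : A * η < 1) :
    ∃ β : ℝ, 0 < β ∧ β < 1 ∧ ∃ C : ℝ, ∀ (ω : Ω) (s : ℕ),
      CondDensityBound P (fun θ (x : Fin d → ℤ) => v (x +ᵥ ω) θ) (latticeBall 0 (2 * window s))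
        (Real.exp (C * (window s : ℝ) ^ β)) := by
  obtain ⟨c, hc, hUPA⟩ := hUPA
  obtain ⟨C, hC, ε₀, hε₀, hLIB⟩ := hLIB
  obtain ⟨β, hβ, hβ1⟩ := exists_between (max_lt hAη one_pos)
  obtain ⟨hAβ, hβ0⟩ := max_lt_iff.1 hβ
  refine ⟨β, hβ0, hβ1, C * (ε₀ ^ (-η) + c ^ (-η) * 4 ^ β), fun ω s => ?_⟩
  have hM : (1 : ℝ) ≤ window s := Nat.one_le_cast.2 (one_le_window s)
  set ε := min ε₀ (c * (4 * window s) ^ (-A))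
  have hε : 0 < ε := by positivity
  refine condDensityBound_of_condLaw hv (τ := fun x : Fin d → ℤ => x +ᵥ ω) (ε := ε)
    (Real.exp_pos _).le (fun x hx y hy hyx => (min_le_right _ _).trans ?_) fun ω' => ?_
  · have hdist := le_dist_vadd_of_mem_latticeBall hUPA ω hx hy hyx
    push_cast at hdist
    rwa [← mul_assoc, show (2 : ℝ) * 2 = 4 by norm_num] at hdist
  · filter_upwards [hLIB ε hε (min_le_left _ _) ω'] with θ ⟨p, hp, hlaw, hpb⟩
    refine ⟨p, hp, hlaw, fun t => (hpb t).trans (ENNReal.ofReal_le_ofReal ?_)⟩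
    rw [Real.exp_le_exp, mul_assoc]
    exact mul_le_mul_of_nonneg_left (min_rpow_neg_le hε₀ hc hM hβ0.le hAβ.le) hC.le

theorem rpow_neg_div_mul_pow_le {t ν : ℝ} {p : ℕ} (ht : 0 < t) (ht1 : t ≤ 1) (hp : 2 + ν ≤ p) :
    t ^ (-ν) / t * t ^ p ≤ t :=
  calc t ^ (-ν) / t * t ^ p = t ^ (-ν - 1 + p) := by
        rw [Real.rpow_add ht, Real.rpow_sub ht, Real.rpow_one, Real.rpow_natCast]
    _ ≤ t ^ (1 : ℝ) := Real.rpow_le_rpow_of_exponent_ge ht ht1 (by linarith)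
    _ = t := Real.rpow_one t

/- The probability of `p` resonances beats the cardinality of a net when `p` is large: each
resonance contributes a factor `tol σ s`, the net and the energy grid cost `tol σ s ^ (-ν - 1)`. -/
theorem eventually_gridBound_le (d p : ℕ) {β σ ν : ℝ} (hβ : 0 < β) (hβσ : β < σ)
    (hp : 2 + ν ≤ p) {c K : ℝ} (c₁ a : ℝ) (hc : 0 ≤ c) (hK : 0 ≤ K) :
    ∀ᶠ s : ℕ in atTop, c * (window s : ℝ) ^ a * tol σ s ^ (-ν) *
      gridBound d K σ (Real.exp (c₁ * (window s : ℝ) ^ β)) s p ≤ (1 / 2) ^ s := by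
  filter_upwards [eventually_mul_tol_le hβ hβσ (c * (2 * K + 5 + 2 * 2 ^ d) * (6 * 30 ^ d) ^ p)
    (p * c₁) (a + d + (3 * d + 1) * p)] with s hs
  refine le_trans ?_ hs
  have hM : (0 : ℝ) < window s := by exact_mod_cast one_le_window s
  unfold gridBound
  set M : ℝ := ((window s : ℕ) : ℝ)
  set t := tol σ s
  set cG := 2 * K + 5 + 2 * 2 ^ d
  have hMpow : M ^ (a + d + (3 * d + 1) * p) = M ^ a * M ^ d * (M ^ (3 * d + 1)) ^ p := by
    have hcast : a + d + (3 * d + 1) * p = a + d + ((3 * d + 1) * p : ℕ) := by push_cast; rfl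
    rw [hcast, Real.rpow_add hM, Real.rpow_add hM, Real.rpow_natCast, Real.rpow_natCast, pow_mul]
  have hexp : Real.exp (p * c₁ * M ^ β) = Real.exp (c₁ * M ^ β) ^ p := by
    rw [← Real.exp_nat_mul, mul_assoc]
  rw [hMpow, hexp]
  calc c * M ^ a * t ^ (-ν) * (cG * M ^ d / t *
        (6 * 30 ^ d * M ^ (3 * d + 1) * Real.exp (c₁ * M ^ β) * t) ^ p)
      = (c * cG * (6 * 30 ^ d) ^ p * Real.exp (c₁ * M ^ β) ^ p *
          (M ^ a * M ^ d * (M ^ (3 * d + 1)) ^ p)) * (t ^ (-ν) / t * t ^ p) := by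
        rw [mul_pow _ t, mul_pow _ (Real.exp _), mul_pow _ (M ^ _)]; ring
    _ ≤ (c * cG * (6 * 30 ^ d) ^ p * Real.exp (c₁ * M ^ β) ^ p *
          (M ^ a * M ^ d * (M ^ (3 * d + 1)) ^ p)) * t := by
        gcongr
        exact rpow_neg_div_mul_pow_le (tol_pos σ s) (tol_le_one σ s) hp

end Estimates

section Regularity

variable {Ω Θ : Type*} [MetricSpace Ω]

theorem FiniteMetricDimension.secondCountableTopology (h : FiniteMetricDimension Ω) :
    SecondCountableTopology Ω := by
  obtain ⟨ν, _, C, _, hnet⟩ := h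
  have htb : TotallyBounded (Set.univ : Set Ω) := Metric.totallyBounded_iff.2 fun ε hε => by
    obtain ⟨N, -, hN⟩ := hnet (min (ε / 2) 1) (lt_min (by linarith) one_pos) (min_le_right _ _)
    refine ⟨N, N.finite_toSet, fun ω _ => ?_⟩
    obtain ⟨ω', hω', hd⟩ := hN ω
    exact Set.mem_biUnion hω' ((hd.trans (min_le_left _ _)).trans_lt (half_lt_self hε))
  have : TopologicalSpace.SeparableSpace Ω :=
    TopologicalSpace.isSeparable_univ_iff.1 htb.isSeparable
  exact UniformSpace.secondCountable_of_separable Ω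

/-- The parameters for which the process is bounded and `κ`-Hölder continuous, both with
constant `K`. -/
def boundedSet (v : Ω → Θ → ℝ) (κ : ℝ≥0) (K : ℕ) : Set Θ :=
  {θ | (∀ ω, |v ω θ| ≤ K) ∧ ∀ ω ω', |v ω θ - v ω' θ| ≤ K * dist ω ω' ^ (κ : ℝ)}

theorem boundedSet_mono (v : Ω → Θ → ℝ) (κ : ℝ≥0) : Monotone (boundedSet v κ) := by
  intro K K' hK θ h
  have hcast : (K : ℝ) ≤ K' := by exact_mod_cast hK
  refine ⟨fun ω => (h.1 ω).trans hcast, fun ω ω' => (h.2 ω ω').trans ?_⟩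
  gcongr

variable [MeasurableSpace Θ] {v : Ω → Θ → ℝ} {κ : ℝ≥0}

theorem IsHolderProcess.abs_sub_le (hv : IsHolderProcess v κ) (θ : Θ) :
    ∃ K : ℝ≥0, ∀ ω ω', |v ω θ - v ω' θ| ≤ K * dist ω ω' ^ (κ : ℝ) := by
  obtain ⟨K, hK⟩ := hv.2 θ
  exact ⟨K, fun ω ω' => by rw [← Real.dist_eq]; exact hK.dist_le ω ω'⟩

theorem IsHolderProcess.continuous (hκ : 0 < κ) (hv : IsHolderProcess v κ) (θ : Θ) :
    Continuous fun ω => v ω θ :=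
  let ⟨_, hK⟩ := hv.2 θ
  hK.continuous hκ

theorem mem_boundedSet_of_dense (hκ : 0 < κ) (hv : IsHolderProcess v κ) {S : Set Ω} (hS : Dense S)
    {K : ℕ} {θ : Θ} (hbound : ∀ ω ∈ S, |v ω θ| ≤ K)
    (hholder : ∀ ω ∈ S, ∀ ω' ∈ S, |v ω θ - v ω' θ| ≤ K * dist ω ω' ^ (κ : ℝ)) :
    θ ∈ boundedSet v κ K := by
  have hcont := hv.continuous hκ θ
  refine ⟨fun ω => ?_, fun ω ω' => ?_⟩
  · have hclosed : IsClosed {ω | |v ω θ| ≤ K} := isClosed_le hcont.abs continuous_const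
    exact closure_minimal hbound hclosed (hS ω)
  · have hclosed : IsClosed {q : Ω × Ω | |v q.1 θ - v q.2 θ| ≤ K * dist q.1 q.2 ^ (κ : ℝ)} :=
      isClosed_le ((hcont.comp continuous_fst).sub (hcont.comp continuous_snd)).abs
        (continuous_const.mul (continuous_dist.rpow_const fun _ => Or.inr κ.2))
    exact closure_minimal (s := S ×ˢ S) (fun q hq => hholder _ hq.1 _ hq.2) hclosed
      ((hS.prod hS) (ω, ω'))

theorem measurableSet_boundedSet [SecondCountableTopology Ω] (hκ : 0 < κ)
    (hv : IsHolderProcess v κ) (K : ℕ) : MeasurableSet (boundedSet v κ K) := by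
  obtain ⟨S, hcount, hdense⟩ := TopologicalSpace.exists_countable_dense Ω
  have hset : boundedSet v κ K = {θ | ∀ ω ∈ S, |v ω θ| ≤ K} ∩
      {θ | ∀ ω ∈ S, ∀ ω' ∈ S, |v ω θ - v ω' θ| ≤ K * dist ω ω' ^ (κ : ℝ)} :=
    Set.ext fun θ => ⟨fun h => ⟨fun ω _ => h.1 ω, fun ω _ ω' _ => h.2 ω ω'⟩,
      fun h => mem_boundedSet_of_dense hκ hv hdense h.1 h.2⟩
  rw [hset]
  simp only [Set.ofPred_forall]
  refine (MeasurableSet.biInter hcount fun ω _ => ?_).inter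
    (MeasurableSet.biInter hcount fun ω _ => MeasurableSet.biInter hcount fun ω' _ => ?_)
  · exact measurableSet_le (hv.1 ω).abs measurable_const
  · exact measurableSet_le ((hv.1 ω).sub (hv.1 ω')).abs measurable_const

theorem iUnion_boundedSet (hΩ : FiniteMetricDimension Ω) (hv : IsHolderProcess v κ) :
    ⋃ K, boundedSet v κ K = Set.univ := by
  refine Set.eq_univ_of_forall fun θ => ?_
  obtain ⟨K, hK⟩ := hv.abs_sub_le θ
  obtain ⟨ν, _, C, _, hnet⟩ := hΩ
  obtain ⟨N, -, hN⟩ := hnet 1 one_pos le_rfl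
  obtain ⟨n, hn⟩ := exists_nat_ge ((∑ ω ∈ N, |v ω θ|) + K)
  have hsum : 0 ≤ ∑ ω ∈ N, |v ω θ| := Finset.sum_nonneg fun _ _ => abs_nonneg _
  refine Set.mem_iUnion.2 ⟨n, fun ω => ?_, fun ω ω' => (hK ω ω').trans ?_⟩
  · obtain ⟨ω', hω', hd⟩ := hN ω
    have hdiff : |v ω θ - v ω' θ| ≤ K :=
      (hK ω ω').trans (mul_le_of_le_one_right K.2 (Real.rpow_le_one dist_nonneg hd κ.2))
    have hnode : |v ω' θ| ≤ ∑ ω ∈ N, |v ω θ| :=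
      Finset.single_le_sum (f := fun ω => |v ω θ|) (fun _ _ => abs_nonneg _) hω'
    linarith [abs_sub_abs_le_abs_sub (v ω θ) (v ω' θ)]
  · gcongr
    linarith

theorem exists_measure_compl_boundedSet_le [SecondCountableTopology Ω]
    (hΩ : FiniteMetricDimension Ω) {P : Measure Θ} [IsFiniteMeasure P] (hκ : 0 < κ)
    (hv : IsHolderProcess v κ) {ε : ℝ≥0∞} (hε : 0 < ε) : ∃ K, P (boundedSet v κ K)ᶜ ≤ ε := by
  have hanti : Antitone fun K => (boundedSet v κ K)ᶜ := fun K K' h =>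
    Set.compl_subset_compl.2 (boundedSet_mono v κ h)
  have hlim := tendsto_measure_iInter_atTop (μ := P)
    (fun K => (measurableSet_boundedSet hκ hv K).compl.nullMeasurableSet) hanti
    ⟨0, measure_ne_top _ _⟩
  rw [← Set.compl_iUnion, iUnion_boundedSet hΩ hv, Set.compl_univ, measure_empty] at hlim
  exact (hlim.eventually (gt_mem_nhds hε)).exists.imp fun _ => le_of_lt

end Regularity

section Translation

variable {d : ℕ} {γ E : ℝ} {V : (Fin d → ℤ) → ℝ}

theorem realSchrodinger_translate (γ : ℝ) (V f : (Fin d → ℤ) → ℝ) (y x : Fin d → ℤ) :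
    realSchrodinger γ (fun z => V (z + y)) (fun z => f (z + y)) x =
      realSchrodinger γ V f (x + y) := by
  simp only [realSchrodinger, neighborSum, add_right_comm, sub_add_eq_add_sub]

theorem IsResonant.translate {u : Fin d → ℤ} {r : ℕ} {δ : ℝ} (y : Fin d → ℤ)
    (h : IsResonant γ V (latticeBall (u + y) r) E δ) :
    IsResonant γ (fun z => V (z + y)) (latticeBall u r) E δ := by
  obtain ⟨f, hf⟩ := h
  have hmem : ∀ z, z + y ∈ latticeBall (u + y) r ↔ z ∈ latticeBall u r := fun z => by
    rw [mem_latticeBall, mem_latticeBall, add_sub_add_right_eq_sub]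
  have hsum : ∀ g : (Fin d → ℤ) → ℝ, ∑ z ∈ latticeBall u r, g (z + y) =
      ∑ z ∈ latticeBall (u + y) r, g z := fun g =>
    Finset.sum_equiv (Equiv.addRight y) (fun z => (hmem z).symm) fun _ _ => rfl
  refine ⟨fun z => f (z + y), fun z hz => hf.eq_zero_of_notMem _ (mt (hmem z).1 hz), ?_, ?_⟩
  · rw [hsum fun z => f z ^ 2, hf.sum_sq]
  · simp only [realSchrodinger_translate]
    rw [hsum fun z => (realSchrodinger γ V f z - E * f z) ^ 2]
    exact hf.sum_sq_sub_le

theorem SeparatedResonances.translate {J s p : ℕ} {σ : ℝ} {y : Fin d → ℤ}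
    (h : SeparatedResonances γ V J σ s p E y) :
    SeparatedResonances γ (fun z => V (z + y)) J σ s p E 0 := by
  obtain ⟨u, hu, hsep⟩ := h
  refine ⟨fun i => u i - y, fun i => ⟨?_, ?_⟩, fun i j hij => ?_⟩
  · rw [mem_latticeBall, sub_zero]
    exact mem_latticeBall.1 (hu i).1
  · obtain ⟨r, hr, hres⟩ := (hu i).2
    exact ⟨r, hr, IsResonant.translate y (by rwa [sub_add_cancel])⟩
  · simpa only [sub_sub_sub_cancel_right] using hsep hij

end Translation

section OrbitPotential

variable {d : ℕ} {Ω Θ : Type*} [AddAction (Fin d → ℤ) Ω] {v : Ω → Θ → ℝ}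

/-- The potential `x ↦ v (T^x ω, θ)` along the orbit of `ω`. -/
abbrev orbitPotential (v : Ω → Θ → ℝ) (ω : Ω) (θ : Θ) : (Fin d → ℤ) → ℝ := fun x => v (x +ᵥ ω) θ

variable (d) in
/-- The parameters for which the orbit of some point of the net `N` has more than `J` well
separated resonances of scale `s` at some energy of the grid. -/
def netEvent (v : Ω → Θ → ℝ) (γ : ℝ) (J : ℕ) (σ K : ℝ) (s : ℕ) (N : Finset Ω) : Set Θ :=
  ⋃ ω ∈ N, {θ | orbitPotential v ω θ ∈ (gridEvent γ J σ K s (J + 1) : Set ((Fin d → ℤ) → ℝ))}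

theorem measurableSet_netEvent [MeasurableSpace Θ] (hv : ∀ ω, Measurable (v ω)) (γ : ℝ)
    (J : ℕ) (σ K : ℝ) (s : ℕ) (N : Finset Ω) : MeasurableSet (netEvent d v γ J σ K s N) :=
  Finset.measurableSet_biUnion _ fun ω _ =>
    measurable_pi_lambda (orbitPotential v ω) (fun _ => hv _) (measurableSet_gridEvent _ _ _ _ _ _)

variable [MeasurableSpace Θ] {P : Measure Θ} [IsProbabilityMeasure P]

theorem measure_netEvent_le {K J s : ℕ} {N : Finset Ω} {σ D a : ℝ} (γ : ℝ)
    (hlarge : LargeScale d J σ s)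
    (hD : 0 ≤ D) (hcond : ∀ ω, CondDensityBound P (orbitPotential v ω)
      (latticeBall (0 : Fin d → ℤ) (2 * window s)) D) (hN : N.card ≤ a) :
    P (netEvent d v γ J σ K s N) ≤ ENNReal.ofReal (a * gridBound d K σ D s (J + 1)) :=
  measure_mem_biUnion_le (X := id) hN fun ω _ =>
    measure_gridEvent_le hD hlarge.resRadius_lt_window (hcond ω) γ (J + 1) K.cast_nonneg

theorem eventually_measure_resonances_le {β σ ν c a C₁ : ℝ} (hβ : 0 < β) (hβσ : β < σ) (hσ : σ < 1)
    (hc : 0 ≤ c) (K : ℕ) {N : ℕ → Finset Ω}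
    (hN : ∀ s, ((N s).card : ℝ) ≤ c * (window s : ℝ) ^ a * tol σ s ^ (-ν))
    (hcond : ∀ (ω : Ω) s, CondDensityBound P (orbitPotential v ω)
      (latticeBall (0 : Fin d → ℤ) (2 * window s)) (Real.exp (C₁ * (window s : ℝ) ^ β))) :
    ∀ᶠ s in atTop, LargeScale d (⌈ν⌉₊ + 1) σ s ∧ ∀ γ,
      P (netEvent d v γ (⌈ν⌉₊ + 1) σ K s (N s)) ≤ ENNReal.ofReal ((1 / 2) ^ s) ∧
      ∀ ω, P {θ | orbitPotential v ω θ ∈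
        (gridEvent γ (⌈ν⌉₊ + 1) σ K s 2 : Set ((Fin d → ℤ) → ℝ))} ≤
          ENNReal.ofReal ((1 / 2) ^ s) := by
  have hJν : 2 + ν ≤ (⌈ν⌉₊ + 1 + 1 : ℕ) := by push_cast; linarith [Nat.le_ceil ν]
  filter_upwards [eventually_largeScale d (⌈ν⌉₊ + 1) (hβ.trans hβσ) hσ,
    eventually_gridBound_le d (⌈ν⌉₊ + 1 + 1) hβ hβσ hJν C₁ a hc K.cast_nonneg,
    eventually_gridBound_le d 2 hβ hβσ (ν := 0) (by norm_num) C₁ 0 zero_le_one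
      K.cast_nonneg] with s hlarge hnet hpair
  refine ⟨hlarge, fun γ => ⟨?_, fun ω => ?_⟩⟩
  · exact (measure_netEvent_le γ hlarge (Real.exp_pos _).le (fun ω => hcond ω s) (hN s)).trans
      (ENNReal.ofReal_le_ofReal hnet)
  · exact (measure_gridEvent_le (Real.exp_pos _).le hlarge.resRadius_lt_window (hcond ω s) γ 2
      K.cast_nonneg).trans (ENNReal.ofReal_le_ofReal (by simpa using hpair))

end OrbitPotential

section Nets

variable {d : ℕ} {Ω Θ : Type*} [MetricSpace Ω]

theorem abs_sub_le_of_dist_le_rpow {v : Ω → Θ → ℝ} {κ : ℝ≥0} {K : ℕ} {θ : Θ} {ω ω' : Ω} {t : ℝ}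
    (hκ : 0 < κ) (hθ : θ ∈ boundedSet v κ K) (ht : 0 ≤ t)
    (h : dist ω ω' ≤ (t / (K + 1)) ^ (κ : ℝ)⁻¹) : |v ω θ - v ω' θ| ≤ t := by
  have hκ0 : (κ : ℝ) ≠ 0 := by exact_mod_cast hκ.ne'
  calc |v ω θ - v ω' θ| ≤ K * dist ω ω' ^ (κ : ℝ) := hθ.2 ω ω'
    _ ≤ K * ((t / (K + 1)) ^ (κ : ℝ)⁻¹) ^ (κ : ℝ) := by gcongr
    _ = K / (K + 1) * t := by
        rw [← Real.rpow_mul (by positivity), inv_mul_cancel₀ hκ0, Real.rpow_one]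
        ring
    _ ≤ t := mul_le_of_le_one_left ht (div_le_one_of_le₀ (by linarith) (by positivity))

variable [AddAction (Fin d → ℤ) Ω]

theorem dist_vadd_le_of_dist_le_div {C b M : ℝ} {q : ℕ} {ω ω' : Ω} {y : Fin d → ℤ} (hC : 1 ≤ C)
    (hT : dist (y +ᵥ ω) (y +ᵥ ω') ≤ C * (1 + (latticeNorm y : ℝ)) ^ q * dist ω ω') (hM : 1 ≤ M)
    (hy : latticeNorm y ≤ 2 * M) (h : dist ω ω' ≤ b / (C * (3 * M) ^ q)) :
    dist (y +ᵥ ω) (y +ᵥ ω') ≤ b :=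
  have hden : 0 < C * (3 * M) ^ q := mul_pos (by linarith) (pow_pos (by linarith) q)
  calc dist (y +ᵥ ω) (y +ᵥ ω') ≤ C * (1 + (latticeNorm y : ℝ)) ^ q * dist ω ω' := hT
    _ ≤ C * (3 * M) ^ q * (b / (C * (3 * M) ^ q)) := by gcongr; linarith
    _ = b := mul_div_cancel₀ b hden.ne'

theorem div_netRadius_rpow {C C' K M t ν α : ℝ} {q : ℕ} (hC : 0 ≤ C) (hC' : 0 < C') (hK : 0 ≤ K)
    (hM : 0 < M) (ht : 0 < t) :
    (C / ((t / (K + 1)) ^ α / (C' * (3 * M) ^ q))) ^ ν =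
      (C * C' * 3 ^ q * (K + 1) ^ α) ^ ν * M ^ (q * ν) * t ^ (-(α * ν)) := by
  have htα : t ^ α ≠ 0 := (Real.rpow_pos_of_pos ht α).ne'
  have hbase : C / ((t / (K + 1)) ^ α / (C' * (3 * M) ^ q)) =
      C * C' * 3 ^ q * (K + 1) ^ α * M ^ q * t ^ (-α) := by
    rw [Real.div_rpow ht.le (by linarith), Real.rpow_neg ht.le, mul_pow]
    field_simp [htα]
  rw [hbase, Real.mul_rpow (by positivity) (by positivity),
    Real.mul_rpow (by positivity) (by positivity), ← Real.rpow_natCast M q,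
    ← Real.rpow_mul hM.le, ← Real.rpow_mul ht.le, neg_mul]

theorem exists_orbitPotential_net {v : Ω → Θ → ℝ} {κ : ℝ≥0} (hκ : 0 < κ)
    (hΩ : FiniteMetricDimension Ω) (hT : TemperedAction d Ω) (σ : ℝ) (K : ℕ) :
    ∃ c a ν : ℝ, 0 ≤ c ∧ ∀ s, ∃ N : Finset Ω,
      (N.card : ℝ) ≤ c * (window s : ℝ) ^ a * tol σ s ^ (-ν) ∧
      ∀ ω, ∃ ω' ∈ N, ∀ θ ∈ boundedSet v κ K, ∀ y ∈ latticeBall (0 : Fin d → ℤ) (2 * window s),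
        |orbitPotential v ω θ y - orbitPotential v ω' θ y| ≤ tol σ s := by
  obtain ⟨ν, -, C, hC, hnet⟩ := hΩ
  obtain ⟨CT, hCT, q, hT⟩ := hT
  refine ⟨(C * (CT + 1) * 3 ^ q * (K + 1) ^ (κ : ℝ)⁻¹) ^ ν, q * ν, (κ : ℝ)⁻¹ * ν, by positivity,
    fun s => ?_⟩
  have ht := tol_pos σ s
  have hM : (1 : ℝ) ≤ window s := by exact_mod_cast one_le_window s
  set M : ℝ := ((window s : ℕ) : ℝ)
  set b : ℝ := (tol σ s / (K + 1)) ^ (κ : ℝ)⁻¹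
  have hb : b ≤ 1 := Real.rpow_le_one (by positivity)
    (div_le_one_of_le₀ (by linarith [tol_le_one σ s, K.cast_nonneg (α := ℝ)]) (by positivity))
    (by positivity)
  have hden : 1 ≤ (CT + 1) * (3 * M) ^ q :=
    one_le_mul_of_one_le_of_one_le (by linarith) (one_le_pow₀ (by linarith))
  obtain ⟨N, hcard, hN⟩ := hnet (b / ((CT + 1) * (3 * M) ^ q)) (by positivity)
    (div_le_one_of_le₀ (hb.trans hden) (by positivity))
  refine ⟨N, hcard.trans_eq (div_netRadius_rpow hC.le (by positivity) (by positivity)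
    (by positivity) ht), fun ω => ?_⟩
  obtain ⟨ω', hω', hdist⟩ := hN ω
  refine ⟨ω', hω', fun θ hθ y hy => abs_sub_le_of_dist_le_rpow hκ hθ ht.le ?_⟩
  rw [mem_latticeBall, sub_zero] at hy
  refine dist_vadd_le_of_dist_le_div (by linarith) ((hT y ω ω').trans ?_) hM
    (by simpa only [M] using mod_cast hy) hdist
  gcongr
  linarith

end Nets

section GoodEvents

variable {d : ℕ}

/-- Solutions of the eigenvalue equation that grow slowly decay exponentially. -/
def DecayingSolutions (γ : ℝ) (V : (Fin d → ℤ) → ℝ) : Prop :=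
  ∀ (E : ℝ) (ψ : (Fin d → ℤ) → ℝ), IsSolutionOn γ V E ψ Set.univ →
    (∃ C, ∀ x, |ψ x| ≤ C * Real.exp (latticeNorm x / 4)) →
    ∃ C, ∀ x, |ψ x| ≤ C * Real.exp (-latticeNorm x)

theorem decayingSolutions_of_rare_separatedResonances {V : (Fin d → ℤ) → ℝ} {γ σ : ℝ} {J s₁ : ℕ}
    (hJ : 1 ≤ J) (hγ : 0 ≤ γ) (hγs : 2 * d * γ ≤ Real.exp (-32) * tol σ s₁)
    (hlarge : ∀ s, s₁ ≤ s → LargeScale d J σ s)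
    (hrare : ∀ E, ∀ s ≥ s₁, ∀ y, ¬ SeparatedResonances γ V J σ s (J + 1) E y)
    (htwo : ∀ E, ∀ᶠ s in atTop, ¬ SeparatedResonances γ V J σ s 2 E 0) : DecayingSolutions γ V := by
  rintro E ψ hψ ⟨C, hC⟩
  refine exists_abs_le_exp_neg (eventually_atTop.2 ⟨s₁, hlarge⟩) (eventually_atTop.2 ⟨s₁, ?_⟩)
    (htwo E) hψ hC
  exact fun s hs => contractsOffResonances_of_not_separatedResonances hJ hγ hγs hlarge (hrare E) hs

variable {Ω Θ : Type*} [MetricSpace Ω] [AddAction (Fin d → ℤ) Ω] {v : Ω → Θ → ℝ} {κ : ℝ≥0}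
  {γ σ : ℝ} {J K s : ℕ} {N : Finset Ω}

theorem SeparatedResonances.mem_netEvent (hγ : 0 ≤ γ) (hγd : 2 * d * γ ≤ 1)
    (hlarge : LargeScale d J σ s) {θ : Θ} (hθ : θ ∈ boundedSet v κ K)
    (hN : ∀ ω, ∃ ω' ∈ N, ∀ y ∈ latticeBall (0 : Fin d → ℤ) (2 * window s),
      |orbitPotential v ω θ y - orbitPotential v ω' θ y| ≤ tol σ s) {ω : Ω} {E : ℝ}
    {y : Fin d → ℤ} (h : SeparatedResonances γ (orbitPotential v ω θ) J σ s (J + 1) E y) :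
    θ ∈ netEvent d v γ J σ K s N := by
  obtain ⟨ω', hω', hclose⟩ := hN (y +ᵥ ω)
  have htranslate := h.translate
  simp only [orbitPotential, add_vadd] at htranslate
  exact Set.mem_biUnion hω' (htranslate.mem_gridEvent J.succ_ne_zero hγ hγd
    hlarge.resRadius_lt_window (fun _ => hθ.1 _) hclose)

theorem measurable_orbitPotential [MeasurableSpace Θ] [MeasurableSpace Ω] [OpensMeasurableSpace Ω]
    [SecondCountableTopology Ω] (hκ : 0 < κ) (hv : IsHolderProcess v κ) (hT : TemperedAction d Ω) :
    Measurable fun q : Θ × Ω => (orbitPotential v q.2 q.1 : (Fin d → ℤ) → ℝ) := by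
  refine measurable_pi_lambda _ fun x => ?_
  have hcont : Continuous fun ω : Ω => x +ᵥ ω := by
    obtain ⟨C, hC, q, hT⟩ := hT
    exact (LipschitzWith.of_dist_le_mul (K := ⟨C * (1 + latticeNorm x) ^ q, by positivity⟩)
      fun ω ω' => hT x ω ω').continuous
  exact (measurable_uncurry_of_continuous_of_measurable (u := fun ω θ => v (x +ᵥ ω) θ)
    (fun θ => (hv.continuous hκ θ).comp hcont) fun ω => hv.1 _).comp measurable_swap

section Tails

variable [MeasurableSpace Θ] {P : Measure Θ}

theorem measure_iUnion_add_le_ofReal {U : ℕ → Set Θ} {s₁ : ℕ}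
    (hU : ∀ s, s₁ ≤ s → P (U s) ≤ ENNReal.ofReal ((1 / 2) ^ s)) :
    P (⋃ s, U (s + s₁)) ≤ ENNReal.ofReal (2 * (1 / 2) ^ s₁) :=
  calc P (⋃ s, U (s + s₁)) ≤ ∑' s, P (U (s + s₁)) := measure_iUnion_le _
    _ ≤ ∑' s : ℕ, ENNReal.ofReal ((1 / 2) ^ s * (1 / 2) ^ s₁) :=
        ENNReal.tsum_le_tsum fun s => (hU _ (Nat.le_add_left _ _)).trans_eq (by rw [pow_add])
    _ = ENNReal.ofReal (2 * (1 / 2) ^ s₁) := by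
        rw [← ENNReal.ofReal_tsum_of_nonneg (fun s => by positivity)
          (summable_geometric_two.mul_right _), tsum_mul_right, tsum_geometric_two]

theorem ae_ae_eventually_notMem_of_section_le {Ω : Type*} [MeasurableSpace Ω] {Q : Measure Ω}
    [SFinite P] [SFinite Q] {W : ℕ → Set (Θ × Ω)} {b : ℕ → ℝ≥0∞} {s₁ : ℕ}
    (hW : ∀ s, MeasurableSet (W s)) (hb : ∑' s, b s ≠ ∞)
    (hWb : ∀ s, s₁ ≤ s → ∀ ω, P {θ | (θ, ω) ∈ W s} ≤ b s) :
    ∀ᵐ θ ∂P, ∀ᵐ ω ∂Q, ∀ᶠ s in atTop, (θ, ω) ∉ W s := by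
  rw [← ae_toFinite]
  have hprod : ∀ s, (P.prod Q.toFinite) (W (s + s₁)) ≤ b (s + s₁) * Q.toFinite Set.univ := by
    intro s
    rw [Measure.prod_apply_symm (hW _), ← lintegral_const]
    exact lintegral_mono fun ω => hWb _ (Nat.le_add_left _ _) ω
  have hsum : ∑' s, (P.prod Q.toFinite) (W (s + s₁)) ≠ ∞ := by
    refine ne_top_of_le_ne_top ?_ (ENNReal.tsum_le_tsum hprod)
    rw [ENNReal.tsum_mul_right]
    exact ENNReal.mul_ne_top (ne_top_of_le_ne_top hb
      (ENNReal.tsum_comp_le_tsum_of_injective (add_left_injective s₁) b)) (measure_ne_top _ _)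
  filter_upwards [Measure.ae_ae_of_ae_prod (ae_eventually_notMem hsum)] with θ hθ
  filter_upwards [hθ] with ω hω
  rwa [← Filter.map_add_atTop_eq_nat s₁, eventually_map]

theorem exists_measurableSet_forall_of_ae {S : Set Θ} {p : Θ → Prop} (hS : MeasurableSet S)
    (hp : ∀ᵐ θ ∂P, p θ) : ∃ G ⊆ S, MeasurableSet G ∧ P Gᶜ = P Sᶜ ∧ ∀ θ ∈ G, p θ := by
  obtain ⟨Z, hpZ, hZ, hPZ⟩ := exists_measurable_superset_of_null (ae_iff.1 hp)
  refine ⟨S \ Z, Set.sdiff_subset, hS.diff hZ, ?_, fun θ hθ => not_not.1 (mt (@hpZ θ) hθ.2)⟩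
  rw [Set.sdiff_eq, Set.compl_inter, compl_compl]
  exact measure_congr (union_ae_eq_left_of_ae_eq_empty (ae_eq_empty.2 hPZ))

theorem ae_ae_eventually_not_separatedResonances [SFinite P] [MeasurableSpace Ω]
    [OpensMeasurableSpace Ω] [SecondCountableTopology Ω] {Q : Measure Ω} [SFinite Q] (hκ : 0 < κ)
    (hv : IsHolderProcess v κ) (hT : TemperedAction d Ω) (hγ : 0 ≤ γ) (hγd : 2 * d * γ ≤ 1)
    {s₁ : ℕ} (hlarge : ∀ s, s₁ ≤ s → LargeScale d J σ s)
    (hpair : ∀ s, s₁ ≤ s → ∀ ω, P {θ | orbitPotential v ω θ ∈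
      (gridEvent γ J σ K s 2 : Set ((Fin d → ℤ) → ℝ))} ≤ ENNReal.ofReal ((1 / 2) ^ s)) :
    ∀ᵐ θ ∂P, ∀ᵐ ω ∂Q, θ ∈ boundedSet v κ K → ∀ E, ∀ᶠ s in atTop,
      ¬ SeparatedResonances γ (orbitPotential v ω θ : (Fin d → ℤ) → ℝ) J σ s 2 E 0 := by
  let W : ℕ → Set (Θ × Ω) := fun s =>
    {q | orbitPotential v q.2 q.1 ∈ (gridEvent γ J σ K s 2 : Set ((Fin d → ℤ) → ℝ))}
  have hW : ∀ s, MeasurableSet (W s) := fun s =>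
    measurable_orbitPotential hκ hv hT (measurableSet_gridEvent _ _ _ _ _ _)
  have hsum : ∑' s : ℕ, ENNReal.ofReal ((1 / 2) ^ s) ≠ ∞ := by
    rw [← ENNReal.ofReal_tsum_of_nonneg (fun s => by positivity) summable_geometric_two]
    exact ENNReal.ofReal_ne_top
  filter_upwards [ae_ae_eventually_notMem_of_section_le (Q := Q) hW hsum hpair] with θ hθ
  filter_upwards [hθ] with ω hω hbound E
  filter_upwards [hω, eventually_ge_atTop s₁] with s hs hs₁ hsep
  refine hs (hsep.mem_gridEvent two_ne_zero hγ hγd (hlarge s hs₁).resRadius_lt_window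
    (fun _ => hbound.1 _) fun y _ => ?_)
  rw [sub_self, abs_zero]
  exact (tol_pos σ s).le

theorem exists_measurableSet_decayingSolutions [SFinite P] [MeasurableSpace Ω]
    [OpensMeasurableSpace Ω] [SecondCountableTopology Ω] {Q : Measure Ω} [SFinite Q] (hκ : 0 < κ)
    (hv : IsHolderProcess v κ) (hT : TemperedAction d Ω) {s₁ : ℕ} {N : ℕ → Finset Ω} (hJ : 1 ≤ J)
    (hγ : 0 ≤ γ) (hγs : 2 * d * γ ≤ Real.exp (-32) * tol σ s₁)
    (hlarge : ∀ s, s₁ ≤ s → LargeScale d J σ s)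
    (hN : ∀ s ω, ∃ ω' ∈ N s, ∀ θ ∈ boundedSet v κ K, ∀ y ∈ latticeBall (0 : Fin d → ℤ)
      (2 * window s), |orbitPotential v ω θ y - orbitPotential v ω' θ y| ≤ tol σ s)
    (hnet : ∀ s, s₁ ≤ s → P (netEvent d v γ J σ K s (N s)) ≤ ENNReal.ofReal ((1 / 2) ^ s))
    (hpair : ∀ s, s₁ ≤ s → ∀ ω, P {θ | orbitPotential v ω θ ∈
      (gridEvent γ J σ K s 2 : Set ((Fin d → ℤ) → ℝ))} ≤ ENNReal.ofReal ((1 / 2) ^ s)) :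
    ∃ G, MeasurableSet G ∧ P Gᶜ ≤ P (boundedSet v κ K)ᶜ + ENNReal.ofReal (2 * (1 / 2) ^ s₁) ∧
      ∀ θ ∈ G, ∀ᵐ ω ∂Q, DecayingSolutions γ (orbitPotential v ω θ : (Fin d → ℤ) → ℝ) := by
  have hγd : 2 * d * γ ≤ 1 := hγs.trans <| mul_le_one₀ (Real.exp_le_one_iff.2 (by norm_num))
    (tol_pos _ _).le (tol_le_one _ _)
  obtain ⟨G, hGS, hG, hPG, hae⟩ := exists_measurableSet_forall_of_ae
    ((measurableSet_boundedSet hκ hv K).diff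
      (.iUnion fun s => measurableSet_netEvent (d := d) hv.1 γ J σ K (s + s₁) (N (s + s₁))))
    (ae_ae_eventually_not_separatedResonances (Q := Q) hκ hv hT hγ hγd hlarge hpair)
  refine ⟨G, hG, ?_, fun θ hθ => ?_⟩
  · rw [hPG, Set.sdiff_eq, Set.compl_inter, compl_compl]
    exact (measure_union_le _ _).trans (by gcongr; exact measure_iUnion_add_le_ofReal hnet)
  · obtain ⟨hbound, hθnet⟩ := hGS hθ
    filter_upwards [hae θ hθ] with ω hω
    refine decayingSolutions_of_rare_separatedResonances hJ hγ hγs hlarge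
      (fun E s hs y hsep => hθnet ?_) (hω hbound)
    refine Set.mem_iUnion.2 ⟨s - s₁, ?_⟩
    rw [Nat.sub_add_cancel hs]
    exact hsep.mem_netEvent hγ hγd (hlarge s hs) hbound fun ω =>
      (hN s ω).imp fun ω' h => ⟨h.1, h.2 θ hbound⟩

theorem eventually_exists_decayingSolutions [IsProbabilityMeasure P] [MeasurableSpace Ω]
    [OpensMeasurableSpace Ω] (Q : Measure Ω) [SFinite Q] {A η : ℝ} (hκ : 0 < κ)
    (hΩ : FiniteMetricDimension Ω) (hT : TemperedAction d Ω) (hv : IsHolderProcess v κ)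
    (hUPA : UPA d Ω A) (hLIB : LIB P v η) (hAη : A * η < 1) {ε : ℝ≥0∞} (hε : 0 < ε) :
    ∀ᶠ g : ℝ in atTop, ∃ G, MeasurableSet G ∧ P Gᶜ ≤ ε ∧
      ∀ θ ∈ G, ∀ᵐ ω ∂Q, DecayingSolutions g⁻¹ (orbitPotential v ω θ : (Fin d → ℤ) → ℝ) := by
  have := hΩ.secondCountableTopology
  obtain ⟨β, hβ, hβ1, C₁, hcond⟩ := exists_condDensityBound hv.1 hUPA hLIB hAη
  obtain ⟨σ, hβσ, hσ1⟩ := exists_between hβ1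
  obtain ⟨K, hK⟩ := exists_measure_compl_boundedSet_le hΩ (P := P) hκ hv (ENNReal.half_pos hε.ne')
  obtain ⟨c, a, ν, hc, hnet⟩ := exists_orbitPotential_net (v := v) hκ hΩ hT σ K
  choose N hNcard hN using hnet
  have htail : Tendsto (fun s : ℕ => ENNReal.ofReal (2 * (1 / 2) ^ s)) atTop (𝓝 0) := by
    simpa using ENNReal.tendsto_ofReal ((tendsto_pow_atTop_nhds_zero_of_lt_one
      (r := (1 / 2 : ℝ)) (by norm_num) (by norm_num)).const_mul 2)
  obtain ⟨s₀, hs₀⟩ := eventually_atTop.1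
    (eventually_measure_resonances_le hβ hβσ hσ1 hc K hNcard hcond)
  obtain ⟨s₁, hs₁, hs₁ε⟩ := ((eventually_ge_atTop s₀).and
    (htail.eventually_le_const (ENNReal.half_pos hε.ne'))).exists
  have hres := fun s hs => hs₀ s (hs₁.trans hs)
  have hsmall : ∀ᶠ g : ℝ in atTop, 2 * d * g⁻¹ ≤ Real.exp (-32) * tol σ s₁ := by
    refine (tendsto_inv_atTop_zero.const_mul (2 * d : ℝ)).eventually_le_const ?_
    rw [mul_zero]
    exact mul_pos (Real.exp_pos _) (tol_pos _ _)
  filter_upwards [hsmall, eventually_ge_atTop 0] with g hgs hg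
  obtain ⟨G, hG, hPG, hdec⟩ := exists_measurableSet_decayingSolutions (Q := Q) hκ hv hT
    (Nat.le_add_left 1 _) (inv_nonneg.2 hg) hgs (fun s hs => (hres s hs).1) hN
    (fun s hs => ((hres s hs).2 g⁻¹).1) fun s hs => ((hres s hs).2 g⁻¹).2
  exact ⟨G, hG, hPG.trans ((add_le_add hK hs₁ε).trans_eq (ENNReal.add_halves ε)), hdec⟩

end Tails

end GoodEvents

section SpectralMeasure

open scoped InnerProductSpace CompactlySupported

variable {K : Type*} [NormedAddCommGroup K] [InnerProductSpace ℂ K] [CompleteSpace K]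
  {A : K →L[ℂ] K}

theorem inner_cfcHom_mul (hA : IsSelfAdjoint A) (f h : C(spectrum ℝ A, ℝ)) (φ : K) :
    ⟪φ, cfcHom hA (f * h) φ⟫_ℂ = ⟪cfcHom hA f φ, cfcHom hA h φ⟫_ℂ := by
  have hf : IsSelfAdjoint (cfcHom hA f) := by
    rw [isSelfAdjoint_iff, ← map_star, star_trivial]
  rw [map_mul, mul_apply_eq_comp]
  exact (hf.isSymmetric φ _).symm

/-- The functional `f ↦ ⟪φ, f(A) φ⟫`, whose representing measure is the spectral measure of `φ`. -/
noncomputable def spectralFunctional (hA : IsSelfAdjoint A) (φ : K) :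
    C_c(spectrum ℝ A, ℝ) →ₚ[ℝ] ℝ :=
  PositiveLinearMap.mk₀
    { toFun := fun f => (⟪φ, cfcHom hA (f : C(spectrum ℝ A, ℝ)) φ⟫_ℂ).re
      map_add' := fun f h => by
        change (⟪φ, cfcHom hA ((f : C(spectrum ℝ A, ℝ)) + (h : C(spectrum ℝ A, ℝ))) φ⟫_ℂ).re = _
        rw [map_add, add_apply, inner_add_right, Complex.add_re]
      map_smul' := fun c f => by
        change (⟪φ, cfcHom hA (c • (f : C(spectrum ℝ A, ℝ))) φ⟫_ℂ).re = _
        rw [map_smul, smul_apply, inner_smul_right_eq_smul]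
        simp }
    fun f hf => by
      let h : C(spectrum ℝ A, ℝ) := ⟨fun E => √(f E), f.continuous.sqrt⟩
      have hh : (f : C(spectrum ℝ A, ℝ)) = h * h := by
        ext E
        exact (Real.mul_self_sqrt (hf E)).symm
      change 0 ≤ (⟪φ, cfcHom hA (f : C(spectrum ℝ A, ℝ)) φ⟫_ℂ).re
      rw [hh, inner_cfcHom_mul]
      exact inner_self_nonneg (𝕜 := ℂ)

/-- The spectral measure of the vector `φ` with respect to the self-adjoint operator `A`. -/
noncomputable def spectralMeasure (hA : IsSelfAdjoint A) (φ : K) : Measure (spectrum ℝ A) :=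
  RealRMK.rieszMeasure (spectralFunctional hA φ)

instance isFiniteMeasure_spectralMeasure (hA : IsSelfAdjoint A) (φ : K) :
    IsFiniteMeasure (spectralMeasure hA φ) := by
  unfold spectralMeasure
  exact ⟨isCompact_univ.measure_lt_top⟩

theorem integral_spectralMeasure (hA : IsSelfAdjoint A) (φ : K) (f : C(spectrum ℝ A, ℝ)) :
    ∫ E, f E ∂spectralMeasure hA φ = (⟪φ, cfcHom hA f φ⟫_ℂ).re :=
  RealRMK.integral_rieszMeasure (spectralFunctional hA φ)
    ⟨f, HasCompactSupport.of_compactSpace f⟩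

theorem norm_toLp_spectralMeasure (hA : IsSelfAdjoint A) (φ : K) (f : C(spectrum ℝ A, ℝ)) :
    ‖ContinuousMap.toLp 2 (spectralMeasure hA φ) ℝ f‖ = ‖cfcHom hA f φ‖ := by
  rw [← sq_eq_sq₀ (norm_nonneg _) (norm_nonneg _), ← real_inner_self_eq_norm_sq,
    ContinuousMap.inner_toLp, ← inner_self_eq_norm_sq (𝕜 := ℂ), ← inner_cfcHom_mul]
  exact integral_spectralMeasure hA φ (f * f)

attribute [local instance] InnerProductSpace.complexToReal

theorem denseRange_toLp_spectralMeasure (hA : IsSelfAdjoint A) (φ : K) :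
    DenseRange (ContinuousMap.toLp 2 (spectralMeasure hA φ) ℝ (E := ℝ)) :=
  ContinuousMap.toLp_denseRange ℝ (spectralMeasure hA φ) ℝ (by simp)

/-- The isometry `f ↦ f(A) φ` from `L²` of the spectral measure of `φ` onto the real cyclic
subspace of `φ`, obtained from the continuous functional calculus by density. -/
noncomputable def cyclicMap (hA : IsSelfAdjoint A) (φ : K) :
    Lp ℝ 2 (spectralMeasure hA φ) →L[ℝ] K :=
  LinearMap.extendOfNorm
    { toFun := fun f => cfcHom hA f φ
      map_add' := fun f h => by rw [map_add, add_apply]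
      map_smul' := fun c f => by rw [map_smul, smul_apply, RingHom.id_apply] }
    (ContinuousMap.toLp 2 (spectralMeasure hA φ) ℝ).toLinearMap

theorem cyclicMap_toLp (hA : IsSelfAdjoint A) (φ : K) (f : C(spectrum ℝ A, ℝ)) :
    cyclicMap hA φ (ContinuousMap.toLp 2 (spectralMeasure hA φ) ℝ f) = cfcHom hA f φ :=
  LinearMap.extendOfNorm_eq (denseRange_toLp_spectralMeasure hA φ)
    ⟨1, fun h => ((norm_toLp_spectralMeasure hA φ h).symm.trans (one_mul _).symm).le⟩ f

theorem norm_cyclicMap_le (hA : IsSelfAdjoint A) (φ : K) : ‖cyclicMap hA φ‖ ≤ 1 :=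
  LinearMap.opNorm_extendOfNorm_le (denseRange_toLp_spectralMeasure hA φ) zero_le_one
    fun h => ((norm_toLp_spectralMeasure hA φ h).symm.trans (one_mul _).symm).le

/-- The spectral representation of vectors relative to `φ`: the adjoint of `f ↦ f(A) φ`. It turns
`A` into multiplication by the spectral parameter. -/
noncomputable def spectralTransform (hA : IsSelfAdjoint A) (φ : K) :
    K →L[ℝ] Lp ℝ 2 (spectralMeasure hA φ) :=
  (cyclicMap hA φ).adjoint

theorem inner_spectralTransform (hA : IsSelfAdjoint A) (φ χ : K)
    (f : Lp ℝ 2 (spectralMeasure hA φ)) :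
    ⟪spectralTransform hA φ χ, f⟫_ℝ = (⟪χ, cyclicMap hA φ f⟫_ℂ).re :=
  ContinuousLinearMap.adjoint_inner_left _ _ _

theorem norm_spectralTransform_le (hA : IsSelfAdjoint A) (φ χ : K) :
    ‖spectralTransform hA φ χ‖ ≤ ‖χ‖ := by
  refine ((spectralTransform hA φ).le_opNorm χ).trans (mul_le_of_le_one_left (norm_nonneg _) ?_)
  rw [spectralTransform, LinearIsometryEquiv.norm_map]
  exact norm_cyclicMap_le hA φ

theorem spectralTransform_eq_of_inner_toLp (hA : IsSelfAdjoint A) {φ χ : K}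
    {w : Lp ℝ 2 (spectralMeasure hA φ)}
    (h : ∀ f : C(spectrum ℝ A, ℝ), (⟪χ, cfcHom hA f φ⟫_ℂ).re =
      ⟪w, ContinuousMap.toLp 2 (spectralMeasure hA φ) ℝ f⟫_ℝ) :
    spectralTransform hA φ χ = w := by
  refine ext_inner_right ℝ fun z => ?_
  refine (denseRange_toLp_spectralMeasure hA φ).induction_on z
    (isClosed_eq (by fun_prop) (by fun_prop)) fun f => ?_
  rw [inner_spectralTransform, cyclicMap_toLp, h]

theorem spectralTransform_self (hA : IsSelfAdjoint A) (φ : K) :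
    spectralTransform hA φ φ = ContinuousMap.toLp 2 (spectralMeasure hA φ) ℝ 1 :=
  spectralTransform_eq_of_inner_toLp hA fun f => by
    rw [ContinuousMap.inner_toLp, ← integral_spectralMeasure]
    simp

theorem spectralTransform_self_ae (hA : IsSelfAdjoint A) (φ : K) :
    spectralTransform hA φ φ =ᵐ[spectralMeasure hA φ] 1 := by
  rw [spectralTransform_self]
  exact ContinuousMap.coeFn_toLp _ _

theorem re_inner_eq_integral_spectralTransform (hA : IsSelfAdjoint A) (φ χ : K) :
    (⟪χ, φ⟫_ℂ).re = ∫ E, spectralTransform hA φ χ E ∂spectralMeasure hA φ := by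
  have hφ : cyclicMap hA φ (spectralTransform hA φ φ) = φ := by
    rw [spectralTransform_self, cyclicMap_toLp, map_one, one_apply_eq_self]
  conv_lhs => rw [← hφ]
  rw [← inner_spectralTransform, L2.inner_def]
  refine integral_congr_ae ?_
  filter_upwards [spectralTransform_self_ae hA φ] with E hE
  rw [hE]
  simp

theorem spectralTransform_apply_ae (hA : IsSelfAdjoint A) (φ χ : K) :
    ∀ᵐ E ∂spectralMeasure hA φ,
      spectralTransform hA φ (A χ) E = E * spectralTransform hA φ χ E := by
  set w := spectralTransform hA φ χ
  have hmem : MemLp (fun E : spectrum ℝ A => (E : ℝ) * w E) 2 (spectralMeasure hA φ) :=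
    (Lp.memLp w).of_le_mul (c := ‖A‖ * ‖(1 : K →L[ℂ] K)‖)
      (continuous_subtype_val.aestronglyMeasurable.mul (Lp.memLp w).1) <| ae_of_all _ fun E => by
        rw [norm_mul]
        gcongr
        exact spectrum.norm_le_norm_mul_of_mem E.2
  have hAχ : spectralTransform hA φ (A χ) = hmem.toLp _ := by
    refine spectralTransform_eq_of_inner_toLp hA fun f => ?_
    have hmul : A (cfcHom hA f φ) = cfcHom hA ((ContinuousMap.id ℝ).restrict _ * f) φ := by
      rw [map_mul, cfcHom_id, mul_apply_eq_comp]
    rw [hA.isSymmetric.apply_clm, hmul, ← cyclicMap_toLp, ← inner_spectralTransform,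
      L2.inner_def, L2.inner_def]
    refine integral_congr_ae ?_
    filter_upwards [hmem.coeFn_toLp, ContinuousMap.coeFn_toLp (p := 2) (𝕜 := ℝ) _ f,
      ContinuousMap.coeFn_toLp (p := 2) (𝕜 := ℝ) (spectralMeasure hA φ)
        ((ContinuousMap.id ℝ).restrict (spectrum ℝ A) * f)] with E hw hf hidf
    simp only [hw, hf, hidf]
    simp only [ContinuousMap.mul_apply, ContinuousMap.restrict_apply, ContinuousMap.id_apply,
      RCLike.inner_apply, Real.ringHom_apply, w]
    ring
  rw [hAχ]
  exact hmem.coeFn_toLp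

theorem apply_cyclicMap_indicatorConstLp (hA : IsSelfAdjoint A) (φ : K) (E : spectrum ℝ A) :
    A (cyclicMap hA φ (indicatorConstLp 2 (measurableSet_singleton E) (measure_ne_top _ _) 1)) =
      ((E : ℝ) : ℂ) •
        cyclicMap hA φ (indicatorConstLp 2 (measurableSet_singleton E) (measure_ne_top _ _) 1) := by
  refine ext_inner_left ℝ fun χ => ?_
  have hinner (χ' : K) : ⟪χ', cyclicMap hA φ (indicatorConstLp 2 (measurableSet_singleton E)
      (measure_ne_top _ _) 1)⟫_ℝ =
        ∫ E' in {E}, spectralTransform hA φ χ' E' ∂spectralMeasure hA φ := by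
    rw [← L2.inner_indicatorConstLp_one (measurableSet_singleton E) (measure_ne_top _ _),
      real_inner_comm (spectralTransform hA φ χ'), inner_spectralTransform]
    rfl
  calc
    _ = ∫ E' in {E}, spectralTransform hA φ (A χ) E' ∂spectralMeasure hA φ := by
      rw [← hinner]
      exact congrArg Complex.re (hA.isSymmetric χ _).symm
    _ = ∫ E' in {E}, E * spectralTransform hA φ χ E' ∂spectralMeasure hA φ := by
      refine setIntegral_congr_ae (measurableSet_singleton E) ?_
      filter_upwards [spectralTransform_apply_ae hA φ χ] with E' hE' hEE'
      rw [hE', Set.mem_singleton_iff.1 hEE']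
    _ = _ := by
      rw [integral_const_mul, ← hinner, ← real_inner_smul_right]
      rfl

end SpectralMeasure

section PurePointCriterion

open scoped InnerProductSpace
open Module.End

theorem countable_of_orthonormal {𝕜 K ι α : Type*} [RCLike 𝕜] [NormedAddCommGroup K]
    [InnerProductSpace 𝕜 K] [Countable ι] {e : ι → K}
    (he : ∀ ψ : K, (∀ i, ⟪ψ, e i⟫_𝕜 = 0) → ψ = 0) {ψ : α → K} (hψ : Orthonormal 𝕜 ψ) :
    Countable α := by
  rw [← Set.countable_univ_iff]
  refine (Set.countable_iUnion fun i =>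
    (hψ.inner_products_summable (e i)).countable_support).mono fun a _ => ?_
  by_contra ha
  simp only [Set.mem_iUnion, Function.mem_support, not_exists, not_not, sq_eq_zero_iff,
    norm_eq_zero] at ha
  exact hψ.ne_zero a (he _ ha)

theorem countable_hasEigenvalue {𝕜 K ι : Type*} [RCLike 𝕜] [NormedAddCommGroup K]
    [InnerProductSpace 𝕜 K] [Countable ι] {e : ι → K}
    (he : ∀ ψ : K, (∀ i, ⟪ψ, e i⟫_𝕜 = 0) → ψ = 0) {T : K →ₗ[𝕜] K} (hT : T.IsSymmetric) :
    {E | HasEigenvalue T E}.Countable := by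
  have hunit : ∀ E : {E | HasEigenvalue T E}, ∃ ψ : eigenspace T (E : 𝕜), ‖ψ‖ = 1 := by
    rintro ⟨E, hE⟩
    obtain ⟨ψ, hψ, hψ0⟩ := hE.exists_hasEigenvector
    exact ⟨((‖ψ‖ : 𝕜)⁻¹) • ⟨ψ, hψ⟩, norm_smul_inv_norm hψ0⟩
  choose ψ hψ using hunit
  have horth : Orthonormal 𝕜 fun E => (ψ E : K) :=
    ⟨hψ, fun E E' hne => hT.orthogonalFamily_eigenspaces (Subtype.coe_injective.ne hne) _ _⟩
  exact countable_of_orthonormal he horth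

variable {K : Type*} [NormedAddCommGroup K] [InnerProductSpace ℂ K] [CompleteSpace K]
  {A : K →L[ℂ] K}

theorem spectralTransform_eq_zero_of_mem_orthogonal (hA : IsSelfAdjoint A) {φ χ : K}
    (hχ : χ ∈ (⨆ E : ℂ, eigenspace (A : K →ₗ[ℂ] K) E)ᗮ) {E : spectrum ℝ A}
    (hE : spectralMeasure hA φ {E} ≠ 0) : spectralTransform hA φ χ E = 0 := by
  have hmem := Submodule.mem_iSup_of_mem ((E : ℝ) : ℂ)
    (mem_eigenspace_iff.2 (apply_cyclicMap_indicatorConstLp hA φ E))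
  have hinner := congrArg Complex.re (Submodule.inner_left_of_mem_orthogonal hmem hχ)
  rw [← inner_spectralTransform, real_inner_comm, L2.inner_indicatorConstLp_one,
    integral_singleton, smul_eq_mul, Complex.zero_re, mul_eq_zero] at hinner
  exact hinner.resolve_left ((measureReal_ne_zero_iff (measure_ne_top _ _)).2 hE)

theorem mem_topologicalClosure_iSup_eigenspace (hA : IsSelfAdjoint A)
    (hcount : {E : ℂ | HasEigenvalue (A : K →ₗ[ℂ] K) E}.Countable) {φ : K}
    (hφ : ∀ᵐ E : spectrum ℝ A ∂spectralMeasure hA φ,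
      HasEigenvalue (A : K →ₗ[ℂ] K) ((E : ℝ) : ℂ)) :
    φ ∈ (⨆ E : ℂ, eigenspace (A : K →ₗ[ℂ] K) E).topologicalClosure := by
  have hre : ∀ χ ∈ (⨆ E : ℂ, eigenspace (A : K →ₗ[ℂ] K) E)ᗮ, (⟪χ, φ⟫_ℂ).re = 0 := by
    intro χ hχ
    have hnull : spectralMeasure hA φ {E : spectrum ℝ A |
        HasEigenvalue (A : K →ₗ[ℂ] K) ((E : ℝ) : ℂ) ∧ spectralTransform hA φ χ E ≠ 0} = 0 := by
      have hinj : Function.Injective fun E : spectrum ℝ A => ((E : ℝ) : ℂ) :=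
        Complex.ofReal_injective.comp Subtype.val_injective
      rw [measure_null_iff_singleton ((hcount.preimage hinj).mono fun E hE => hE.1)]
      rintro E ⟨-, hE⟩
      by_contra hatom
      exact hE (spectralTransform_eq_zero_of_mem_orthogonal hA hχ hatom)
    rw [re_inner_eq_integral_spectralTransform hA]
    refine integral_eq_zero_of_ae ?_
    filter_upwards [hφ, measure_eq_zero_iff_ae_notMem.1 hnull] with E hE hnot
    by_contra hne
    exact hnot ⟨hE, hne⟩
  rw [← Submodule.orthogonal_orthogonal_eq_closure, Submodule.mem_orthogonal]
  refine fun χ hχ => Complex.ext (hre χ hχ) ?_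
  simpa [inner_smul_left] using hre (Complex.I • χ) (Submodule.smul_mem _ _ hχ)

end PurePointCriterion

section Operator

open scoped InnerProductSpace
open Module.End

theorem summable_prod_pi {ι α : Type*} [Fintype ι] {f : ι → α → ℝ} (hf0 : ∀ i a, 0 ≤ f i a)
    (hf : ∀ i, Summable (f i)) : Summable fun x : ι → α => ∏ i, f i (x i) := by
  classical
  refine summable_of_sum_le (c := ∏ i, ∑' a, f i a)
    (fun x => Finset.prod_nonneg fun i _ => hf0 i (x i)) fun u => ?_
  let t (i : ι) : Finset α := u.image fun x => x i
  calc ∑ x ∈ u, ∏ i, f i (x i) ≤ ∑ x ∈ Fintype.piFinset t, ∏ i, f i (x i) :=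
        Finset.sum_le_sum_of_subset_of_nonneg
          (fun x hx => Fintype.mem_piFinset.2 fun i => Finset.mem_image_of_mem _ hx)
          fun x _ _ => Finset.prod_nonneg fun i _ => hf0 i (x i)
    _ = ∏ i, ∑ a ∈ t i, f i a := (Finset.prod_univ_sum t f).symm
    _ ≤ ∏ i, ∑' a, f i a := Finset.prod_le_prod (fun i _ => Finset.sum_nonneg fun a _ => hf0 i a)
        fun i _ => (hf i).sum_le_tsum _ fun a _ => hf0 i a

variable {d : ℕ}

theorem summable_exp_neg_latticeNorm {a : ℝ} (ha : 0 < a) :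
    Summable fun x : Fin d → ℤ => Real.exp (-(a * latticeNorm x)) := by
  have hnat : Summable fun n : ℕ => Real.exp (-(a * n)) :=
    (Real.summable_exp_nat_mul_iff.2 (neg_lt_zero.2 ha)).congr fun n => by
      rw [mul_neg, mul_comm]
  have hint : Summable fun k : ℤ => Real.exp (-(a * k.natAbs)) :=
    .of_nat_of_neg (by simpa using hnat) (by simpa using hnat)
  refine (summable_prod_pi (fun _ _ => (Real.exp_pos _).le) fun _ : Fin d => hint).congr fun x => ?_
  rw [← Real.exp_sum, latticeNorm, Nat.cast_sum, Finset.mul_sum, Finset.sum_neg_distrib]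

theorem memℓp_two_iff {α : Type*} {f : α → ℂ} : Memℓp f 2 ↔ Summable fun x => ‖f x‖ ^ 2 := by
  rw [memℓp_gen_iff (by simp)]
  simp

theorem memℓp_of_abs_le_exp {ψ : (Fin d → ℤ) → ℝ} {C : ℝ}
    (hC : ∀ x, |ψ x| ≤ C * Real.exp (-latticeNorm x)) : Memℓp (fun x => (ψ x : ℂ)) 2 := by
  rw [memℓp_two_iff]
  refine Summable.of_nonneg_of_le (fun x => by positivity) (fun x => ?_)
    ((summable_exp_neg_latticeNorm (d := d) two_pos).mul_left (C ^ 2))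
  rw [Complex.norm_real, Real.norm_eq_abs]
  calc |ψ x| ^ 2 ≤ (C * Real.exp (-latticeNorm x)) ^ 2 := by gcongr; exact hC x
    _ = C ^ 2 * Real.exp (-(2 * latticeNorm x)) := by
      rw [mul_pow, ← Real.exp_nat_mul]; push_cast; rw [mul_neg]

/-- Translation of square-summable functions. -/
noncomputable def shiftLp (e : Fin d → ℤ) : EllTwo d →ₗ[ℂ] EllTwo d where
  toFun f := ⟨fun x => f (x + e), memℓp_two_iff.2 <|
    ((Equiv.addRight e).summable_iff (f := fun x => ‖f x‖ ^ 2)).2 (memℓp_two_iff.1 (lp.memℓp f))⟩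
  map_add' _ _ := rfl
  map_smul' _ _ := rfl

theorem shiftLp_apply (e : Fin d → ℤ) (f : EllTwo d) (x : Fin d → ℤ) :
    shiftLp e f x = f (x + e) := rfl

/-- Multiplication of square-summable functions by a bounded real function. -/
noncomputable def multiplicationLp {V : (Fin d → ℤ) → ℝ} {K : ℝ} (hV : ∀ x, |V x| ≤ K) :
    EllTwo d →ₗ[ℂ] EllTwo d where
  toFun f := ⟨fun x => (V x : ℂ) * f x, memℓp_two_iff.2 <| by
    refine Summable.of_nonneg_of_le (fun x => by positivity) (fun x => ?_)
      ((memℓp_two_iff.1 (lp.memℓp f)).mul_left (K ^ 2))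
    rw [norm_mul, mul_pow, Complex.norm_real, Real.norm_eq_abs]
    gcongr
    exact hV x⟩
  map_add' f h := by
    ext x
    exact mul_add _ _ _
  map_smul' c f := by
    ext x
    exact mul_left_comm _ _ _

theorem inner_shiftLp (e : Fin d → ℤ) (f h : EllTwo d) :
    ⟪shiftLp e f, h⟫_ℂ = ⟪f, shiftLp (-e) h⟫_ℂ := by
  rw [lp.inner_eq_tsum, lp.inner_eq_tsum,
    ← (Equiv.addRight e).tsum_eq fun x => ⟪f x, shiftLp (-e) h x⟫_ℂ]
  refine tsum_congr fun x => ?_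
  simp [shiftLp_apply]

theorem isSymmetric_multiplicationLp {V : (Fin d → ℤ) → ℝ} {K : ℝ} (hV : ∀ x, |V x| ≤ K) :
    (multiplicationLp hV).IsSymmetric := fun f h => by
  rw [lp.inner_eq_tsum, lp.inner_eq_tsum]
  refine tsum_congr fun x => ?_
  simp only [multiplicationLp, LinearMap.coe_mk, AddHom.coe_mk, RCLike.inner_apply, map_mul,
    Complex.conj_ofReal]
  ring

theorem isSymmetric_sum_shiftLp :
    (∑ i : Fin d, (shiftLp (Pi.single i 1) + shiftLp (-Pi.single i 1))).IsSymmetric := by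
  intro f h
  simp only [LinearMap.add_apply, LinearMap.sum_apply, inner_add_left, inner_add_right,
    sum_inner, inner_sum, inner_shiftLp, neg_neg]
  exact Finset.sum_congr rfl fun i _ => add_comm _ _

variable {V : (Fin d → ℤ) → ℝ} {K : ℝ}

/-- The Schrödinger operator with a bounded potential as a bounded operator on `ℓ²(ℤ^d)`. -/
noncomputable def boundedSchrodinger (hV : ∀ x, |V x| ≤ K) : EllTwo d →L[ℂ] EllTwo d :=
  (isSymmetric_sum_shiftLp.add (isSymmetric_multiplicationLp hV)).toSelfAdjoint

theorem isSelfAdjoint_boundedSchrodinger (hV : ∀ x, |V x| ≤ K) :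
    IsSelfAdjoint (boundedSchrodinger hV) :=
  (isSymmetric_sum_shiftLp.add (isSymmetric_multiplicationLp hV)).toSelfAdjoint.2

theorem coe_boundedSchrodinger (hV : ∀ x, |V x| ≤ K) (f : EllTwo d) :
    (boundedSchrodinger hV f : (Fin d → ℤ) → ℂ) = schrodingerExpr V f := by
  ext x
  change ((∑ i : Fin d, (shiftLp (Pi.single i 1) + shiftLp (-Pi.single i 1))) f +
    multiplicationLp hV f) x = _
  simp only [LinearMap.add_apply, LinearMap.sum_apply, lp.coeFn_add, lp.coeFn_sum, Pi.add_apply,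
    Finset.sum_apply, shiftLp_apply, schrodingerExpr, sub_eq_add_neg]
  rfl

theorem schrodinger_eq_toPMap (hV : ∀ x, |V x| ≤ K) :
    schrodinger V = (boundedSchrodinger hV : EllTwo d →ₗ[ℂ] EllTwo d).toPMap ⊤ := by
  refine LinearPMap.ext ?_ fun f _ _ => ?_
  · refine eq_top_iff.2 fun f _ => ?_
    change Memℓp (schrodingerExpr V f) 2
    rw [← coe_boundedSchrodinger hV]
    exact lp.memℓp _
  · exact lp.ext (coe_boundedSchrodinger hV f).symm

theorem isSelfAdjoint_schrodinger (hV : ∀ x, |V x| ≤ K) : IsSelfAdjoint (schrodinger V) := by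
  rw [schrodinger_eq_toPMap hV, LinearPMap.isSelfAdjoint_def,
    ContinuousLinearMap.toPMap_adjoint_eq_adjoint_toPMap_of_dense _ (by simp),
    ← ContinuousLinearMap.star_eq_adjoint, (isSelfAdjoint_boundedSchrodinger hV).star_eq]

theorem isEigenvector_schrodinger_iff (hV : ∀ x, |V x| ≤ K) {E : ℂ} {ψ : EllTwo d} :
    IsEigenvector (schrodinger V) E ψ ↔
      HasEigenvector (boundedSchrodinger hV : EllTwo d →ₗ[ℂ] EllTwo d) E ψ := by
  rw [schrodinger_eq_toPMap hV, hasEigenvector_iff, mem_eigenspace_iff, and_comm]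
  exact and_congr_right fun _ => ⟨fun ⟨_, h⟩ => h, fun h => ⟨trivial, h⟩⟩

theorem hasPurePointSpectrum_schrodinger_of_iSup_eigenspace (hV : ∀ x, |V x| ≤ K)
    (h : (⨆ E : ℂ, eigenspace (boundedSchrodinger hV : EllTwo d →ₗ[ℂ] EllTwo d)
      E).topologicalClosure = ⊤) : HasPurePointSpectrum (schrodinger V) := by
  refine ⟨isSelfAdjoint_schrodinger hV, eq_top_iff.2 (h.ge.trans ?_)⟩
  refine Submodule.topologicalClosure_mono (iSup_le fun E ψ hψ => ?_)
  rcases eq_or_ne ψ 0 with rfl | hψ0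
  · exact Submodule.zero_mem _
  · exact Submodule.subset_span ⟨E, (isEigenvector_schrodinger_iff hV).2 ⟨hψ, hψ0⟩⟩

theorem inner_single_one (ψ : EllTwo d) (x : Fin d → ℤ) :
    ⟪ψ, lp.single 2 x 1⟫_ℂ = starRingEnd ℂ (ψ x) := by
  rw [lp.inner_single_right]
  simp

theorem eq_zero_of_inner_single_eq_zero {ψ : EllTwo d}
    (h : ∀ x, ⟪ψ, lp.single 2 x 1⟫_ℂ = 0) : ψ = 0 := by
  ext x
  simpa [inner_single_one] using h x

theorem boundedSchrodinger_single (hV : ∀ x, |V x| ≤ K) (x : Fin d → ℤ) :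
    boundedSchrodinger hV (lp.single 2 x 1) =
      (∑ i : Fin d, (lp.single 2 (x + Pi.single i 1) 1 + lp.single 2 (x - Pi.single i 1) 1)) +
        V x • lp.single 2 x (1 : ℂ) := by
  ext y
  rw [coe_boundedSchrodinger, lp.coeFn_add, lp.coeFn_sum, Pi.add_apply, Finset.sum_apply,
    lp.coeFn_smul, Pi.smul_apply]
  simp only [schrodingerExpr, lp.coeFn_add, Pi.add_apply, lp.single_apply, Pi.single_apply]
  congr 1
  · refine Finset.sum_congr rfl fun i _ => ?_
    rw [add_comm]
    simp only [sub_eq_iff_eq_add, eq_sub_iff_add_eq]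
  · split_ifs with h <;> simp [h]

theorem hasEigenvalue_boundedSchrodinger_of_isSolutionOn (hV : ∀ x, |V x| ≤ K) {E C : ℝ}
    {ψ : (Fin d → ℤ) → ℝ} (hψ : IsSolutionOn 1 V E ψ Set.univ)
    (hC : ∀ x, |ψ x| ≤ C * Real.exp (-latticeNorm x)) (hψ0 : ψ ≠ 0) :
    HasEigenvalue (boundedSchrodinger hV : EllTwo d →ₗ[ℂ] EllTwo d) (E : ℂ) := by
  refine hasEigenvalue_of_hasEigenvector (x := ⟨_, memℓp_of_abs_le_exp hC⟩) ⟨?_, fun h => ?_⟩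
  · refine mem_eigenspace_iff.2 (lp.ext ((coe_boundedSchrodinger hV _).trans (funext fun x => ?_)))
    have hx := hψ x trivial
    simp only [realSchrodinger, neighborSum, one_mul] at hx
    change schrodingerExpr V (fun x => (ψ x : ℂ)) x = (E : ℂ) * ψ x
    simp only [schrodingerExpr]
    exact_mod_cast hx
  · exact hψ0 (funext fun x => by simpa using congrArg (fun f : EllTwo d => f x) h)

end Operator

section PurePoint

open scoped InnerProductSpace
open Module.End

theorem lintegral_ofReal_mul_sq_le {X : Type*} [MeasurableSpace X] {μ : Measure X} {w : ℝ}
    (hw : 0 ≤ w) (f : Lp ℝ 2 μ) (hf : ‖f‖ ≤ 1) :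
    ∫⁻ E, ENNReal.ofReal (w * f E ^ 2) ∂μ ≤ ENNReal.ofReal w := by
  have hsq : Integrable (fun E => f E ^ 2) μ := (Lp.memLp f).integrable_sq
  have hnorm : ∫ E, f E ^ 2 ∂μ = ‖f‖ ^ 2 := by
    rw [← real_inner_self_eq_norm_sq, L2.inner_def]
    exact integral_congr_ae (ae_of_all _ fun E => by simp [sq])
  rw [← ofReal_integral_eq_lintegral_ofReal (hsq.const_mul w)
    (ae_of_all _ fun E => mul_nonneg hw (sq_nonneg _)), integral_const_mul, hnorm]
  exact ENNReal.ofReal_le_ofReal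
    (mul_le_of_le_one_right hw (pow_le_one₀ (norm_nonneg f) hf))

theorem ae_exists_forall_mul_sq_le {X ι : Type*} [MeasurableSpace X] {μ : Measure X} [Countable ι]
    {w : ι → ℝ} (hw0 : ∀ x, 0 ≤ w x) (hw : Summable w) (p : ι → Lp ℝ 2 μ)
    (hp : ∀ x, ‖p x‖ ≤ 1) : ∀ᵐ E ∂μ, ∃ B, ∀ x, w x * p x E ^ 2 ≤ B := by
  have hmeas : ∀ x, AEMeasurable (fun E => ENNReal.ofReal (w x * p x E ^ 2)) μ := fun x =>
    (((Lp.aestronglyMeasurable (p x)).aemeasurable.pow_const 2).const_mul _).ennreal_ofReal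
  have hfin : ∫⁻ E, ∑' x, ENNReal.ofReal (w x * p x E ^ 2) ∂μ ≠ ∞ := by
    rw [lintegral_tsum hmeas]
    refine ne_top_of_le_ne_top ?_
      (ENNReal.tsum_le_tsum fun x => lintegral_ofReal_mul_sq_le (hw0 x) (p x) (hp x))
    rw [← ENNReal.ofReal_tsum_of_nonneg hw0 hw]
    exact ENNReal.ofReal_ne_top
  filter_upwards [ae_lt_top' (AEMeasurable.tsum hmeas) hfin] with E hE
  exact ⟨_, fun x => (ENNReal.ofReal_le_iff_le_toReal hE.ne).1 (ENNReal.le_tsum x)⟩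

variable {d : ℕ}

theorem ae_exists_abs_le_exp {X : Type*} [MeasurableSpace X] {μ : Measure X}
    (p : (Fin d → ℤ) → Lp ℝ 2 μ) (hp : ∀ x, ‖p x‖ ≤ 1) :
    ∀ᵐ E ∂μ, ∃ C, ∀ x, |p x E| ≤ C * Real.exp (latticeNorm x / 4) := by
  filter_upwards [ae_exists_forall_mul_sq_le (fun x => (Real.exp_pos _).le)
    (summable_exp_neg_latticeNorm (d := d) one_half_pos) p hp] with E ⟨B, hB⟩
  refine ⟨Real.sqrt B, fun x => ?_⟩
  rw [← Real.sqrt_sq (Real.exp_pos (latticeNorm x / 4 : ℝ)).le,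
    ← Real.sqrt_mul' _ (sq_nonneg _), ← Real.exp_nat_mul]
  refine Real.abs_le_sqrt ?_
  have hexp : ((2 : ℕ) * (latticeNorm x / 4) : ℝ) = 1 / 2 * latticeNorm x := by
    push_cast; ring
  rw [hexp, ← div_le_iff₀ (Real.exp_pos _), div_eq_inv_mul, ← Real.exp_neg]
  exact hB x

theorem coeFn_neighborSum_add_smul_ae {X : Type*} [MeasurableSpace X] {μ : Measure X}
    {V : (Fin d → ℤ) → ℝ} (p : (Fin d → ℤ) → Lp ℝ 2 μ) (x : Fin d → ℤ) :
    ∀ᵐ E ∂μ, ((∑ i : Fin d, (p (x + Pi.single i 1) + p (x - Pi.single i 1))) + V x • p x :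
      Lp ℝ 2 μ) E = realSchrodinger 1 V (fun y => p y E) x := by
  have hneigh : ∀ᵐ E ∂μ, ∀ i : Fin d, (p (x + Pi.single i 1) + p (x - Pi.single i 1)) E =
      p (x + Pi.single i 1) E + p (x - Pi.single i 1) E :=
    ae_all_iff.2 fun i => Lp.coeFn_add _ _
  filter_upwards [hneigh, Lp.coeFn_add (∑ i : Fin d, (p (x + Pi.single i 1) +
      p (x - Pi.single i 1))) (V x • p x), Lp.coeFn_smul (V x) (p x),
    Lp.coeFn_fun_finsetSum Finset.univ fun i : Fin d =>
      p (x + Pi.single i 1) + p (x - Pi.single i 1)] with E hneighE hadd hsmul hsum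
  rw [hadd, Pi.add_apply, hsmul, hsum]
  simp only [realSchrodinger, neighborSum, hneighE, one_mul, Pi.smul_apply, smul_eq_mul]

theorem DecayingSolutions.smul {V : (Fin d → ℤ) → ℝ} {g : ℝ} (hg : g ≠ 0)
    (h : DecayingSolutions g⁻¹ V) : DecayingSolutions 1 fun x => g * V x := by
  refine fun E ψ hψ hC => h (g⁻¹ * E) ψ (fun x hx => ?_) hC
  have heq := hψ x hx
  simp only [realSchrodinger, one_mul] at heq ⊢
  rw [mul_assoc, ← heq]
  field_simp

variable {V : (Fin d → ℤ) → ℝ} {K : ℝ}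

theorem ae_isSolutionOn_spectralTransform_single (hV : ∀ x, |V x| ≤ K) (φ : EllTwo d) :
    ∀ᵐ E : spectrum ℝ (boundedSchrodinger hV)
      ∂spectralMeasure (isSelfAdjoint_boundedSchrodinger hV) φ,
      IsSolutionOn 1 V E (fun x => spectralTransform (isSelfAdjoint_boundedSchrodinger hV) φ
        (lp.single 2 x 1) E) Set.univ := by
  have hpoint : ∀ x, ∀ᵐ E : spectrum ℝ (boundedSchrodinger hV)
      ∂spectralMeasure (isSelfAdjoint_boundedSchrodinger hV) φ,
      realSchrodinger 1 V (fun y => spectralTransform (isSelfAdjoint_boundedSchrodinger hV) φ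
        (lp.single 2 y 1) E) x =
        E * spectralTransform (isSelfAdjoint_boundedSchrodinger hV) φ (lp.single 2 x 1) E := by
    intro x
    have hmul := spectralTransform_apply_ae (isSelfAdjoint_boundedSchrodinger hV) φ
      (lp.single 2 x 1)
    rw [boundedSchrodinger_single, map_add, map_sum, map_smul] at hmul
    simp only [map_add] at hmul
    filter_upwards [hmul, coeFn_neighborSum_add_smul_ae (V := V) (fun y =>
      spectralTransform (isSelfAdjoint_boundedSchrodinger hV) φ (lp.single 2 y 1)) x]
      with E hE hexpr
    exact hexpr.symm.trans hE
  filter_upwards [ae_all_iff.2 hpoint] with E hE x _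
  exact hE x

theorem ae_hasEigenvalue_boundedSchrodinger (hV : ∀ x, |V x| ≤ K)
    (hdec : DecayingSolutions 1 V) (x₀ : Fin d → ℤ) :
    ∀ᵐ E : spectrum ℝ (boundedSchrodinger hV)
      ∂spectralMeasure (isSelfAdjoint_boundedSchrodinger hV) (lp.single 2 x₀ 1),
      HasEigenvalue (boundedSchrodinger hV : EllTwo d →ₗ[ℂ] EllTwo d) ((E : ℝ) : ℂ) := by
  have hgrowth := ae_exists_abs_le_exp (fun x =>
    spectralTransform (isSelfAdjoint_boundedSchrodinger hV) (lp.single 2 x₀ 1) (lp.single 2 x 1))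
    fun x => (norm_spectralTransform_le _ _ _).trans (by simp [lp.norm_single])
  filter_upwards [ae_isSolutionOn_spectralTransform_single hV (lp.single 2 x₀ 1), hgrowth,
    spectralTransform_self_ae (isSelfAdjoint_boundedSchrodinger hV) (lp.single 2 x₀ 1)]
    with E hsol hE hself
  obtain ⟨C, hC⟩ := hdec E _ hsol hE
  refine hasEigenvalue_boundedSchrodinger_of_isSolutionOn hV hsol hC fun h => ?_
  exact one_ne_zero (hself.symm.trans (congrFun h x₀))

theorem hasPurePointSpectrum_schrodinger (hV : ∀ x, |V x| ≤ K) (hdec : DecayingSolutions 1 V) :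
    HasPurePointSpectrum (schrodinger V) := by
  have hA := isSelfAdjoint_boundedSchrodinger hV
  have hcount := countable_hasEigenvalue (fun _ => eq_zero_of_inner_single_eq_zero) hA.isSymmetric
  refine hasPurePointSpectrum_schrodinger_of_iSup_eigenspace hV ?_
  rw [Submodule.topologicalClosure_eq_top_iff, Submodule.eq_bot_iff]
  refine fun χ hχ => eq_zero_of_inner_single_eq_zero fun x => ?_
  rw [← Submodule.orthogonal_closure] at hχ
  exact Submodule.inner_left_of_mem_orthogonal (mem_topologicalClosure_iSup_eigenspace hA hcount
    (ae_hasEigenvalue_boundedSchrodinger hV hdec x)) hχ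

theorem bddAbove_of_isEigenvector (hV : ∀ x, |V x| ≤ K) (hdec : DecayingSolutions 1 V) {E : ℂ}
    {ψ : EllTwo d} (hψ : IsEigenvector (schrodinger V) E ψ) :
    BddAbove (Set.range fun x : Fin d → ℤ => ‖ψ x‖ * Real.exp (latticeNorm x : ℝ)) := by
  have hA := isSelfAdjoint_boundedSchrodinger hV
  have hvec := (isEigenvector_schrodinger_iff hV).1 hψ
  obtain ⟨E, rfl⟩ := Complex.conj_eq_iff_real.1
    (hA.isSymmetric.conj_eigenvalue_eq_self (hasEigenvalue_of_hasEigenvector hvec))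
  have heq : ∀ x, schrodingerExpr V ψ x = (E : ℂ) * ψ x := fun x => by
    rw [← coe_boundedSchrodinger hV]
    exact congrArg (fun f : EllTwo d => f x) hvec.apply_eq_smul
  have hsmall : ∀ x, ‖ψ x‖ ≤ ‖ψ‖ * Real.exp (latticeNorm x / 4) := fun x =>
    (lp.norm_apply_le_norm two_ne_zero ψ x).trans
      (le_mul_of_one_le_right (norm_nonneg _) (Real.one_le_exp (by positivity)))
  obtain ⟨C₁, hC₁⟩ := hdec E (fun x => (ψ x).re) (fun x _ => by
    simpa [schrodingerExpr, realSchrodinger, neighborSum, Complex.re_sum] using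
      congrArg Complex.re (heq x)) ⟨‖ψ‖, fun x => (Complex.abs_re_le_norm _).trans (hsmall x)⟩
  obtain ⟨C₂, hC₂⟩ := hdec E (fun x => (ψ x).im) (fun x _ => by
    simpa [schrodingerExpr, realSchrodinger, neighborSum, Complex.im_sum] using
      congrArg Complex.im (heq x)) ⟨‖ψ‖, fun x => (Complex.abs_im_le_norm _).trans (hsmall x)⟩
  refine ⟨C₁ + C₂, ?_⟩
  rintro _ ⟨x, rfl⟩
  calc ‖ψ x‖ * Real.exp (latticeNorm x)
      ≤ (C₁ * Real.exp (-latticeNorm x) + C₂ * Real.exp (-latticeNorm x)) *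
          Real.exp (latticeNorm x) := by
        gcongr
        exact (Complex.norm_le_abs_re_add_abs_im _).trans (add_le_add (hC₁ x) (hC₂ x))
    _ = C₁ + C₂ := by
        rw [← add_mul, mul_assoc, ← Real.exp_add, neg_add_cancel, Real.exp_zero, mul_one]

end PurePoint

section Selection

variable {Θ : Type*} [MeasurableSpace Θ] {P : Measure Θ} [IsFiniteMeasure P]

theorem exists_measure_compl_le_add {𝒢 : Set (Set Θ)} (h𝒢 : 𝒢.Nonempty) {ε : ℝ≥0∞} (hε : ε ≠ 0) :
    ∃ G ∈ 𝒢, ∀ G' ∈ 𝒢, P Gᶜ ≤ P G'ᶜ + ε := by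
  obtain ⟨G₀, hG₀⟩ := h𝒢
  have hfin : ⨅ G ∈ 𝒢, P Gᶜ ≠ ∞ := ne_top_of_le_ne_top (measure_ne_top P G₀ᶜ) (iInf₂_le G₀ hG₀)
  have hlt := ENNReal.lt_add_right hfin hε
  simp only [iInf_lt_iff, exists_prop] at hlt
  obtain ⟨G, hG, hlt⟩ := hlt
  exact ⟨G, hG, fun G' hG' => hlt.le.trans (add_le_add_left (iInf₂_le G' hG') _)⟩

theorem exists_forall_mem_tendsto_measure_compl {𝒢 : ℝ → Set (Set Θ)}
    (h𝒢 : ∀ g, (𝒢 g).Nonempty)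
    (h : ∀ ε : ℝ≥0∞, 0 < ε → ∀ᶠ g in atTop, ∃ G ∈ 𝒢 g, P Gᶜ ≤ ε) :
    ∃ G : ℝ → Set Θ, (∀ g, G g ∈ 𝒢 g) ∧ Tendsto (fun g => P (G g)ᶜ) atTop (𝓝 0) := by
  have hpos : ∀ g : ℝ, ENNReal.ofReal (Real.exp (-g)) ≠ 0 := fun g =>
    (ENNReal.ofReal_pos.2 (Real.exp_pos _)).ne'
  choose G hG hmin using fun g => exists_measure_compl_le_add (P := P) (h𝒢 g) (hpos g)
  have hsmall : Tendsto (fun g : ℝ => ENNReal.ofReal (Real.exp (-g))) atTop (𝓝 0) := by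
    simpa using ENNReal.tendsto_ofReal Real.tendsto_exp_neg_atTop_nhds_zero
  refine ⟨G, hG, ENNReal.tendsto_nhds_zero.2 fun ε hε => ?_⟩
  filter_upwards [h (ε / 2) (ENNReal.half_pos hε.ne'),
    ENNReal.tendsto_nhds_zero.1 hsmall (ε / 2) (ENNReal.half_pos hε.ne')] with g ⟨G', hG', hle⟩ hg
  exact (hmin g G' hG').trans ((add_le_add hle hg).trans (ENNReal.add_halves ε).le)

end Selection

end QuasiPeriodic

open QuasiPeriodic in
theorem proposition1_general {d : ℕ}
    {Ω : Type*} [MetricSpace Ω] [MeasurableSpace Ω] [OpensMeasurableSpace Ω]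
    (PΩ : Measure Ω) [SFinite PΩ] [AddAction (Fin d → ℤ) Ω]
    {Θ : Type*} [MeasurableSpace Θ] (PΘ : Measure Θ) [IsProbabilityMeasure PΘ]
    (v : Ω → Θ → ℝ) (κ : ℝ≥0) (hκ : 0 < κ) (A η : ℝ)
    (hΩ : FiniteMetricDimension Ω) (hT : TemperedAction d Ω) (hv : IsHolderProcess v κ)
    (hUPA : UPA d Ω A) (hLIB : LIB PΘ v η) (hAη : A * η < 1) :
    ∃ Θplus : ℝ → Set Θ,
      (∀ g : ℝ, 0 < g → MeasurableSet (Θplus g)) ∧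
      Tendsto (fun g : ℝ => PΘ (Θplus g)) atTop (𝓝 1) ∧
      ∀ g : ℝ, 0 < g → ∀ θ ∈ Θplus g, ∀ᵐ ω ∂PΩ,
        HasPurePointSpectrum (hamiltonian (d := d) v g ω θ) ∧
        ∀ (E : ℂ) (ψ : EllTwo d), IsEigenvector (hamiltonian v g ω θ) E ψ →
          BddAbove (Set.range fun x : Fin d → ℤ => ‖ψ x‖ * Real.exp (latticeNorm x : ℝ)) := by
  let good (g : ℝ) : Set (Set Θ) := {G | MeasurableSet G ∧
    ∀ θ ∈ G, ∀ᵐ ω ∂PΩ, DecayingSolutions g⁻¹ (orbitPotential v ω θ : (Fin d → ℤ) → ℝ)}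
  have hgood : ∀ ε : ℝ≥0∞, 0 < ε → ∀ᶠ g in atTop, ∃ G ∈ good g, PΘ Gᶜ ≤ ε := fun ε hε =>
    (eventually_exists_decayingSolutions PΩ hκ hΩ hT hv hUPA hLIB hAη hε).mono
      fun _ ⟨G, hG, hPG, hdec⟩ => ⟨G, ⟨hG, hdec⟩, hPG⟩
  have hne : ∀ g, (good g).Nonempty := fun _ => ⟨∅, .empty, fun _ hθ => hθ.elim⟩
  obtain ⟨Θplus, hΘplus, hlim⟩ := exists_forall_mem_tendsto_measure_compl hne hgood
  refine ⟨Θplus, fun g _ => (hΘplus g).1, ?_, fun g hg θ hθ => ?_⟩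
  · have hsub := ENNReal.Tendsto.sub tendsto_const_nhds hlim (.inl ENNReal.one_ne_top)
    rw [tsub_zero] at hsub
    refine hsub.congr fun g => ?_
    rw [← prob_compl_eq_one_sub (hΘplus g).1.compl, compl_compl]
  · obtain ⟨K, hK⟩ := Set.mem_iUnion.1 ((iUnion_boundedSet hΩ hv).ge (Set.mem_univ θ))
    filter_upwards [(hΘplus g).2 θ hθ] with ω hω
    have hV : ∀ x : Fin d → ℤ, |g * v (x +ᵥ ω) θ| ≤ g * K := fun x => by
      rw [abs_mul, abs_of_pos hg]
      exact mul_le_mul_of_nonneg_left (hK.1 _) hg.le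
    exact ⟨hasPurePointSpectrum_schrodinger hV (hω.smul hg.ne'),
      fun _ _ => bddAbove_of_isEigenvector hV (hω.smul hg.ne')⟩

theorem proposition1 {d : ℕ} (hd : 1 ≤ d)
    {Ω : Type*} [MetricSpace Ω] [MeasurableSpace Ω] [BorelSpace Ω]
    (PΩ : Measure Ω) [IsProbabilityMeasure PΩ]
    [AddAction (Fin d → ℤ) Ω] [MeasurableConstVAdd (Fin d → ℤ) Ω]
    [ErgodicVAdd (Fin d → ℤ) Ω PΩ]
    {Θ : Type*} [MeasurableSpace Θ] (PΘ : Measure Θ) [IsProbabilityMeasure PΘ]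
    (v : Ω → Θ → ℝ) (κ : ℝ≥0) (hκ : 0 < κ) (A η : ℝ)
    (hΩ : QuasiPeriodic.FiniteMetricDimension Ω)
    (hT : QuasiPeriodic.TemperedAction d Ω)
    (hv : QuasiPeriodic.IsHolderProcess v κ)
    (hUPA : QuasiPeriodic.UPA d Ω A)
    (hLIB : QuasiPeriodic.LIB PΘ v η)
    (hAη : A * η < 1) :
    ∃ Θplus : ℝ → Set Θ,
      (∀ g : ℝ, 0 < g → MeasurableSet (Θplus g)) ∧
      Tendsto (fun g : ℝ => PΘ (Θplus g)) atTop (𝓝 1) ∧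
      ∀ g : ℝ, 0 < g → ∀ θ ∈ Θplus g, ∀ᵐ ω ∂PΩ,
        QuasiPeriodic.HasPurePointSpectrum (QuasiPeriodic.hamiltonian (d := d) v g ω θ) ∧
        ∀ (E : ℂ) (ψ : QuasiPeriodic.EllTwo d),
          QuasiPeriodic.IsEigenvector (QuasiPeriodic.hamiltonian v g ω θ) E ψ →
            BddAbove (Set.range fun x : Fin d → ℤ =>
              ‖ψ x‖ * Real.exp (QuasiPeriodic.latticeNorm x : ℝ)) :=
  proposition1_general PΩ PΘ v κ hκ A η hΩ hT hv hUPA hLIB hAη
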